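/- Let $\mathbf x_0\in\mathbb R^n$, $h>0$, let $B_h$ be the open ball of radius $h$ centred at $\mathbf x_0$, and let $\mathcal C_h$ be a corner with apex $\mathbf x_0$, that is, one of the following two sets. (i) $n\in\{2,3\}$ and $\mathcal C_h=\mathcal S\cap B_h$, where $\mathcal S=\{\mathbf x_0\}\cup\{\mathbf y\neq\mathbf x_0:\ \angle(\mathbf y-\mathbf x_0,\mathbf v_0)\le\theta_0\}$ is the closed circular cone with some axis $\mathbf v_0\neq 0$ and some $\theta_0\in(0,\pi/2)$ (a sector of opening angle $2\theta_0$ if $n=2$). (ii) $n=3$ and $\mathcal C_h=\mathcal K\cap B_h$, where $\mathcal K=\{\mathbf x_0+\sum_{j=1}^{\ell}t_j\mathbf e_j:\ t_j\ge 0\}$ with $\ell\ge 3$ pairwise linearly independent vectors $\mathbf e_1,\dots,\mathbf e_\ell$ that span $\mathbb R^3$, and $\mathcal K$ is contained in a cone $\mathcal S$ as in (i) with the same apex. Let $\lambda\in\mathbb C$, $\gamma\in(0,1)$, and let $f:\mathcal C_h\times\mathbb C\to\mathbb C$ be Hölder continuous with exponent $\gamma$ on $\mathcal C_h\times\{z:|z|\le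 R\}$ for every $R>0$. Let $u,v\in H^2_{loc}(\mathcal C_h)$ be complex-valued; this means that all weak derivatives of order at most $2$ in the interior of $\mathcal C_h$ are square integrable on every compact subset of $\mathcal C_h$ (such a set may touch the lateral boundary and the apex, but not $\partial B_h$). Suppose that $$\Delta u+f(\mathbf x,u)=0,\qquad \Delta v+\lambda v=0\qquad\text{a.e. in }\mathcal C_h,$$ $$u=v,\qquad \partial_\nu u=\partial_\nu v\qquad\text{on }\partial\mathcal C_h\setminus\partial B_h,$$ where $\nu$ is the exterior unit normal and the boundary conditions are understood in the sense of Sobolev traces: $\chi(u-v)\in H^1_0(\operatorname{int}\mathcal C_h)$ and $$\int_{\mathcal C_h}\big(\nabla u\cdot\nabla\varphi+\varphi\,\Delta u\big)\,d\mathbf x=\int_{\mathcal C_h}\big(\nabla v\cdot\nabla\varphi+\varphi\,\Delta v\big)\,d\mathbf x$$ for all $\chi,\varphi\in C_c^\infty(\mathbb R^n)$ that vanish near $\partial\mathcal C_h\cap\partial B_h$. Then $u$ has a (unique) representative that is continuous on $\mathcal C_h$, and, with $u(\mathbf x_0)$ denoting the value of this representative at the apex, $$\lambda u(\mathbf x_0)-f(\mathbf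 x_0,u(\mathbf x_0))=0 .$$ -/

import Mathlib

open MeasureTheory Filter Topology Set Metric
open scoped ContDiff NNReal ENNReal

/-! ### Geometry: conic and polyhedral corners -/

/-- The closed conic cone with apex `x₀`, axis `v₀` and half opening angle `θ`. The apex is listed
separately because `InnerProductGeometry.angle 0 v₀ = π / 2` by convention. -/
def conicCone {n : ℕ} (x₀ v₀ : EuclideanSpace ℝ (Fin n)) (θ : ℝ) :
    Set (EuclideanSpace ℝ (Fin n)) :=
  {y | y = x₀ ∨ InnerProductGeometry.angle (y - x₀) v₀ ≤ θ}

/-- The polyhedral cone with apex `x₀` spanned by the vectors `e j`. -/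
def polyhedralCone {n ℓ : ℕ} (x₀ : EuclideanSpace ℝ (Fin n))
    (e : Fin ℓ → EuclideanSpace ℝ (Fin n)) : Set (EuclideanSpace ℝ (Fin n)) :=
  {y | ∃ t : Fin ℓ → ℝ, (∀ j, 0 ≤ t j) ∧ y = x₀ + ∑ j, t j • e j}

/-- `C` is a (convex) corner of radius `h` with apex `x₀`: in dimension 2 or 3 a truncated conic
cone of opening angle `2 θ ∈ (0, π)` (a sector if `n = 2`), or in dimension 3 a truncated
polyhedral cone with at least three pairwise independent edges, which is three-dimensional and
fits into a strictly convex conic cone with the same apex. -/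
def IsConvexCorner {n : ℕ} (x₀ : EuclideanSpace ℝ (Fin n)) (h : ℝ)
    (C : Set (EuclideanSpace ℝ (Fin n))) : Prop :=
  0 < h ∧
    (((n = 2 ∨ n = 3) ∧ ∃ (v₀ : EuclideanSpace ℝ (Fin n)) (θ : ℝ),
        v₀ ≠ 0 ∧ 0 < θ ∧ θ < Real.pi / 2 ∧ C = conicCone x₀ v₀ θ ∩ ball x₀ h) ∨
     (n = 3 ∧ ∃ (ℓ : ℕ) (e : Fin ℓ → EuclideanSpace ℝ (Fin n)),
        3 ≤ ℓ ∧ (∀ i j, i ≠ j → LinearIndependent ℝ ![e i, e j]) ∧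
        Submodule.span ℝ (range e) = ⊤ ∧
        (∃ (v₀ : EuclideanSpace ℝ (Fin n)) (θ : ℝ),
          v₀ ≠ 0 ∧ 0 < θ ∧ θ < Real.pi / 2 ∧ polyhedralCone x₀ e ⊆ conicCone x₀ v₀ θ) ∧
        C = polyhedralCone x₀ e ∩ ball x₀ h))

/-! ### Weak derivatives and Sobolev spaces -/

/-- The classical partial derivative `∂ᵢ φ`. -/
noncomputable def partialDeriv {n : ℕ} (i : Fin n) (φ : EuclideanSpace ℝ (Fin n) → ℂ)
    (x : EuclideanSpace ℝ (Fin n)) : ℂ :=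
  fderiv ℝ φ x (EuclideanSpace.single i 1)

/-- Test functions on all of `ℝⁿ`: smooth with compact support. -/
def IsTestFun {n : ℕ} (φ : EuclideanSpace ℝ (Fin n) → ℂ) : Prop :=
  ContDiff ℝ ∞ φ ∧ HasCompactSupport φ

/-- `g` is the weak partial derivative `∂ᵢ u` in the open set `U`
(for `u`, `g` locally integrable in `U`). -/
def HasWeakPartialDeriv {n : ℕ} (U : Set (EuclideanSpace ℝ (Fin n))) (i : Fin n)
    (u g : EuclideanSpace ℝ (Fin n) → ℂ) : Prop :=
  ∀ φ : EuclideanSpace ℝ (Fin n) → ℂ, IsTestFun φ → tsupport φ ⊆ U →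
    ∫ x in U, u x * partialDeriv i φ x = - ∫ x in U, g x * φ x

/-- `w` is square integrable on every compact subset of `C`. -/
def MemL2Loc {n : ℕ} (C : Set (EuclideanSpace ℝ (Fin n)))
    (w : EuclideanSpace ℝ (Fin n) → ℂ) : Prop :=
  ∀ A : Set (EuclideanSpace ℝ (Fin n)), IsCompact A → A ⊆ C → MemLp w 2 (volume.restrict A)

/-- `u ∈ H²_loc(C)`, with weak gradient `Du` and weak Hessian `D2u`: the weak derivatives are taken
in the interior of `C`, and all derivatives up to order two are square integrable on the compact
subsets of `C`. (If `C` contains a part of its boundary, these compact sets may touch it.) -/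
structure IsH2Loc {n : ℕ} (C : Set (EuclideanSpace ℝ (Fin n)))
    (u : EuclideanSpace ℝ (Fin n) → ℂ) (Du : Fin n → EuclideanSpace ℝ (Fin n) → ℂ)
    (D2u : Fin n → Fin n → EuclideanSpace ℝ (Fin n) → ℂ) : Prop where
  memL2 : MemL2Loc C u
  memL2_grad : ∀ i, MemL2Loc C (Du i)
  memL2_hess : ∀ i j, MemL2Loc C (D2u i j)
  weak_grad : ∀ i, HasWeakPartialDeriv (interior C) i u (Du i)
  weak_hess : ∀ i j, HasWeakPartialDeriv (interior C) j (Du i) (D2u i j)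

/-- The Laplacian, read off from the (weak) Hessian. -/
noncomputable def laplacianOf {n : ℕ} (D2u : Fin n → Fin n → EuclideanSpace ℝ (Fin n) → ℂ)
    (x : EuclideanSpace ℝ (Fin n)) : ℂ :=
  ∑ i, D2u i i x

/-- `w ∈ H¹₀(U)` with weak gradient `Dw`: the `H¹(U)`-limit of smooth functions compactly supported
in `U`. -/
def MemH10 {n : ℕ} (U : Set (EuclideanSpace ℝ (Fin n))) (w : EuclideanSpace ℝ (Fin n) → ℂ)
    (Dw : Fin n → EuclideanSpace ℝ (Fin n) → ℂ) : Prop :=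
  ∃ ψ : ℕ → EuclideanSpace ℝ (Fin n) → ℂ,
    (∀ k, IsTestFun (ψ k) ∧ tsupport (ψ k) ⊆ U) ∧
    Tendsto (fun k => eLpNorm (fun x => ψ k x - w x) 2 (volume.restrict U)) atTop (𝓝 0) ∧
    ∀ i, Tendsto (fun k => eLpNorm (fun x => partialDeriv i (ψ k) x - Dw i x) 2
      (volume.restrict U)) atTop (𝓝 0)

/-! ### Cauchy data on a part of the boundary -/

/-- `u = v` on the part `Γ` of `∂C`, in the sense of `H¹`: for every smooth cutoff `χ` vanishing
near `∂C ∖ Γ`, the function `χ (u - v)` belongs to `H¹₀`. -/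
def DirichletEqOn {n : ℕ} (C Γ : Set (EuclideanSpace ℝ (Fin n)))
    (u : EuclideanSpace ℝ (Fin n) → ℂ) (Du : Fin n → EuclideanSpace ℝ (Fin n) → ℂ)
    (v : EuclideanSpace ℝ (Fin n) → ℂ) (Dv : Fin n → EuclideanSpace ℝ (Fin n) → ℂ) : Prop :=
  ∀ χ : EuclideanSpace ℝ (Fin n) → ℂ, IsTestFun χ → Disjoint (tsupport χ) (frontier C \ Γ) →
    MemH10 (interior C) (fun x => χ x * (u x - v x))
      (fun i x => partialDeriv i χ x * (u x - v x) + χ x * (Du i x - Dv i x))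

/-- The pairing `⟨∂_ν u, φ⟩ = ∫_C (∇u · ∇φ + Δu φ)` of the exterior normal derivative of `u` on `∂C`
(an element of `H^{-1/2}`) with the boundary values of `φ`. -/
noncomputable def normalDerivPairing {n : ℕ} (C : Set (EuclideanSpace ℝ (Fin n)))
    (Du : Fin n → EuclideanSpace ℝ (Fin n) → ℂ)
    (D2u : Fin n → Fin n → EuclideanSpace ℝ (Fin n) → ℂ)
    (φ : EuclideanSpace ℝ (Fin n) → ℂ) : ℂ :=
  ∫ x in C, ((∑ i, Du i x * partialDeriv i φ x) + laplacianOf D2u x * φ x)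

/-- `∂_ν u = ∂_ν v` on the part `Γ` of `∂C`: the normal derivatives agree against all test functions
whose boundary values are supported in `Γ`. -/
def NeumannEqOn {n : ℕ} (C Γ : Set (EuclideanSpace ℝ (Fin n)))
    (Du : Fin n → EuclideanSpace ℝ (Fin n) → ℂ)
    (D2u : Fin n → Fin n → EuclideanSpace ℝ (Fin n) → ℂ)
    (Dv : Fin n → EuclideanSpace ℝ (Fin n) → ℂ)
    (D2v : Fin n → Fin n → EuclideanSpace ℝ (Fin n) → ℂ) : Prop :=
  ∀ φ : EuclideanSpace ℝ (Fin n) → ℂ, IsTestFun φ → Disjoint (tsupport φ) (frontier C \ Γ) →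
    normalDerivPairing C Du D2u φ = normalDerivPairing C Dv D2v φ

/-! ### The nonlinearity -/

/-- `f(x, z)` is `C^γ` in `(x, z) ∈ C × ℂ`, with constants that are uniform for bounded `z`
(which includes polynomials in `z`). -/
def IsHolderNonlinearity {n : ℕ} (C : Set (EuclideanSpace ℝ (Fin n))) (γ : ℝ≥0)
    (f : EuclideanSpace ℝ (Fin n) → ℂ → ℂ) : Prop :=
  ∀ R : ℝ, ∃ M : ℝ≥0, HolderOnWith M γ
    (fun p : EuclideanSpace ℝ (Fin n) × ℂ => f p.1 p.2) (C ×ˢ closedBall (0 : ℂ) R)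

/-! Place the apex at the origin, so that the corner is a closed convex cone $K$, with nonempty
interior and no line in it, cut off by a ball.

Regularity. In dimension at most three, an $H^2_{loc}$ function on the truncated cone has a
continuous representative up to the lateral boundary and the apex. It is averaged against a bump
supported in the interior of $K$, shrunk to scale $\varepsilon$ and moved to $x$; such means only
look into the cone, even from boundary points. Their second derivative in $\varepsilon$ is
$O(\varepsilon^{-n/2})$ by an $L^2$ estimate (`norm_scaledMean_le`), hence $O(\varepsilon^{-3/2})$.
Two integrations give a Hölder bound in $\varepsilon$, uniform in $x$, so the means converge locally
uniformly (`IsH2Loc.exists_continuousOn_ae_eq`).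

Weak equation. With $w=u-v$ and $g=\Delta w=\lambda v-f(\cdot,u)$, equality of the Cauchy data says
that the extensions of $w$ and $g$ by zero satisfy $\Delta w=g$ as distributions in the ball
(`isWeakCauchySolution_of_cauchyData`). Both have continuous representatives on the corner.

Exponentials. The equation is tested with $\chi e^{\tau\ell}$, where $\ell$ is a complex covector
whose real part is at most $-\delta|y|$ on $K$. Terms with derivatives of the cutoff are
exponentially small. Rescaling by $\tau$ gives $\tau^n\int He^{\tau\ell}\to H(x_0)F(\ell)$ with
$F(\ell)=\int_K e^{\ell}$ (`tendsto_pow_smul_integral_exp`). A real $\ell$ has $\ell\cdot\ell\ne0$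
and $F(\ell)>0$, and the leading order in $\tau$ gives $w(x_0)=0$. If $\ell\cdot\ell=0$, the
$w$-term disappears and $g(x_0)F(\ell)=0$. The two together are the claim, provided that some null
$\ell$ has $F(\ell)\neq0$.

Nonvanishing. For a sector, $F(\ell)$ is explicit (`integral_planarWedge_exp_ne_zero`). For a
circular cone in space, Fubini turns it into the integral of a nonnegative function
(`integral_roundCone_exp`). For a polyhedral cone, the real part of $\ell$ is let degenerate to a
covector that vanishes on a single exposed edge: then $\varepsilon F(\ell_\varepsilon)$ tends to the
transform of the planar wedge that $K$ spans across that edge (`exists_null_covector_of_edge`), so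
it is nonzero for small $\varepsilon$. -/

/-! ### Smooth means at small scales -/

/-- The test function `ψ`, moved to `x` and shrunk by the factor `ε`, with its integral kept. -/
noncomputable def scaledKernel {n : ℕ} (ψ : EuclideanSpace ℝ (Fin n) → ℂ)
    (x : EuclideanSpace ℝ (Fin n)) (ε : ℝ) (z : EuclideanSpace ℝ (Fin n)) : ℂ :=
  (ε ^ n)⁻¹ • ψ (ε⁻¹ • (z - x))

/-- The weighted mean `∫ g (x + ε y) ψ y dy`. -/
noncomputable def scaledMean {n : ℕ} (ψ g : EuclideanSpace ℝ (Fin n) → ℂ)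
    (x : EuclideanSpace ℝ (Fin n)) (ε : ℝ) : ℂ :=
  ∫ z, g z * scaledKernel ψ x ε z

/-- The divergence of the vector field `ξ ↦ ψ ξ • ξ`. -/
noncomputable def radialDivergence {n : ℕ} (ψ : EuclideanSpace ℝ (Fin n) → ℂ)
    (ξ : EuclideanSpace ℝ (Fin n)) : ℂ :=
  (n : ℝ) • ψ ξ + fderiv ℝ ψ ξ ξ

section ScaledKernel

variable {n : ℕ} {ψ g : EuclideanSpace ℝ (Fin n) → ℂ} {x z : EuclideanSpace ℝ (Fin n)} {ε : ℝ}

theorem IsTestFun.coord_smul (hψ : IsTestFun ψ) (i : Fin n) :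
    IsTestFun (fun ξ => ξ i • ψ ξ) := by
  refine ⟨ContDiff.smul (EuclideanSpace.proj (𝕜 := ℝ) i).contDiff hψ.1, hψ.2.mono fun ξ hξ => ?_⟩
  simp only [Function.mem_support] at hξ ⊢
  exact right_ne_zero_of_smul hξ

theorem tsupport_coord_smul_subset (ψ : EuclideanSpace ℝ (Fin n) → ℂ) (i : Fin n) :
    tsupport (fun ξ => ξ i • ψ ξ) ⊆ tsupport ψ :=
  closure_mono fun ξ hξ => by
    simp only [Function.mem_support] at hξ ⊢
    exact right_ne_zero_of_smul hξ

theorem sum_apply_single {F : Type*} [NormedAddCommGroup F] [NormedSpace ℝ F]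
    (L : EuclideanSpace ℝ (Fin n) →L[ℝ] F) (y : EuclideanSpace ℝ (Fin n)) :
    ∑ i, y i • L (EuclideanSpace.single i 1) = L y := by
  conv_rhs => rw [← (EuclideanSpace.basisFun (Fin n) ℝ).sum_repr y]
  simp [map_sum]

theorem hasFDerivAt_scaledKernel (hψ : IsTestFun ψ) :
    HasFDerivAt (scaledKernel ψ x ε)
      ((ε ^ (n + 1))⁻¹ • fderiv ℝ ψ (ε⁻¹ • (z - x))) z := by
  have h1 : HasFDerivAt (fun z : EuclideanSpace ℝ (Fin n) => ε⁻¹ • (z - x))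
      (ε⁻¹ • ContinuousLinearMap.id ℝ _) z :=
    ((hasFDerivAt_id z).sub_const x).const_smul ε⁻¹
  have h2 := ((hψ.1.differentiable (by simp)).differentiableAt.hasFDerivAt
    (x := ε⁻¹ • (z - x))).comp z h1
  convert! h2.const_smul (ε ^ n)⁻¹ using 1
  ext y
  simp [pow_succ, smul_smul, mul_comm]

theorem isTestFun_scaledKernel (hψ : IsTestFun ψ) (hε : ε ≠ 0) :
    IsTestFun (scaledKernel ψ x ε) := by
  refine ⟨?_, ?_⟩
  · exact ContDiff.const_smul _ (hψ.1.comp (by fun_prop))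
  · have : HasCompactSupport (fun z => ψ (ε⁻¹ • (z - x))) :=
      hψ.2.comp_homeomorph ((Homeomorph.subRight x).trans
        (Homeomorph.smulOfNeZero ε⁻¹ (inv_ne_zero hε)))
    exact this.smul_left (f := fun _ => (ε ^ n)⁻¹)

theorem scaledKernel_apply_ne_zero (h : scaledKernel ψ x ε z ≠ 0) :
    ε⁻¹ • (z - x) ∈ Function.support ψ := by
  simp only [scaledKernel] at h
  exact right_ne_zero_of_smul h

theorem tsupport_scaledKernel_subset (hε : ε ≠ 0) :
    tsupport (scaledKernel ψ x ε) ⊆ (fun y => x + ε • y) '' tsupport ψ := by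
  have hc : Continuous fun z : EuclideanSpace ℝ (Fin n) => ε⁻¹ • (z - x) := by fun_prop
  intro z hz
  refine ⟨ε⁻¹ • (z - x), ?_, by simp [smul_smul, hε]⟩
  have : tsupport (scaledKernel ψ x ε) ⊆ (fun z => ε⁻¹ • (z - x)) ⁻¹' tsupport ψ :=
    closure_minimal (fun z hz => subset_closure (scaledKernel_apply_ne_zero hz))
      ((isClosed_tsupport ψ).preimage hc)
  exact this hz

/-- The prefactor $\varepsilon^{-n}$ contributes $n\psi$ and the dilated argument contributes the
radial derivative. Their sum is a divergence, so a derivative in the scale can be traded for spatial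
derivatives. -/
theorem hasDerivAt_scaledKernel (hψ : IsTestFun ψ) (hε : ε ≠ 0) :
    HasDerivAt (fun ε => scaledKernel ψ x ε z)
      (-((ε ^ (n + 1))⁻¹ • radialDivergence ψ (ε⁻¹ • (z - x)))) ε := by
  have h1 : HasDerivAt (fun ε : ℝ => ε⁻¹ • (z - x)) ((-(ε ^ 2)⁻¹) • (z - x)) ε :=
    (hasDerivAt_inv hε).smul_const _
  have h2 := ((hψ.1.differentiable (by simp)).differentiableAt.hasFDerivAt
    (x := ε⁻¹ • (z - x))).comp_hasDerivAt ε h1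
  have h3 : HasDerivAt (fun ε : ℝ => (ε ^ n)⁻¹) (-(n : ℝ) * (ε ^ (n + 1))⁻¹) ε := by
    convert! (hasDerivAt_pow n ε).inv (pow_ne_zero n hε) using 1
    rcases n with _ | m
    · simp
    · field_simp
      simp
      ring
  refine (h3.smul h2).congr_deriv ?_
  have e1 : (-(ε ^ 2)⁻¹) • (z - x) = (-ε⁻¹) • (ε⁻¹ • (z - x)) := by
    rw [smul_smul]; congr 1; field_simp
  rw [e1, map_smul, radialDivergence, smul_add, smul_smul, smul_smul, neg_add, ← neg_smul,
    ← neg_smul, add_comm]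
  congr 1
  · rw [Function.comp_apply]
    congr 1
    ring
  · congr 1
    rw [pow_succ, mul_inv]; ring

theorem sum_partialDeriv_scaledKernel (hψ : IsTestFun ψ) :
    ∑ i, partialDeriv i (scaledKernel (fun ξ => ξ i • ψ ξ) x ε) z =
      (ε ^ (n + 1))⁻¹ • radialDivergence ψ (ε⁻¹ • (z - x)) := by
  have h : ∀ i : Fin n, partialDeriv i (scaledKernel (fun ξ => ξ i • ψ ξ) x ε) z =
      (ε ^ (n + 1))⁻¹ • (ψ (ε⁻¹ • (z - x)) + (ε⁻¹ • (z - x)) i •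
        fderiv ℝ ψ (ε⁻¹ • (z - x)) (EuclideanSpace.single i 1)) := by
    intro i
    rw [partialDeriv, (hasFDerivAt_scaledKernel (hψ.coord_smul i)).fderiv]
    set ξ := ε⁻¹ • (z - x)
    have h1 : HasFDerivAt (fun ξ : EuclideanSpace ℝ (Fin n) => ξ i)
        (EuclideanSpace.proj (𝕜 := ℝ) i) ξ := (EuclideanSpace.proj (𝕜 := ℝ) i).hasFDerivAt
    have h2 := (h1.smul ((hψ.1.differentiable (by simp)).differentiableAt.hasFDerivAt (x := ξ)))
    have h3 : fderiv ℝ (fun ξ : EuclideanSpace ℝ (Fin n) => ξ i • ψ ξ) ξ = _ := h2.fderiv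
    rw [h3]
    simp [add_comm]
  simp_rw [h, ← Finset.smul_sum, Finset.sum_add_distrib, sum_apply_single]
  simp [radialDivergence]

theorem continuous_radialDivergence (hψ : IsTestFun ψ) : Continuous (radialDivergence ψ) := by
  have := hψ.1.continuous_fderiv (by simp)
  unfold radialDivergence
  have h2 := hψ.1.continuous
  fun_prop

theorem radialDivergence_eq_zero {ξ : EuclideanSpace ℝ (Fin n)} (h : ξ ∉ tsupport ψ) :
    radialDivergence ψ ξ = 0 := by
  have h2 : fderiv ℝ ψ ξ = 0 := by
    by_contra h0
    exact h (support_fderiv_subset ℝ h0)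
  simp [radialDivergence, image_eq_zero_of_notMem_tsupport h, h2]

theorem exists_norm_radialDivergence_le (hψ : IsTestFun ψ) :
    ∃ M, ∀ ξ, ‖radialDivergence ψ ξ‖ ≤ M :=
  (HasCompactSupport.intro hψ.2 fun _ hξ =>
    radialDivergence_eq_zero hξ).exists_bound_of_continuous (continuous_radialDivergence hψ)


/-! ### Differentiation and growth of the means in the scale -/

theorem integrable_mul_of_support_subset {A : Set (EuclideanSpace ℝ (Fin n))}
    {k : EuclideanSpace ℝ (Fin n) → ℂ} (hA : MeasurableSet A) (hg : IntegrableOn g A)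
    (hk : Continuous k) (hkc : HasCompactSupport k) (hkA : Function.support k ⊆ A) :
    Integrable (fun z => g z * k z) := by
  obtain ⟨M, hM⟩ := hkc.exists_bound_of_continuous hk
  refine (((integrable_indicator_iff hA).2 hg).mul_bdd hk.aestronglyMeasurable
    (ae_of_all _ hM)).congr (ae_of_all _ fun z => ?_)
  by_cases hz : z ∈ A
  · simp [hz]
  · have : k z = 0 := by
      by_contra h0
      exact hz (hkA h0)
    simp [this]

theorem setIntegral_mul_eq_integral {U : Set (EuclideanSpace ℝ (Fin n))}
    {k : EuclideanSpace ℝ (Fin n) → ℂ} (hk : Function.support k ⊆ U) :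
    ∫ z in U, g z * k z = ∫ z, g z * k z :=
  setIntegral_eq_integral_of_forall_compl_eq_zero fun z hz => by
    have : k z = 0 := by
      by_contra h0
      exact hz (hk h0)
    simp [this]

theorem support_partialDeriv_subset (φ : EuclideanSpace ℝ (Fin n) → ℂ) (i : Fin n) :
    Function.support (partialDeriv i φ) ⊆ tsupport φ := fun z hz =>
  support_fderiv_subset ℝ fun h0 => hz (by simp [partialDeriv, h0])

theorem IsTestFun.partialDeriv {φ : EuclideanSpace ℝ (Fin n) → ℂ} (hφ : IsTestFun φ)
    (i : Fin n) : IsTestFun (partialDeriv i φ) := by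
  refine ⟨?_, HasCompactSupport.intro hφ.2 fun z hz => ?_⟩
  · exact (hφ.1.fderiv_right (m := ∞) (by simp)).clm_apply contDiff_const
  · by_contra h0
    exact hz (support_partialDeriv_subset φ i h0)

/-- The scale derivative of the kernel is minus the spatial divergence of the kernels built from
$\xi_i\psi$. The definition of the weak gradient moves that divergence onto $g$. The new means have
the same form, so the formula can be iterated. -/
theorem hasDerivAt_scaledMean {U A : Set (EuclideanSpace ℝ (Fin n))}
    {Dg : Fin n → EuclideanSpace ℝ (Fin n) → ℂ} {ε₁ : ℝ}
    (hA : MeasurableSet A) (hg : IntegrableOn g A) (hDg : ∀ i, HasWeakPartialDeriv U i g (Dg i))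
    (hψ : IsTestFun ψ)
    (hx : ∀ ε ∈ Ioc 0 ε₁, ∀ y ∈ tsupport ψ, x + ε • y ∈ U ∩ A) (hε : ε ∈ Ioo 0 ε₁) :
    HasDerivAt (scaledMean ψ g x)
      (∑ i, scaledMean (fun ξ => ξ i • ψ ξ) (Dg i) x ε) ε := by
  have hε0 : ε ≠ 0 := hε.1.ne'
  have hsupp : ∀ ε ∈ Ioc 0 ε₁, ∀ ψ' : EuclideanSpace ℝ (Fin n) → ℂ, tsupport ψ' ⊆ tsupport ψ →
      tsupport (scaledKernel ψ' x ε) ⊆ U ∩ A := by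
    intro ε hε ψ' hψ' z hz
    obtain ⟨y, hy, rfl⟩ := tsupport_scaledKernel_subset hε.1.ne' hz
    exact hx ε hε y (hψ' hy)
  have hint : ∀ ε ∈ Ioc 0 ε₁, Integrable fun z => g z * scaledKernel ψ x ε z := fun ε hε =>
    integrable_mul_of_support_subset hA hg (isTestFun_scaledKernel hψ hε.1.ne').1.continuous
      (isTestFun_scaledKernel hψ hε.1.ne').2
      (subset_closure.trans ((hsupp ε hε ψ subset_rfl).trans inter_subset_right))
  obtain ⟨M, hM⟩ := exists_norm_radialDivergence_le hψ
  have hgA := (integrable_indicator_iff hA).2 hg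
  have hmem : Ioo (ε / 2) ε₁ ∈ 𝓝 ε := Ioo_mem_nhds (by linarith [hε.1]) hε.2
  have hpos : ∀ ε' ∈ Ioo (ε / 2) ε₁, ε' ∈ Ioc 0 ε₁ := fun ε' h' =>
    ⟨by linarith [h'.1, hε.1], h'.2.le⟩
  have hzero : ∀ ε' ∈ Ioc 0 ε₁, ∀ z ∉ A, radialDivergence ψ (ε'⁻¹ • (z - x)) = 0 := by
    intro ε' hε' z hz
    refine radialDivergence_eq_zero fun h => hz ?_
    have := (hx ε' hε' _ h).2
    rwa [smul_smul, mul_inv_cancel₀ hε'.1.ne', one_smul, add_sub_cancel] at this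
  have hεm : ε ∈ Ioo (ε / 2) ε₁ := ⟨by linarith [hε.1], hε.2⟩
  -- Keeping the scale above $\varepsilon/2$ bounds the differentiated kernel by a constant, and it
  -- vanishes off `A`, where nothing is known about `g`.
  have key := hasDerivAt_integral_of_dominated_loc_of_deriv_le (μ := volume)
    (F := fun ε z => g z * scaledKernel ψ x ε z)
    (F' := fun ε z => g z * -((ε ^ (n + 1))⁻¹ • radialDivergence ψ (ε⁻¹ • (z - x))))
    (bound := fun z => ‖A.indicator g z‖ * (((ε / 2) ^ (n + 1))⁻¹ * M)) hmem
    (by filter_upwards [hmem] with ε' h' using (hint ε' (hpos ε' h')).aestronglyMeasurable)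
    (hint ε (hpos ε hεm)) ?_ ?_ (hgA.norm.mul_const _) ?_
  · refine key.2.congr_deriv ?_
    simp_rw [← sum_partialDeriv_scaledKernel hψ]
    have hi : ∀ i, tsupport (scaledKernel (fun ξ => ξ i • ψ ξ) x ε) ⊆ U ∩ A := fun i =>
      hsupp ε (hpos ε hεm) _ (tsupport_coord_smul_subset ψ i)
    have hti : ∀ i, IsTestFun (scaledKernel (fun ξ => ξ i • ψ ξ) x ε) := fun i =>
      isTestFun_scaledKernel (hψ.coord_smul i) hε0
    simp_rw [mul_neg, Finset.mul_sum]
    rw [integral_neg, integral_finsetSum, ← Finset.sum_neg_distrib]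
    · refine Finset.sum_congr rfl fun i _ => ?_
      have := hDg i _ (hti i) ((hi i).trans inter_subset_left)
      rw [setIntegral_mul_eq_integral ((support_partialDeriv_subset _ i).trans
        ((hi i).trans inter_subset_left)), setIntegral_mul_eq_integral
        (subset_closure.trans ((hi i).trans inter_subset_left))] at this
      rw [this, neg_neg, scaledMean]
    · intro i _
      exact integrable_mul_of_support_subset hA hg ((hti i).partialDeriv i).1.continuous
        ((hti i).partialDeriv i).2
        ((support_partialDeriv_subset _ i).trans ((hi i).trans inter_subset_right))
  · have hc : Continuous fun z => -((ε ^ (n + 1))⁻¹ • radialDivergence ψ (ε⁻¹ • (z - x))) := by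
      have := continuous_radialDivergence hψ
      fun_prop
    refine (hgA.aestronglyMeasurable.mul hc.aestronglyMeasurable).congr (ae_of_all _ fun z => ?_)
    by_cases hz : z ∈ A
    · simp [hz]
    · simp [hzero ε (hpos ε hεm) z hz]
  · refine ae_of_all _ fun z ε' h' => ?_
    by_cases hz : z ∈ A
    · rw [norm_mul, indicator_of_mem hz, norm_neg, norm_smul]
      have h0 : 0 < ε / 2 := by linarith [hε.1]
      have h1 : ‖(ε' ^ (n + 1))⁻¹‖ ≤ ((ε / 2) ^ (n + 1))⁻¹ := by
        rw [Real.norm_of_nonneg (inv_nonneg.2 (pow_nonneg (hpos ε' h').1.le _))]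
        gcongr
        exact h'.1.le
      gcongr
      exact hM _
    · simp [hzero ε' (hpos ε' h') z hz, hz]
  · refine ae_of_all _ fun z ε' h' => ?_
    exact (hasDerivAt_scaledKernel hψ (hpos ε' h').1.ne').const_mul _

/-- The square of the kernel integrates to $\varepsilon^{-n}\|\psi\|_2^2=s^2\|\psi\|_2^2$. The
weighted inequality $pq\le s p^2+s^{-1}q^2$ with $s=\varepsilon^{-n/2}$ balances the two terms. -/
theorem norm_scaledMean_le {A : Set (EuclideanSpace ℝ (Fin n))} (hA : MeasurableSet A)
    (hg : MemLp g 2 (volume.restrict A)) (hψ : IsTestFun ψ) (hε : 0 < ε)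
    (hx : ∀ y ∈ tsupport ψ, x + ε • y ∈ A) :
    ‖scaledMean ψ g x ε‖ ≤
      ((∫ z in A, ‖g z‖ ^ 2) + ∫ y, ‖ψ y‖ ^ 2) * ε ^ (-(n : ℝ) / 2) := by
  set s : ℝ := ε ^ (-(n : ℝ) / 2) with hs
  have hs0 : 0 < s := Real.rpow_pos_of_pos hε _
  have hss : s * s = (ε ^ n)⁻¹ := by
    rw [hs, ← Real.rpow_add hε, ← Real.rpow_natCast, ← Real.rpow_neg hε.le]
    congr 1; ring
  have hk := isTestFun_scaledKernel (x := x) hψ hε.ne'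
  have hkA : Function.support (scaledKernel ψ x ε) ⊆ A := fun z hz => by
    obtain ⟨y, hy, rfl⟩ := tsupport_scaledKernel_subset hε.ne' (subset_closure hz)
    exact hx y hy
  have hksq : ∫ z, ‖scaledKernel ψ x ε z‖ ^ 2 = (s * s) * ∫ y, ‖ψ y‖ ^ 2 := by
    simp_rw [scaledKernel, norm_smul, mul_pow]
    rw [integral_const_mul, integral_sub_right_eq_self (fun z => ‖ψ (ε⁻¹ • z)‖ ^ 2) x,
      Measure.integral_comp_inv_smul_of_nonneg _ (fun z => ‖ψ z‖ ^ 2) hε.le]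
    simp only [finrank_euclideanSpace, Fintype.card_fin, smul_eq_mul, hss, norm_inv, norm_pow,
      Real.norm_of_nonneg hε.le]
    field_simp
  have hgi : Integrable (A.indicator fun z => ‖g z‖ ^ 2) :=
    (integrable_indicator_iff hA).2 (hg.integrable_norm_pow (p := 2) two_ne_zero)
  have hki : Integrable fun z => ‖scaledKernel ψ x ε z‖ ^ 2 := by
    refine Continuous.integrable_of_hasCompactSupport (hk.1.continuous.norm.pow 2) ?_
    exact hk.2.comp_left (g := fun z : ℂ => ‖z‖ ^ 2) (by simp)
  calc ‖scaledMean ψ g x ε‖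
      ≤ ∫ z, (s * A.indicator (fun z => ‖g z‖ ^ 2) z + s⁻¹ * ‖scaledKernel ψ x ε z‖ ^ 2) := by
        refine norm_integral_le_of_norm_le ((hgi.const_mul _).add (hki.const_mul _))
          (ae_of_all _ fun z => ?_)
        by_cases hz : z ∈ A
        · rw [indicator_of_mem hz, norm_mul]
          set p := ‖g z‖
          set q := ‖scaledKernel ψ x ε z‖
          have : s * p ^ 2 + s⁻¹ * q ^ 2 - p * q = s⁻¹ * ((s * p - q / 2) ^ 2 + 3 / 4 * q ^ 2) := by
            field_simp; ring
          have h2 : 0 ≤ s⁻¹ * ((s * p - q / 2) ^ 2 + 3 / 4 * q ^ 2) := by positivity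
          linarith
        · have : scaledKernel ψ x ε z = 0 := by
            by_contra h0
            exact hz (hkA h0)
          simp [this, hz]
    _ = _ := by
        rw [integral_add (hgi.const_mul _) (hki.const_mul _), integral_const_mul,
          integral_const_mul, hksq, integral_indicator hA]
        field_simp

end ScaledKernel

/-! ### Sobolev embedding on truncated cones -/

/-- A closed convex cone with nonempty interior that lies strictly inside a half-space. -/
structure IsSolidCone {n : ℕ} (K : Set (EuclideanSpace ℝ (Fin n))) : Prop where
  isClosed : IsClosed K
  smul_mem : ∀ t : ℝ, 0 ≤ t → ∀ y ∈ K, t • y ∈ K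
  add_mem : ∀ y ∈ K, ∀ z ∈ K, y + z ∈ K
  interior_nonempty : (interior K).Nonempty
  exists_norm_le_inner : ∃ (a : EuclideanSpace ℝ (Fin n)) (δ : ℝ), 0 < δ ∧
    ∀ y ∈ K, δ * ‖y‖ ≤ inner ℝ a y

/-- The part of the cone `x₀ + K` in the open ball of radius `h` about the apex `x₀`. -/
def truncatedCone {n : ℕ} (x₀ : EuclideanSpace ℝ (Fin n)) (K : Set (EuclideanSpace ℝ (Fin n)))
    (h : ℝ) : Set (EuclideanSpace ℝ (Fin n)) :=
  {x | x - x₀ ∈ K} ∩ ball x₀ h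

/-- The part of the cone `x₀ + K` in the closed ball of radius `r` about the apex `x₀`. -/
def closedTruncatedCone {n : ℕ} (x₀ : EuclideanSpace ℝ (Fin n))
    (K : Set (EuclideanSpace ℝ (Fin n))) (r : ℝ) : Set (EuclideanSpace ℝ (Fin n)) :=
  {x | x - x₀ ∈ K} ∩ closedBall x₀ r

theorem norm_sub_le_sub_of_deriv_le {F : Type*} [NormedAddCommGroup F] [NormedSpace ℝ F]
    {f f' : ℝ → F} {B B' : ℝ → ℝ} {a b : ℝ} (hab : a ≤ b)
    (hf : ∀ t ∈ Icc a b, HasDerivAt f (f' t) t) (hB : ∀ t ∈ Icc a b, HasDerivAt B (B' t) t)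
    (h : ∀ t ∈ Icc a b, ‖f' t‖ ≤ B' t) : ‖f b - f a‖ ≤ B b - B a :=
  image_norm_le_of_norm_deriv_right_le_deriv_boundary' (f := fun t => f t - f a) (f' := f')
    (B := fun t => B t - B a) (B' := B')
    (fun t ht => ((hf t ht).sub_const _).continuousAt.continuousWithinAt)
    (fun t ht => ((hf t (Ico_subset_Icc_self ht)).sub_const _).hasDerivWithinAt) (by simp)
    (fun t ht => ((hB t ht).sub_const _).continuousAt.continuousWithinAt)
    (fun t ht => ((hB t (Ico_subset_Icc_self ht)).sub_const _).hasDerivWithinAt)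
    (fun t ht => h t (Ico_subset_Icc_self ht)) (right_mem_Icc.2 hab)

/-- A function on `(0, ε₀]` whose second derivative is `O(t ^ (-3/2))` is Hölder continuous
with exponent `1/2`. -/
theorem norm_sub_le_sqrt_sub_sqrt {φ φ' φ'' : ℝ → ℂ} {ε₀ M : ℝ} (hε₀ : ε₀ ≤ 1)
    (h1 : ∀ t ∈ Ioc 0 ε₀, HasDerivAt φ (φ' t) t) (h2 : ∀ t ∈ Ioc 0 ε₀, HasDerivAt φ' (φ'' t) t)
    (hM0 : ‖φ' ε₀‖ ≤ M) (hM : ∀ t ∈ Ioc 0 ε₀, ‖φ'' t‖ ≤ M * t ^ (-(3 : ℝ) / 2)) {a b : ℝ}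
    (ha : 0 < a) (hab : a ≤ b) (hb : b ≤ ε₀) :
    ‖φ b - φ a‖ ≤ 6 * M * (√b - √a) := by
  have hM' : 0 ≤ M := (norm_nonneg _).trans hM0
  -- Integrating `φ''` from `t` to `ε₀` costs at most $2Mt^{-1/2}$; the end value `M` is at most
  -- $Mt^{-1/2}$ because `t ≤ 1`.
  have hφ' : ∀ t ∈ Ioc 0 ε₀, ‖φ' t‖ ≤ 3 * M * t ^ (-(1 : ℝ) / 2) := by
    intro t ht
    have := norm_sub_le_sub_of_deriv_le (f := φ') (B := fun s => -2 * M * s ^ (-(1 : ℝ) / 2))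
      (B' := fun s => M * s ^ (-(3 : ℝ) / 2)) ht.2
      (fun s hs => h2 s ⟨ht.1.trans_le hs.1, hs.2⟩)
      (fun s hs => by
        have := (Real.hasDerivAt_rpow_const (x := s) (p := -(1 : ℝ) / 2)
          (Or.inl (ht.1.trans_le hs.1).ne')).const_mul (-2 * M)
        refine this.congr_deriv ?_
        norm_num
        ring)
      (fun s hs => hM s ⟨ht.1.trans_le hs.1, hs.2⟩)
    have h3 : ‖φ' t‖ ≤ ‖φ' ε₀‖ + ‖φ' ε₀ - φ' t‖ := by
      simpa using norm_sub_le (φ' ε₀) (φ' ε₀ - φ' t)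
    have h4 : 0 ≤ ε₀ ^ (-(1 : ℝ) / 2) := Real.rpow_nonneg (ht.1.le.trans ht.2) _
    have h5 : 1 ≤ t ^ (-(1 : ℝ) / 2) :=
      Real.one_le_rpow_of_pos_of_le_one_of_nonpos ht.1 (ht.2.trans hε₀) (by norm_num)
    nlinarith
  have := norm_sub_le_sub_of_deriv_le (f := φ) (f' := φ') (B := fun s => 6 * M * √s)
    (B' := fun s => 3 * M * s ^ (-(1 : ℝ) / 2)) hab
    (fun s hs => h1 s ⟨ha.trans_le hs.1, hs.2.trans hb⟩)
    (fun s hs => by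
      have hs0 := ha.trans_le hs.1
      refine ((Real.hasDerivAt_sqrt hs0.ne').const_mul (6 * M)).congr_deriv ?_
      rw [neg_div, Real.rpow_neg hs0.le, ← Real.sqrt_eq_rpow]
      field_simp
      ring)
    (fun s hs => hφ' s ⟨ha.trans_le hs.1, hs.2.trans hb⟩)
  linarith

section Cone

variable {n : ℕ} {K : Set (EuclideanSpace ℝ (Fin n))} {x₀ x y : EuclideanSpace ℝ (Fin n)}
  {h r r' ε R : ℝ}

/-- The translate $x+\varepsilon\operatorname{int}K$ is open and contained in $K$. This lets means
centred at boundary points, including the apex, use interior values only. -/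
theorem IsSolidCone.add_smul_mem_interior (hK : IsSolidCone K) (hx : x ∈ K) (hy : y ∈ interior K)
    (hε : 0 < ε) : x + ε • y ∈ interior K := by
  have ho : IsOpen ((fun y => x + ε • y) '' interior K) :=
    ((Homeomorph.smulOfNeZero ε hε.ne').trans (Homeomorph.addLeft x)).isOpenMap _ isOpen_interior
  refine interior_maximal ?_ ho ⟨y, hy, rfl⟩
  rintro _ ⟨z, hz, rfl⟩
  exact hK.add_mem _ hx _ (hK.smul_mem _ hε.le _ (interior_subset hz))

theorem IsSolidCone.zero_mem (hK : IsSolidCone K) : 0 ∈ K := by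
  obtain ⟨y, hy⟩ := hK.interior_nonempty
  simpa using hK.smul_mem 0 le_rfl y (interior_subset hy)

theorem IsSolidCone.convex (hK : IsSolidCone K) : Convex ℝ K := fun _ hx _ hy a b ha hb _ =>
  hK.add_mem _ (hK.smul_mem a ha _ hx) _ (hK.smul_mem b hb _ hy)

theorem IsSolidCone.convex_truncatedCone (hK : IsSolidCone K) :
    Convex ℝ (truncatedCone x₀ K h) := by
  refine Convex.inter ?_ (convex_ball x₀ h)
  simpa [sub_eq_add_neg, add_comm] using! hK.convex.translate_preimage_right (-x₀)

theorem isClosed_preimage_sub (hK : IsSolidCone K) : IsClosed {x | x - x₀ ∈ K} :=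
  hK.isClosed.preimage (continuous_id.sub continuous_const)

theorem isCompact_closedTruncatedCone (hK : IsSolidCone K) :
    IsCompact (closedTruncatedCone x₀ K r) :=
  (isCompact_closedBall x₀ r).inter_left (isClosed_preimage_sub hK)

theorem closedTruncatedCone_subset (hr : r < h) :
    closedTruncatedCone x₀ K r ⊆ truncatedCone x₀ K h :=
  inter_subset_inter_right _ (closedBall_subset_ball hr)

theorem measurableSet_truncatedCone (hK : IsSolidCone K) :
    MeasurableSet (truncatedCone x₀ K h) :=
  (isClosed_preimage_sub hK).measurableSet.inter measurableSet_ball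

theorem preimage_interior_subset_interior_truncatedCone :
    {x | x - x₀ ∈ interior K} ∩ ball x₀ h ⊆ interior (truncatedCone x₀ K h) :=
  interior_maximal (inter_subset_inter_left _ fun _ hx => interior_subset (s := K) hx)
    ((isOpen_interior.preimage (continuous_id.sub continuous_const)).inter isOpen_ball)

theorem IsSolidCone.add_smul_mem_truncatedCone (hK : IsSolidCone K)
    (hx : x ∈ closedTruncatedCone x₀ K r) (hy : y ∈ interior K) (hyR : ‖y‖ ≤ R) (hε : 0 < ε)
    (hr' : r + ε * R ≤ r') (hrh : r' < h) :
    x + ε • y ∈ interior (truncatedCone x₀ K h) ∩ closedTruncatedCone x₀ K r' := by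
  have h1 : x + ε • y - x₀ ∈ interior K := by
    rw [add_sub_right_comm]
    exact hK.add_smul_mem_interior hx.1 hy hε
  have h2 : x + ε • y ∈ closedBall x₀ r' := by
    have := hx.2
    rw [mem_closedBall, dist_eq_norm] at this ⊢
    rw [add_sub_right_comm]
    refine (norm_add_le _ _).trans ?_
    rw [norm_smul, Real.norm_of_nonneg hε.le]
    nlinarith
  exact ⟨preimage_interior_subset_interior_truncatedCone
    ⟨h1, closedBall_subset_ball hrh h2⟩, interior_subset (s := K) h1, h2⟩

variable {u : EuclideanSpace ℝ (Fin n) → ℂ} {Du : Fin n → EuclideanSpace ℝ (Fin n) → ℂ}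
  {D2u : Fin n → Fin n → EuclideanSpace ℝ (Fin n) → ℂ} {ψ : EuclideanSpace ℝ (Fin n) → ℂ}

theorem IsSolidCone.exists_pos_forall_add_smul_mem (hK : IsSolidCone K) (hψ : IsTestFun ψ)
    (hψK : tsupport ψ ⊆ interior K) (hr : r < h) :
    ∃ ε₁ : ℝ, 0 < ε₁ ∧ ε₁ ≤ 1 ∧ ∀ x ∈ closedTruncatedCone x₀ K r, ∀ ε ∈ Ioc 0 ε₁, ∀ y ∈ tsupport ψ,
      x + ε • y ∈ interior (truncatedCone x₀ K h) ∩ closedTruncatedCone x₀ K ((r + h) / 2) := by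
  obtain ⟨R, hR⟩ := hψ.2.isBounded.exists_norm_le
  have hR' : 0 < |R| + 1 := by positivity
  -- A shift of length at most $(h-r)/2$ keeps the point within radius $(r+h)/2$. The cap at 1 makes
  -- powers of the scale comparable later on.
  refine ⟨min 1 ((h - r) / 2 / (|R| + 1)), lt_min one_pos (by have := sub_pos.2 hr; positivity),
    min_le_left _ _, fun x hx ε hε y hy => ?_⟩
  refine hK.add_smul_mem_truncatedCone hx (hψK hy) (R := |R| + 1)
    ((hR y hy).trans ((le_abs_self R).trans (by simp))) hε.1 ?_ (by linarith)
  have := (le_div_iff₀ hR').1 (hε.2.trans (min_le_right _ _))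
  linarith

theorem MemL2Loc.integrableOn {C A : Set (EuclideanSpace ℝ (Fin n))}
    {g : EuclideanSpace ℝ (Fin n) → ℂ} (hg : MemL2Loc C g) (hA : IsCompact A) (hAC : A ⊆ C) :
    IntegrableOn g A :=
  have : IsFiniteMeasure (volume.restrict A) := ⟨by simpa using hA.measure_lt_top⟩
  (hg A hA hAC).integrable one_le_two

/-- Along a cone that contains the support of `ψ`, the means of an `H²` function over small scales
are uniformly Hölder continuous in the scale. -/
theorem IsH2Loc.exists_norm_scaledMean_sub_le (hn : n ≤ 3) (hK : IsSolidCone K)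
    (hu : IsH2Loc (truncatedCone x₀ K h) u Du D2u) (hψ : IsTestFun ψ)
    (hψK : tsupport ψ ⊆ interior K) (hr : r < h) :
    ∃ ε₀ : ℝ, 0 < ε₀ ∧ ∃ M : ℝ, ∀ x ∈ closedTruncatedCone x₀ K r, ∀ a b, 0 < a → a ≤ b → b ≤ ε₀ →
      ‖scaledMean ψ u x b - scaledMean ψ u x a‖ ≤ M * (√b - √a) := by
  obtain ⟨ε₁, hε₁, hε₁', hmem⟩ := hK.exists_pos_forall_add_smul_mem (x₀ := x₀) hψ hψK hr
  set A := closedTruncatedCone x₀ K ((r + h) / 2) with hAdef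
  have hA : IsCompact A := isCompact_closedTruncatedCone hK
  have hAC : A ⊆ truncatedCone x₀ K h := closedTruncatedCone_subset (by linarith)
  have hti : ∀ i, IsTestFun (fun ξ : EuclideanSpace ℝ (Fin n) => ξ i • ψ ξ) :=
    fun i => hψ.coord_smul i
  have hsi : ∀ i, tsupport (fun ξ : EuclideanSpace ℝ (Fin n) => ξ i • ψ ξ) ⊆ tsupport ψ :=
    fun i => tsupport_coord_smul_subset ψ i
  set c : Fin n → ℝ := fun i => (∫ z in A, ‖Du i z‖ ^ 2) +
    ∫ y : EuclideanSpace ℝ (Fin n), ‖y i • ψ y‖ ^ 2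
  set d : Fin n → Fin n → ℝ := fun i j => (∫ z in A, ‖D2u i j z‖ ^ 2) +
    ∫ y : EuclideanSpace ℝ (Fin n), ‖y j • y i • ψ y‖ ^ 2
  have hd : ∀ i j, 0 ≤ d i j := fun i j => by positivity
  -- The first summand controls the first derivative at the largest scale $\varepsilon_1/2$, the
  -- second controls the second derivative at all scales.
  set M : ℝ := (∑ i, c i) * (ε₁ / 2) ^ (-(n : ℝ) / 2) + ∑ i, ∑ j, d i j with hMdef
  have hc0 : 0 ≤ (∑ i, c i) * (ε₁ / 2) ^ (-(n : ℝ) / 2) :=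
    mul_nonneg (Finset.sum_nonneg fun i _ => by positivity) (by positivity)
  have hd0 : 0 ≤ ∑ i, ∑ j, d i j :=
    Finset.sum_nonneg fun i _ => Finset.sum_nonneg fun j _ => hd i j
  refine ⟨ε₁ / 2, by positivity, 6 * M, fun x hx a b ha hab hb => ?_⟩
  have hIoo : ∀ t ∈ Ioc 0 (ε₁ / 2), t ∈ Ioo 0 ε₁ := fun t ht => ⟨ht.1, by linarith [ht.2]⟩
  have hmem' := hmem x hx
  refine norm_sub_le_sqrt_sub_sqrt (ε₀ := ε₁ / 2) (M := M)
    (φ := scaledMean ψ u x)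
    (φ' := fun ε => ∑ i, scaledMean (fun ξ => ξ i • ψ ξ) (Du i) x ε)
    (φ'' := fun ε => ∑ i, ∑ j, scaledMean (fun ξ => ξ j • ξ i • ψ ξ) (D2u i j) x ε)
    (by linarith) ?_ ?_ ?_ ?_ ha hab hb
  · exact fun t ht => hasDerivAt_scaledMean hA.measurableSet (hu.memL2.integrableOn hA hAC)
      hu.weak_grad hψ hmem' (hIoo t ht)
  · intro t ht
    refine HasDerivAt.fun_sum fun i _ => ?_
    exact hasDerivAt_scaledMean hA.measurableSet ((hu.memL2_grad i).integrableOn hA hAC)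
      (hu.weak_hess i) (hti i) (fun ε hε y hy => hmem' ε hε y (hsi i hy)) (hIoo t ht)
  · refine (norm_sum_le _ _).trans (le_trans ?_ (le_add_of_nonneg_right hd0))
    rw [Finset.sum_mul]
    refine Finset.sum_le_sum fun i _ => ?_
    exact norm_scaledMean_le hA.measurableSet (hu.memL2_grad i A hA hAC) (hti i) (by positivity)
      fun y hy => (hmem' (ε₁ / 2) ⟨by positivity, by linarith⟩ y (hsi i hy)).2
  · intro t ht
    -- The dimension restriction enters here: the exponent $-n/2$ must exceed $-2$ for two
    -- integrations to leave a bounded function.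
    have h1 : t ^ (-(n : ℝ) / 2) ≤ t ^ (-(3 : ℝ) / 2) := by
      refine Real.rpow_le_rpow_of_exponent_ge ht.1 (by linarith [ht.2]) ?_
      have : (n : ℝ) ≤ 3 := by exact_mod_cast hn
      linarith
    have h2 : ‖∑ i, ∑ j, scaledMean (fun ξ => ξ j • ξ i • ψ ξ) (D2u i j) x t‖ ≤
        (∑ i, ∑ j, d i j) * t ^ (-(n : ℝ) / 2) := by
      simp_rw [Finset.sum_mul]
      refine (norm_sum_le _ _).trans (Finset.sum_le_sum fun i _ => ?_)
      refine (norm_sum_le _ _).trans (Finset.sum_le_sum fun j _ => ?_)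
      refine norm_scaledMean_le hA.measurableSet (hu.memL2_hess i j A hA hAC)
        ((hti i).coord_smul j) ht.1 fun y hy => ?_
      exact (hmem' t ⟨ht.1, (hIoo t ht).2.le⟩ y
        (hsi i (tsupport_coord_smul_subset (fun ξ => ξ i • ψ ξ) j hy))).2
    refine h2.trans ?_
    have h3 : 0 ≤ t ^ (-(n : ℝ) / 2) := Real.rpow_nonneg ht.1.le _
    calc _ ≤ (∑ i, ∑ j, d i j) * t ^ (-(3 : ℝ) / 2) := by gcongr
      _ ≤ _ := by
        have := Real.rpow_nonneg ht.1.le (-(3 : ℝ) / 2)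
        gcongr
        linarith

theorem continuousOn_scaledMean {S A : Set (EuclideanSpace ℝ (Fin n))}
    (hA : MeasurableSet A) (hu : IntegrableOn u A) (hψ : IsTestFun ψ) (hε : ε ≠ 0)
    (hS : ∀ x ∈ S, ∀ y ∈ tsupport ψ, x + ε • y ∈ A) :
    ContinuousOn (fun x => scaledMean ψ u x ε) S := by
  obtain ⟨M, hM⟩ := hψ.2.exists_bound_of_continuous hψ.1.continuous
  have hsupp : ∀ x ∈ S, Function.support (scaledKernel ψ x ε) ⊆ A := fun x hx z hz => by
    obtain ⟨y, hy, rfl⟩ := tsupport_scaledKernel_subset hε (subset_closure hz)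
    exact hS x hx y hy
  refine continuousOn_of_dominated (bound := fun z => ‖A.indicator u z‖ * (‖(ε ^ n)⁻¹‖ * M))
    (fun x hx => ?_) (fun x hx => ae_of_all _ fun z => ?_)
    (((integrable_indicator_iff hA).2 hu).norm.mul_const _) (ae_of_all _ fun z => ?_)
  · have hk := isTestFun_scaledKernel (x := x) hψ hε
    exact (integrable_mul_of_support_subset hA hu hk.1.continuous hk.2
      (hsupp x hx)).aestronglyMeasurable
  · by_cases hz : z ∈ A
    · rw [indicator_of_mem hz, norm_mul, scaledKernel, norm_smul]
      gcongr
      exact hM _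
    · have : scaledKernel ψ x ε z = 0 := by
        by_contra h0
        exact hz (hsupp x hx h0)
      simp [this, hz]
  · have := hψ.1.continuous
    unfold scaledKernel
    fun_prop

theorem integral_scaledKernel (hε : 0 < ε) : ∫ z, scaledKernel ψ x ε z = ∫ y, ψ y := by
  simp_rw [scaledKernel]
  rw [integral_smul, integral_sub_right_eq_self (fun z => ψ (ε⁻¹ • z)) x,
    Measure.integral_comp_inv_smul_of_nonneg _ ψ hε.le]
  rw [finrank_euclideanSpace, Fintype.card_fin, smul_smul, inv_mul_cancel₀ (pow_pos hε n).ne',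
    one_smul]

/-- Smooth means over small scales converge at the Lebesgue points. -/
theorem ae_tendsto_scaledMean (hu : LocallyIntegrable u) (hψ : IsTestFun ψ)
    (hψ1 : ∫ y, ψ y = 1) :
    ∀ᵐ x, Tendsto (scaledMean ψ u x) (𝓝[>] 0) (𝓝 (u x)) := by
  obtain ⟨M, hM⟩ := hψ.2.exists_bound_of_continuous hψ.1.continuous
  obtain ⟨R, hR⟩ := hψ.2.isBounded.exists_norm_le
  set R' := |R| + 1 with hR'def
  have hR' : 0 < R' := by positivity
  have hRR : R ≤ R' := (le_abs_self R).trans (by simp [hR'def])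
  filter_upwards [IsUnifLocDoublingMeasure.ae_tendsto_average_norm_sub (volume : Measure
    (EuclideanSpace ℝ (Fin n))) hu 1] with x hx
  have hlim : Tendsto (fun ε : ℝ => ε * R') (𝓝[>] 0) (𝓝[>] 0) := by
    refine tendsto_nhdsWithin_iff.2 ⟨?_, ?_⟩
    · have : Tendsto (fun ε : ℝ => ε * R') (𝓝 0) (𝓝 (0 * R')) := by
        exact (continuous_id.mul continuous_const).tendsto 0
      rw [zero_mul] at this
      exact this.mono_left nhdsWithin_le_nhds
    · filter_upwards [self_mem_nhdsWithin] with ε hε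
      exact mul_pos hε hR'
  have h1 := hx (fun _ => x) (fun ε : ℝ => ε * R') hlim (by
    filter_upwards [self_mem_nhdsWithin] with ε hε
    have : 0 < ε := hε
    exact mem_closedBall_self (by positivity))
  rw [tendsto_iff_norm_sub_tendsto_zero]
  -- The kernel is at most $M\varepsilon^{-n}$ and lives on a ball of radius $\varepsilon R'$. The
  -- product of this bound with the volume of the ball is the constant `c`, free of $\varepsilon$.
  set c := R' ^ n * volume.real (ball (0 : EuclideanSpace ℝ (Fin n)) 1) * M
  have h2 := h1.const_mul c
  rw [mul_zero] at h2
  refine squeeze_zero' (Eventually.of_forall fun _ => norm_nonneg _) ?_ h2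
  filter_upwards [self_mem_nhdsWithin] with ε hε
  have hε : 0 < ε := hε
  have hk := isTestFun_scaledKernel (x := x) hψ hε.ne'
  have hsupp : Function.support (scaledKernel ψ x ε) ⊆ closedBall x (ε * R') := fun z hz => by
    obtain ⟨y, hy, rfl⟩ := tsupport_scaledKernel_subset hε.ne' (subset_closure hz)
    rw [mem_closedBall, dist_eq_norm, add_sub_cancel_left, norm_smul, Real.norm_of_nonneg hε.le]
    gcongr
    exact (hR y hy).trans hRR
  have hki : Integrable (scaledKernel ψ x ε) :=
    hk.1.continuous.integrable_of_hasCompactSupport hk.2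
  have hball : IntegrableOn u (closedBall x (ε * R')) :=
    hu.integrableOn_isCompact (isCompact_closedBall _ _)
  have hui : Integrable fun z => u z * scaledKernel ψ x ε z :=
    integrable_mul_of_support_subset measurableSet_closedBall hball hk.1.continuous hk.2 hsupp
  have h3 : scaledMean ψ u x ε - u x =
      ∫ z in closedBall x (ε * R'), (u z - u x) * scaledKernel ψ x ε z := by
    rw [setIntegral_mul_eq_integral (g := fun z => u z - u x) hsupp]
    simp_rw [sub_mul]
    rw [integral_sub hui (hki.const_mul _), integral_const_mul, integral_scaledKernel hε, hψ1,
      mul_one, scaledMean]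
  have hfin : volume (closedBall x (ε * R')) ≠ ⊤ := measure_closedBall_lt_top.ne
  rw [h3]
  calc _ ≤ ∫ z in closedBall x (ε * R'), ‖u z - u x‖ * ((ε ^ n)⁻¹ * M) := by
        refine norm_integral_le_of_norm_le ?_ (ae_of_all _ fun z => ?_)
        · exact ((hball.sub (integrableOn_const hfin)).norm).mul_const _
        · rw [norm_mul, scaledKernel, norm_smul, Real.norm_of_nonneg (by positivity)]
          gcongr
          exact hM _
    _ = _ := by
        rw [integral_mul_const, setAverage_eq, measureReal_def, Measure.addHaar_closedBall _ _
          (by positivity), ENNReal.toReal_mul, ENNReal.toReal_ofReal (by positivity),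
          ← measureReal_def]
        have hb : volume.real (ball (0 : EuclideanSpace ℝ (Fin n)) 1) ≠ 0 :=
          (ENNReal.toReal_pos (measure_ball_pos _ _ one_pos).ne' measure_ball_lt_top.ne).ne'
        simp only [c, finrank_euclideanSpace, Fintype.card_fin, smul_eq_mul, mul_pow]
        field_simp

theorem exists_isTestFun_integral_eq_one (hK : (interior K).Nonempty) :
    ∃ ψ : EuclideanSpace ℝ (Fin n) → ℂ,
      IsTestFun ψ ∧ tsupport ψ ⊆ interior K ∧ ∫ y, ψ y = 1 := by
  obtain ⟨v, hv⟩ := hK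
  obtain ⟨r, hr, hrK⟩ := Metric.nhds_basis_closedBall.mem_iff.1 (isOpen_interior.mem_nhds hv)
  let b : ContDiffBump v := ⟨r / 2, r, by positivity, by linarith⟩
  have hs : Function.support (fun y => ((b.normed volume y : ℝ) : ℂ)) = ball v r := by
    rw [← b.support_normed_eq (μ := volume)]
    ext y
    simp
  refine ⟨fun y => ((b.normed volume y : ℝ) : ℂ), ⟨?_, ?_⟩, ?_, ?_⟩
  · exact Complex.ofRealCLM.contDiff.comp b.contDiff_normed
  · exact HasCompactSupport.of_support_subset_isCompact (isCompact_closedBall v r)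
      (hs ▸ ball_subset_closedBall)
  · rw [tsupport, hs]
    exact closure_ball_subset_closedBall.trans hrK
  · rw [integral_complex_ofReal, b.integral_normed, Complex.ofReal_one]

/-- **Sobolev embedding** `H² ⊆ C⁰` up to the lateral boundary and the apex of a truncated cone,
in dimension at most three. -/
theorem IsH2Loc.exists_continuousOn_ae_eq (hn : n ≤ 3) (hK : IsSolidCone K)
    (hu : IsH2Loc (truncatedCone x₀ K h) u Du D2u) :
    ∃ u' : EuclideanSpace ℝ (Fin n) → ℂ, ContinuousOn u' (truncatedCone x₀ K h) ∧
      ∀ᵐ x ∂(volume.restrict (truncatedCone x₀ K h)), u' x = u x := by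
  obtain ⟨ψ, hψ, hψK, hψ1⟩ := exists_isTestFun_integral_eq_one hK.interior_nonempty
  -- The representative is defined pointwise as the limit of the means; `hlim` shows that the limit
  -- exists at every point of the truncated cone.
  set u' : EuclideanSpace ℝ (Fin n) → ℂ := fun x => limUnder (𝓝[>] 0) (scaledMean ψ u x)
  have hlim : ∀ r < h, ∃ ε₀ : ℝ, 0 < ε₀ ∧ ∃ M : ℝ, ∀ x ∈ closedTruncatedCone x₀ K r,
      Tendsto (scaledMean ψ u x) (𝓝[>] 0) (𝓝 (u' x)) ∧
      ∀ ε ∈ Ioc 0 ε₀, ‖scaledMean ψ u x ε - u' x‖ ≤ M * √ε := by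
    intro r hr
    obtain ⟨ε₀, hε₀, M, hM⟩ := hu.exists_norm_scaledMean_sub_le hn hK hψ hψK hr
    refine ⟨ε₀, hε₀, |M|, fun x hx => ?_⟩
    have hb : ∀ a b, 0 < a → a ≤ b → b ≤ ε₀ →
        ‖scaledMean ψ u x b - scaledMean ψ u x a‖ ≤ |M| * √b := fun a b ha hab hb => by
      refine (hM x hx a b ha hab hb).trans ?_
      have h1 := Real.sqrt_le_sqrt hab
      have h2 := Real.sqrt_nonneg a
      calc M * (√b - √a) ≤ |M| * (√b - √a) := by
            exact mul_le_mul_of_nonneg_right (le_abs_self M) (by linarith)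
        _ ≤ |M| * √b := by
            gcongr
            linarith
    have hT : Tendsto (scaledMean ψ u x) (𝓝[>] 0) (𝓝 (u' x)) := by
      refine tendsto_nhds_limUnder (cauchy_map_iff_exists_tendsto.1 (Metric.cauchy_iff.2
        ⟨inferInstance, fun δ hδ => ?_⟩))
      have h0 : Tendsto (fun ε => |M| * √ε) (𝓝[>] 0) (𝓝 0) := by
        have : Tendsto (fun ε => |M| * √ε) (𝓝 0) (𝓝 (|M| * √0)) :=
          (continuous_const.mul Real.continuous_sqrt).tendsto 0
        simpa using this.mono_left nhdsWithin_le_nhds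
      have hev : {ε | |M| * √ε < δ ∧ ε ∈ Ioc 0 ε₀} ∈ 𝓝[>] (0 : ℝ) :=
        (h0.eventually_lt_const hδ).and (Ioc_mem_nhdsGT hε₀)
      refine ⟨_, image_mem_map hev, ?_⟩
      rintro _ ⟨a, ha, rfl⟩ _ ⟨b, hb', rfl⟩
      rcases le_total a b with hab | hab
      · rw [dist_comm, dist_eq_norm]
        exact (hb a b ha.2.1 hab hb'.2.2).trans_lt hb'.1
      · rw [dist_eq_norm]
        exact (hb b a hb'.2.1 hab ha.2.2).trans_lt ha.1
    refine ⟨hT, fun ε hε => ?_⟩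
    refine le_of_tendsto ((tendsto_const_nhds.sub hT).norm) ?_
    filter_upwards [Ioc_mem_nhdsGT hε.1] with a ha
    exact hb a ε ha.1 ha.2 hε.2
  refine ⟨u', ?_, ?_⟩
  · intro x hx
    obtain ⟨r, hxr, hrh⟩ := exists_between (mem_ball.1 hx.2)
    obtain ⟨ε₀, hε₀, M, hM⟩ := hlim r hrh
    obtain ⟨ε₁, hε₁, -, hmem⟩ := hK.exists_pos_forall_add_smul_mem (x₀ := x₀) hψ hψK hrh
    -- A uniform limit of the means, each of which is continuous in its centre.
    have hc : ContinuousOn u' (closedTruncatedCone x₀ K r) := by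
      have hU : TendstoUniformlyOn (fun ε x => scaledMean ψ u x ε) u' (𝓝[>] 0)
          (closedTruncatedCone x₀ K r) := by
        rw [Metric.tendstoUniformlyOn_iff]
        intro δ hδ
        have h0 : Tendsto (fun ε => M * √ε) (𝓝[>] 0) (𝓝 0) := by
          have : Tendsto (fun ε => M * √ε) (𝓝 0) (𝓝 (M * √0)) :=
            (continuous_const.mul Real.continuous_sqrt).tendsto 0
          simpa using this.mono_left nhdsWithin_le_nhds
        filter_upwards [h0.eventually_lt_const hδ, Ioc_mem_nhdsGT hε₀] with ε h1 h2 y hy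
        rw [dist_comm, dist_eq_norm]
        exact ((hM y hy).2 ε h2).trans_lt h1
      refine hU.continuousOn (Eventually.frequently ?_)
      filter_upwards [Ioc_mem_nhdsGT hε₁] with ε hε
      exact continuousOn_scaledMean (isCompact_closedTruncatedCone hK).measurableSet
        (hu.memL2.integrableOn (isCompact_closedTruncatedCone hK)
          (closedTruncatedCone_subset (r := (r + h) / 2) (by linarith))) hψ hε.1.ne'
        fun y hy z hz => (hmem y hy ε hε z hz).2
    refine (hc x ⟨hx.1, hxr.le⟩).mono_of_mem_nhdsWithin ?_
    rw [mem_nhdsWithin]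
    exact ⟨ball x₀ r, isOpen_ball, hxr, fun y hy => ⟨hy.2.1, ball_subset_closedBall hy.1⟩⟩
  · have hcover : truncatedCone x₀ K h =
        ⋃ k : ℕ, closedTruncatedCone x₀ K (h - 1 / ((k : ℝ) + 1)) := by
      refine Subset.antisymm (fun x hx => ?_) (iUnion_subset fun k =>
        closedTruncatedCone_subset (by have : 0 < 1 / ((k : ℝ) + 1) := by positivity
                                       linarith))
      obtain ⟨k, hk⟩ := exists_nat_one_div_lt (sub_pos.2 (mem_ball.1 hx.2))
      refine mem_iUnion.2 ⟨k, hx.1, ?_⟩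
      rw [mem_closedBall]
      linarith
    rw [hcover, ae_restrict_iUnion_iff]
    intro k
    set r := h - 1 / ((k : ℝ) + 1) with hr
    have hrh : r < h := by
      have : 0 < 1 / ((k : ℝ) + 1) := by positivity
      linarith
    set A := closedTruncatedCone x₀ K ((r + h) / 2)
    have hA : IsCompact A := isCompact_closedTruncatedCone hK
    have hAC : A ⊆ truncatedCone x₀ K h := closedTruncatedCone_subset (by linarith)
    -- Lebesgue differentiation needs a locally integrable function on the whole space, so `u` is
    -- cut off to `A`; small means centred in the smaller cone do not notice this.
    have hint : Integrable (A.indicator u) :=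
      (integrable_indicator_iff hA.measurableSet).2 (hu.memL2.integrableOn hA hAC)
    obtain ⟨ε₀, hε₀, M, hM⟩ := hlim r hrh
    obtain ⟨ε₁, hε₁, -, hmem⟩ := hK.exists_pos_forall_add_smul_mem (x₀ := x₀) hψ hψK hrh
    rw [ae_restrict_iff' (isCompact_closedTruncatedCone hK).measurableSet]
    filter_upwards [ae_tendsto_scaledMean hint.locallyIntegrable hψ hψ1] with x hx hxr
    have hxA : x ∈ A := ⟨hxr.1, closedBall_subset_closedBall (by linarith) hxr.2⟩
    rw [indicator_of_mem hxA] at hx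
    refine tendsto_nhds_unique ((hM x hxr).1.congr' ?_) hx
    filter_upwards [Ioc_mem_nhdsGT hε₁] with ε hε
    refine integral_congr_ae (ae_of_all _ fun z => ?_)
    by_cases hz : z ∈ A
    · simp [hz]
    · have : scaledKernel ψ x ε z = 0 := by
        by_contra h0
        obtain ⟨y, hy, rfl⟩ := tsupport_scaledKernel_subset hε.1.ne' (subset_closure h0)
        exact hz (hmem x hxr ε hε y hy).2
      simp [this]

end Cone

/-! ### The weak equation for the difference of two solutions with equal Cauchy data -/

/-- The Laplacian of a smooth function. -/
noncomputable def smoothLaplacian {n : ℕ} (φ : EuclideanSpace ℝ (Fin n) → ℂ)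
    (x : EuclideanSpace ℝ (Fin n)) : ℂ :=
  ∑ i, partialDeriv i (partialDeriv i φ) x

/-- `Δ w = g` in the truncated cone, and `w` has zero Cauchy data on its lateral boundary, in the
sense of distributions: `w` and `g`, extended by zero, satisfy `Δ w = g` in the ball. -/
def IsWeakCauchySolution {n : ℕ} (x₀ : EuclideanSpace ℝ (Fin n))
    (K : Set (EuclideanSpace ℝ (Fin n))) (h : ℝ) (w g : EuclideanSpace ℝ (Fin n) → ℂ) : Prop :=
  ∀ (φ : EuclideanSpace ℝ (Fin n) → ℂ) (r : ℝ), IsTestFun φ → r < h →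
    tsupport φ ⊆ closedBall x₀ r →
    ∫ x in truncatedCone x₀ K h, w x * smoothLaplacian φ x =
      ∫ x in truncatedCone x₀ K h, g x * φ x

section WeakEquation

variable {n : ℕ} {K : Set (EuclideanSpace ℝ (Fin n))} {x₀ : EuclideanSpace ℝ (Fin n)}
  {h r : ℝ} {u v g φ : EuclideanSpace ℝ (Fin n) → ℂ}
  {Du Dv : Fin n → EuclideanSpace ℝ (Fin n) → ℂ}
  {D2u D2v : Fin n → Fin n → EuclideanSpace ℝ (Fin n) → ℂ}

/-- The frontier of a convex set is a null set. This reconciles the weak conditions, posed in the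
interior, with integrals over the corner. -/
theorem IsSolidCone.restrict_interior_truncatedCone (hK : IsSolidCone K) :
    (volume.restrict (interior (truncatedCone x₀ K h)) : Measure (EuclideanSpace ℝ (Fin n))) =
      volume.restrict (truncatedCone x₀ K h) :=
  Measure.restrict_congr_set
    (interior_ae_eq_of_null_frontier (hK.convex_truncatedCone.addHaar_frontier volume))

theorem integrableOn_truncatedCone_mul (hK : IsSolidCone K)
    (hg : MemL2Loc (truncatedCone x₀ K h) g) (hφ : Continuous φ) (hφc : HasCompactSupport φ)
    (hr : r < h) (hφr : tsupport φ ⊆ closedBall x₀ r) :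
    IntegrableOn (fun x => g x * φ x) (truncatedCone x₀ K h) := by
  obtain ⟨M, hM⟩ := hφc.exists_bound_of_continuous hφ
  have hA : IsCompact (closedTruncatedCone x₀ K r) := isCompact_closedTruncatedCone hK
  have h1 : IntegrableOn (fun x => g x * φ x) (closedTruncatedCone x₀ K r) :=
    (hg.integrableOn hA (closedTruncatedCone_subset hr)).mul_bdd hφ.aestronglyMeasurable
      (ae_of_all _ hM)
  refine h1.of_forall_sdiff_eq_zero (measurableSet_truncatedCone hK) fun x hx => ?_
  rw [image_eq_zero_of_notMem_tsupport fun hx' => hx.2 ⟨hx.1.1, hφr hx'⟩, mul_zero]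

theorem memLp_truncatedCone_mul (hK : IsSolidCone K)
    (hg : MemL2Loc (truncatedCone x₀ K h) g) (hφ : Continuous φ) (hφc : HasCompactSupport φ)
    (hr : r < h) (hφr : tsupport φ ⊆ closedBall x₀ r) :
    MemLp (fun x => φ x * g x) 2 (volume.restrict (truncatedCone x₀ K h)) := by
  obtain ⟨M, hM⟩ := hφc.exists_bound_of_continuous hφ
  have hA : IsCompact (closedTruncatedCone x₀ K r) := isCompact_closedTruncatedCone hK
  have h1 : MemLp (fun x => φ x * g x) 2 (volume.restrict (closedTruncatedCone x₀ K r)) :=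
    (hg _ hA (closedTruncatedCone_subset hr)).mul (p := ⊤)
      (memLp_top_of_bound hφ.aestronglyMeasurable M (ae_of_all _ hM))
  rw [← memLp_indicator_iff_restrict hA.measurableSet] at h1
  refine h1.restrict (truncatedCone x₀ K h) |>.ae_eq ?_
  filter_upwards [ae_restrict_mem (measurableSet_truncatedCone hK)] with x hx
  by_cases hxr : x ∈ closedTruncatedCone x₀ K r
  · simp [hxr]
  · rw [indicator_of_notMem hxr, image_eq_zero_of_notMem_tsupport fun hx' => hxr ⟨hx.1, hφr hx'⟩,
      zero_mul]

theorem tendsto_integral_mul_of_tendsto_eLpNorm {α : Type*} [MeasurableSpace α] {μ : Measure α}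
    {F : ℕ → α → ℂ} {f k : α → ℂ} (hF : ∀ m, MemLp (F m) 2 μ) (hf : MemLp f 2 μ)
    (hk : MemLp k 2 μ) (hlim : Tendsto (fun m => eLpNorm (fun x => F m x - f x) 2 μ) atTop (𝓝 0)) :
    Tendsto (fun m => ∫ x, F m x * k x ∂μ) atTop (𝓝 (∫ x, f x * k x ∂μ)) := by
  refine tendsto_integral_of_L1' _ (hf.1.mul hk.1)
    (Eventually.of_forall fun m => (hF m).integrable_mul hk) ?_
  have h1 : Tendsto (fun m => eLpNorm (fun x => F m x - f x) 2 μ * eLpNorm k 2 μ) atTop (𝓝 0) := by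
    simpa using ENNReal.Tendsto.mul_const hlim (Or.inr hk.2.ne)
  refine tendsto_of_tendsto_of_tendsto_of_le_of_le tendsto_const_nhds h1 (fun _ => zero_le)
    fun m => ?_
  have := eLpNorm_smul_le_mul_eLpNorm (p := 2) (q := 2) (r := 1) hk.1 ((hF m).sub hf).1
  refine le_trans (le_of_eq ?_) this
  congr 1
  ext x
  simp [sub_mul]

theorem IsTestFun.memLp (hφ : IsTestFun φ) (μ : Measure (EuclideanSpace ℝ (Fin n)))
    [IsFiniteMeasureOnCompacts μ] : MemLp φ 2 μ :=
  hφ.1.continuous.memLp_of_hasCompactSupport hφ.2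

theorem IsTestFun.integral_mul_partialDeriv {ψ : EuclideanSpace ℝ (Fin n) → ℂ}
    (hψ : IsTestFun ψ) (hφ : IsTestFun φ) (i : Fin n) :
    ∫ x, ψ x * _root_.partialDeriv i φ x = - ∫ x, _root_.partialDeriv i ψ x * φ x := by
  have h1 := hψ.1.continuous
  have h2 := hφ.1.continuous
  have h3 := (hψ.partialDeriv i).1.continuous
  have h4 := (hφ.partialDeriv i).1.continuous
  exact integral_mul_fderiv_eq_neg_fderiv_mul_of_integrable
    ((h3.mul h2).integrable_of_hasCompactSupport hφ.2.mul_left)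
    ((h1.mul h4).integrable_of_hasCompactSupport hψ.2.mul_right)
    ((h1.mul h2).integrable_of_hasCompactSupport hφ.2.mul_left)
    (fun x _ => (hψ.1.differentiable (by simp)).differentiableAt)
    (fun x _ => (hφ.1.differentiable (by simp)).differentiableAt)

/-- The part of the boundary without Cauchy data lies on the sphere of radius `h`, so any function
supported in a smaller ball is admissible, whatever it does on the lateral boundary. -/
theorem disjoint_frontier_of_subset_closedBall {C T : Set (EuclideanSpace ℝ (Fin n))}
    (hr : r < h) (hT : T ⊆ closedBall x₀ r) :
    Disjoint T (frontier C \ (frontier C \ sphere x₀ h)) := by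
  refine disjoint_left.2 fun x hx hx' => hx'.2 ⟨hx'.1, fun hs => ?_⟩
  have h1 := mem_closedBall.1 (hT hx)
  have h2 := mem_sphere.1 hs
  linarith

/-- A smooth cutoff equal to one near a smaller ball. -/
theorem exists_isTestFun_eq_one (x₀ : EuclideanSpace ℝ (Fin n)) {r s : ℝ} (hr : 0 < r)
    (hrs : r < s) :
    ∃ χ : EuclideanSpace ℝ (Fin n) → ℂ, IsTestFun χ ∧ tsupport χ ⊆ closedBall x₀ s ∧
      (∀ x ∈ closedBall x₀ r, χ x = 1) := by
  let b : ContDiffBump x₀ := ⟨r, s, hr, hrs⟩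
  have hs : Function.support (fun y => ((b y : ℝ) : ℂ)) = ball x₀ s := by
    rw [← show b.rOut = s from rfl, ← b.support_eq]
    ext y
    simp
  refine ⟨fun y => ((b y : ℝ) : ℂ), ⟨Complex.ofRealCLM.contDiff.comp b.contDiff, ?_⟩, ?_,
    fun x hx => ?_⟩
  · exact HasCompactSupport.of_support_subset_isCompact (isCompact_closedBall x₀ s)
      (hs ▸ ball_subset_closedBall)
  · rw [tsupport, hs]
    exact closure_ball_subset_closedBall
  · simp [b.one_of_mem_closedBall (show x ∈ closedBall x₀ b.rIn from hx)]

theorem partialDeriv_eq_zero_of_eventuallyEq_const {x : EuclideanSpace ℝ (Fin n)} {c : ℂ}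
    (hφ : φ =ᶠ[𝓝 x] fun _ => c) (i : Fin n) : partialDeriv i φ x = 0 := by
  simp [partialDeriv, hφ.fderiv_eq]

theorem MemL2Loc.sub {C : Set (EuclideanSpace ℝ (Fin n))} (hu : MemL2Loc C u)
    (hv : MemL2Loc C v) : MemL2Loc C (fun x => u x - v x) :=
  fun A hA hAC => (hu A hA hAC).sub (hv A hA hAC)

/-- No boundary term appears although `φ` need not vanish on the lateral boundary. The cut-off
difference is an $H^1$ limit of test functions supported in the interior, for which integration by
parts is classical, and both sides pass to the limit. -/
theorem DirichletEqOn.integral_mul_partialDeriv (hK : IsSolidCone K)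
    (hu : IsH2Loc (truncatedCone x₀ K h) u Du D2u) (hv : IsH2Loc (truncatedCone x₀ K h) v Dv D2v)
    (hD : DirichletEqOn (truncatedCone x₀ K h) (frontier (truncatedCone x₀ K h) \ sphere x₀ h)
      u Du v Dv)
    (hφ : IsTestFun φ) (hr0 : 0 < r) (hr : r < h) (hφr : tsupport φ ⊆ closedBall x₀ r)
    (i : Fin n) :
    ∫ x in truncatedCone x₀ K h, (u x - v x) * partialDeriv i φ x =
      - ∫ x in truncatedCone x₀ K h, (Du i x - Dv i x) * φ x := by
  obtain ⟨s, hrs, hsh⟩ := exists_between hr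
  obtain ⟨s', hss', hsh'⟩ := exists_between hsh
  obtain ⟨χ, hχ, hχs, hχ1⟩ := exists_isTestFun_eq_one x₀ (hr0.trans hrs) hss'
  obtain ⟨ψ, hψ, hψw, hψD⟩ := hD χ hχ (disjoint_frontier_of_subset_closedBall hsh' hχs)
  rw [hK.restrict_interior_truncatedCone] at hψw
  have hψDi := hψD i
  rw [hK.restrict_interior_truncatedCone] at hψDi
  set μ : Measure (EuclideanSpace ℝ (Fin n)) := volume.restrict (truncatedCone x₀ K h)
  have hw := hu.memL2.sub hv.memL2
  have hDw := (hu.memL2_grad i).sub (hv.memL2_grad i)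
  have m1 : MemLp (fun x => χ x * (u x - v x)) 2 μ :=
    memLp_truncatedCone_mul hK hw hχ.1.continuous hχ.2 hsh' hχs
  have m2 : MemLp (fun x => partialDeriv i χ x * (u x - v x) + χ x * (Du i x - Dv i x)) 2 μ :=
    (memLp_truncatedCone_mul hK hw (hχ.partialDeriv i).1.continuous (hχ.partialDeriv i).2 hsh'
      ((closure_minimal (support_partialDeriv_subset χ i) (isClosed_tsupport χ)).trans hχs)).add
      (memLp_truncatedCone_mul hK hDw hχ.1.continuous hχ.2 hsh' hχs)
  have l1 := tendsto_integral_mul_of_tendsto_eLpNorm (fun k => (hψ k).1.memLp μ) m1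
    ((hφ.partialDeriv i).memLp μ) hψw
  have l2 := tendsto_integral_mul_of_tendsto_eLpNorm
    (fun k => ((hψ k).1.partialDeriv i).memLp μ) m2 (hφ.memLp μ) hψDi
  have heq : ∀ k, ∫ x, ψ k x * partialDeriv i φ x ∂μ = -∫ x, partialDeriv i (ψ k) x * φ x ∂μ := by
    intro k
    have hs : tsupport (ψ k) ⊆ truncatedCone x₀ K h := (hψ k).2.trans interior_subset
    have e1 : ∀ {p q : EuclideanSpace ℝ (Fin n) → ℂ}, Function.support p ⊆ tsupport (ψ k) →
        ∫ x, p x * q x ∂μ = ∫ x, p x * q x := fun {p q} hp => by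
      simp_rw [mul_comm (p _)]
      exact setIntegral_mul_eq_integral (hp.trans hs)
    rw [e1 subset_closure, e1 (support_partialDeriv_subset _ i),
      (hψ k).1.integral_mul_partialDeriv hφ i]
  have hlim := tendsto_nhds_unique (l1.congr heq) l2.neg
  -- The cutoff is constant near the support of `φ`, so it drops out of the limit identity.
  have hone : ∀ x, φ x ≠ 0 ∨ partialDeriv i φ x ≠ 0 → χ x = 1 ∧ partialDeriv i χ x = 0 := by
    intro x hx
    have hxr : x ∈ closedBall x₀ r := hφr (hx.elim (fun h => subset_closure h)
      (fun h => support_partialDeriv_subset φ i h))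
    refine ⟨hχ1 x (closedBall_subset_closedBall hrs.le hxr),
      partialDeriv_eq_zero_of_eventuallyEq_const (c := 1) ?_ i⟩
    filter_upwards [isOpen_ball.mem_nhds (closedBall_subset_ball hrs hxr)] with y hy
    exact hχ1 y (ball_subset_closedBall hy)
  convert hlim using 1
  · refine integral_congr_ae (ae_of_all _ fun x => ?_)
    by_cases hx : partialDeriv i φ x = 0
    · simp [hx]
    · simp [hone x (Or.inr hx)]
  · congr 1
    refine integral_congr_ae (ae_of_all _ fun x => ?_)
    by_cases hx : φ x = 0
    · simp [hx]
    · simp [hone x (Or.inl hx)]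

/-- Green's formula in two halves: the Dirichlet condition moves one derivative from `φ` to the
difference, and the Neumann condition is the integration by parts of the other one. -/
theorem isWeakCauchySolution_of_cauchyData (hK : IsSolidCone K) (hh : 0 < h)
    (hu : IsH2Loc (truncatedCone x₀ K h) u Du D2u) (hv : IsH2Loc (truncatedCone x₀ K h) v Dv D2v)
    (hD : DirichletEqOn (truncatedCone x₀ K h) (frontier (truncatedCone x₀ K h) \ sphere x₀ h)
      u Du v Dv)
    (hN : NeumannEqOn (truncatedCone x₀ K h) (frontier (truncatedCone x₀ K h) \ sphere x₀ h)
      Du D2u Dv D2v) :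
    IsWeakCauchySolution x₀ K h (fun x => u x - v x)
      (fun x => laplacianOf D2u x - laplacianOf D2v x) := by
  intro φ r' hφ hr' hφr'
  -- The given radius may be nonpositive, while the cutoff needs a positive one, so it is enlarged
  -- below `h`.
  obtain ⟨r, hr0, hr⟩ := exists_between (max_lt hh hr')
  have hφr : tsupport φ ⊆ closedBall x₀ r :=
    hφr'.trans (closedBall_subset_closedBall ((le_max_right _ _).trans hr0.le))
  replace hr0 := (le_max_left _ _).trans_lt hr0
  have hφi : ∀ i, tsupport (partialDeriv i φ) ⊆ closedBall x₀ r := fun i =>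
    (closure_minimal (support_partialDeriv_subset φ i) (isClosed_tsupport φ)).trans hφr
  have hneu := hN φ hφ (disjoint_frontier_of_subset_closedBall hr hφr)
  have ig : ∀ {p : EuclideanSpace ℝ (Fin n) → ℂ}, MemL2Loc (truncatedCone x₀ K h) p → ∀ i,
      IntegrableOn (fun x => p x * partialDeriv i φ x) (truncatedCone x₀ K h) := fun hp i =>
    integrableOn_truncatedCone_mul hK hp (hφ.partialDeriv i).1.continuous (hφ.partialDeriv i).2
      hr (hφi i)
  have il : ∀ {D : Fin n → Fin n → EuclideanSpace ℝ (Fin n) → ℂ},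
      (∀ i j, MemL2Loc (truncatedCone x₀ K h) (D i j)) →
      IntegrableOn (fun x => laplacianOf D x * φ x) (truncatedCone x₀ K h) := fun hD => by
    simp_rw [laplacianOf, Finset.sum_mul]
    exact integrable_finsetSum _ fun i _ =>
      integrableOn_truncatedCone_mul hK (hD i i) hφ.1.continuous hφ.2 hr hφr
  have hi2 : ∀ i, IntegrableOn (fun x => (u x - v x) * partialDeriv i (partialDeriv i φ) x)
      (truncatedCone x₀ K h) := fun i =>
    integrableOn_truncatedCone_mul hK (hu.memL2.sub hv.memL2)
      ((hφ.partialDeriv i).partialDeriv i).1.continuous ((hφ.partialDeriv i).partialDeriv i).2 hr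
      ((closure_minimal (support_partialDeriv_subset _ i) (isClosed_tsupport _)).trans (hφi i))
  simp only [normalDerivPairing] at hneu
  rw [integral_add (integrable_finsetSum _ fun i _ => ig (hu.memL2_grad i) i) (il hu.memL2_hess),
    integral_add (integrable_finsetSum _ fun i _ => ig (hv.memL2_grad i) i) (il hv.memL2_hess),
    integral_finsetSum _ fun i _ => ig (hu.memL2_grad i) i,
    integral_finsetSum _ fun i _ => ig (hv.memL2_grad i) i] at hneu
  simp_rw [smoothLaplacian, Finset.mul_sum]
  rw [integral_finsetSum _ fun i _ => hi2 i]
  simp_rw [hD.integral_mul_partialDeriv hK hu hv (hφ.partialDeriv _) hr0 hr (hφi _), sub_mul]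
  rw [integral_sub (il hu.memL2_hess) (il hv.memL2_hess)]
  simp_rw [fun i => integral_sub (ig (hu.memL2_grad i) i) (ig (hv.memL2_grad i) i)]
  rw [Finset.sum_neg_distrib, Finset.sum_sub_distrib]
  linear_combination -hneu

end WeakEquation

/-! ### Exponential test functions -/

/-- The bilinear square `∑ᵢ ℓ(eᵢ)²` of a complex covector. -/
noncomputable def covectorSq {n : ℕ} (ℓ : EuclideanSpace ℝ (Fin n) →L[ℝ] ℂ) : ℂ :=
  ∑ i, ℓ (EuclideanSpace.single i 1) ^ 2

/-- The Laplace transform of the indicator function of a set. -/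
noncomputable def laplaceIntegral {n : ℕ} (K : Set (EuclideanSpace ℝ (Fin n)))
    (ℓ : EuclideanSpace ℝ (Fin n) →L[ℝ] ℂ) : ℂ :=
  ∫ y in K, Complex.exp (ℓ y)

/-- `exp ∘ ℓ` decays exponentially on `K`. -/
def IsDecayingOn {n : ℕ} (K : Set (EuclideanSpace ℝ (Fin n)))
    (ℓ : EuclideanSpace ℝ (Fin n) →L[ℝ] ℂ) : Prop :=
  ∃ δ : ℝ, 0 < δ ∧ ∀ y ∈ K, (ℓ y).re ≤ -(δ * ‖y‖)

section Exponential

variable {n : ℕ} {K : Set (EuclideanSpace ℝ (Fin n))} {x₀ : EuclideanSpace ℝ (Fin n)}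
  {h r s δ : ℝ} {w g H χ : EuclideanSpace ℝ (Fin n) → ℂ} {ℓ : EuclideanSpace ℝ (Fin n) →L[ℝ] ℂ}

/-- Comparison with the integrable power $(1+\|y\|)^{-k}$, $k=\dim E+1$: a multiple of $1+\|y\|$ is
dominated by $e^{\delta\|y\|/k}$, and this is raised to the power $-k$. -/
theorem integrable_exp_neg_mul_norm {E : Type*} [NormedAddCommGroup E] [NormedSpace ℝ E]
    [FiniteDimensional ℝ E] [MeasurableSpace E] [BorelSpace E] (μ : Measure E)
    [μ.IsAddHaarMeasure] (hδ : 0 < δ) :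
    Integrable (fun y : E => Real.exp (-(δ * ‖y‖))) μ := by
  set k : ℝ := Module.finrank ℝ E + 1 with hk
  have hk0 : 0 < k := by positivity
  set c : ℝ := min 1 (δ / k)
  have hc : 0 < c := lt_min one_pos (by positivity)
  have h1 : Integrable (fun y : E => c ^ (-k) * (1 + ‖y‖) ^ (-k)) μ := by
    refine (integrable_one_add_norm ?_).const_mul _
    simp [hk]
  refine h1.mono' (by fun_prop) (ae_of_all _ fun y => ?_)
  have h2 : c * (1 + ‖y‖) ≤ Real.exp (δ * ‖y‖ / k) := by
    have e1 := Real.add_one_le_exp (δ * ‖y‖ / k)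
    have e2 : c ≤ 1 := min_le_left _ _
    have e3 : c * ‖y‖ ≤ δ / k * ‖y‖ := by
      gcongr
      exact min_le_right _ _
    have e4 : δ / k * ‖y‖ = δ * ‖y‖ / k := by ring
    nlinarith
  rw [Real.norm_of_nonneg (Real.exp_pos _).le, ← Real.mul_rpow hc.le (by positivity)]
  calc Real.exp (-(δ * ‖y‖)) = Real.exp (δ * ‖y‖ / k) ^ (-k) := by
        rw [← Real.exp_mul]
        congr 1
        field_simp
    _ ≤ _ := Real.rpow_le_rpow_of_nonpos (by positivity) h2 (by linarith)

theorem measurable_indicator_of_continuousOn {C : Set (EuclideanSpace ℝ (Fin n))}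
    (hH : ContinuousOn H C) (hC : MeasurableSet C) : Measurable (C.indicator H) := by
  classical
  rw [← Set.piecewise_eq_indicator]
  exact hH.measurable_piecewise continuousOn_const hC

/-- Concentration at the apex of the integral against a decaying exponential. -/
theorem tendsto_pow_smul_integral_exp (hK : IsSolidCone K) (hh : 0 < h) (hℓ : IsDecayingOn K ℓ)
    (hH : ContinuousOn H (truncatedCone x₀ K h)) {M : ℝ}
    (hM : ∀ x ∈ truncatedCone x₀ K h, ‖H x‖ ≤ M) :
    Tendsto (fun τ : ℝ => τ ^ n •
      ∫ x in truncatedCone x₀ K h, H x * Complex.exp ((τ • ℓ) (x - x₀)))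
      atTop (𝓝 (H x₀ * laplaceIntegral K ℓ)) := by
  obtain ⟨δ, hδ, hdec⟩ := hℓ
  set C := truncatedCone x₀ K h
  have hC : MeasurableSet C := measurableSet_truncatedCone hK
  have hKm : MeasurableSet K := hK.isClosed.measurableSet
  have hx₀ : x₀ ∈ C := ⟨by simpa using hK.zero_mem, mem_ball_self hh⟩
  -- Substitution $y=\tau(x-x_0)$: the factor $\tau^n$ is the Jacobian. The rescaled corners exhaust
  -- $K$, which is invariant under dilation.
  have hscale : ∀ τ : ℝ, 0 < τ → τ ^ n • ∫ x in C, H x * Complex.exp ((τ • ℓ) (x - x₀)) =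
      ∫ y, C.indicator H (x₀ + τ⁻¹ • y) * Complex.exp (ℓ y) := by
    intro τ hτ
    have := Measure.integral_comp_inv_smul_of_nonneg (volume : Measure (EuclideanSpace ℝ (Fin n)))
      (fun z => C.indicator H (x₀ + z) * Complex.exp ((τ • ℓ) z)) hτ.le
    simp only [finrank_euclideanSpace, Fintype.card_fin] at this
    have e1 : ∀ y, (τ • ℓ) (τ⁻¹ • y) = ℓ y := fun y => by
      rw [map_smul, smul_apply, smul_smul, inv_mul_cancel₀ hτ.ne', one_smul]
    simp_rw [e1] at this
    rw [this]
    congr 1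
    rw [← integral_sub_right_eq_self (fun z => C.indicator H (x₀ + z) *
      Complex.exp ((τ • ℓ) z)) x₀, ← integral_indicator hC]
    refine integral_congr_ae (ae_of_all _ fun x => ?_)
    by_cases hx : x ∈ C <;> simp [hx]
  have hmemK : ∀ τ : ℝ, 0 < τ → ∀ y, x₀ + τ⁻¹ • y ∈ C → y ∈ K := by
    intro τ hτ y hy
    have h1 : x₀ + τ⁻¹ • y - x₀ ∈ K := hy.1
    rw [add_sub_cancel_left] at h1
    simpa [smul_smul, hτ.ne'] using hK.smul_mem τ hτ.le _ h1
  have hM0 : 0 ≤ M := (norm_nonneg _).trans (hM x₀ hx₀)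
  have key : Tendsto (fun τ : ℝ => ∫ y, C.indicator H (x₀ + τ⁻¹ • y) * Complex.exp (ℓ y)) atTop
      (𝓝 (∫ y, K.indicator (fun y => H x₀ * Complex.exp (ℓ y)) y)) := by
    refine tendsto_integral_filter_of_dominated_convergence
      (fun y => M * Real.exp (-(δ * ‖y‖))) (Eventually.of_forall fun τ => ?_) ?_
      ((integrable_exp_neg_mul_norm volume hδ).const_mul M) (ae_of_all _ fun y => ?_)
    · have h1 := measurable_indicator_of_continuousOn hH hC
      have h2 : Measurable fun y => C.indicator H (x₀ + τ⁻¹ • y) := h1.comp (by fun_prop)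
      exact (h2.mul (by fun_prop)).aestronglyMeasurable
    · filter_upwards [eventually_gt_atTop 0] with τ hτ
      refine ae_of_all _ fun y => ?_
      by_cases hy : x₀ + τ⁻¹ • y ∈ C
      · rw [indicator_of_mem hy, norm_mul, Complex.norm_exp]
        gcongr
        · exact hM _ hy
        · exact hdec y (hmemK τ hτ y hy)
      · simp only [indicator_of_notMem hy, zero_mul, norm_zero]
        positivity
    · by_cases hy : y ∈ K
      · rw [indicator_of_mem hy]
        refine Tendsto.mul_const _ ?_
        have hlim : Tendsto (fun τ : ℝ => x₀ + τ⁻¹ • y) atTop (𝓝 x₀) := by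
          have : Tendsto (fun τ : ℝ => x₀ + τ⁻¹ • y) atTop (𝓝 (x₀ + (0 : ℝ) • y)) :=
            tendsto_const_nhds.add (tendsto_inv_atTop_zero.smul_const y)
          simpa using this
        have hev : ∀ᶠ τ : ℝ in atTop, x₀ + τ⁻¹ • y ∈ C := by
          filter_upwards [hlim.eventually (isOpen_ball.mem_nhds (mem_ball_self hh)),
            eventually_gt_atTop 0] with τ h1 hτ
          refine ⟨?_, h1⟩
          rw [mem_ofPred_eq, add_sub_cancel_left]
          exact hK.smul_mem _ (by positivity) y hy
        have h2 := (hH x₀ hx₀).tendsto.comp (tendsto_nhdsWithin_iff.2 ⟨hlim, hev⟩)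
        refine h2.congr' ?_
        filter_upwards [hev] with τ hτ
        simp [hτ]
      · rw [indicator_of_notMem hy]
        refine tendsto_const_nhds.congr' ?_
        filter_upwards [eventually_gt_atTop 0] with τ hτ
        rw [indicator_of_notMem fun h => hy (hmemK τ hτ y h), zero_mul]
  rw [integral_indicator hKm, integral_const_mul] at key
  refine key.congr' ?_
  filter_upwards [eventually_gt_atTop 0] with τ hτ
  exact (hscale τ hτ).symm

/-- Away from the apex, decaying exponentials are exponentially small. -/
theorem tendsto_pow_smul_integral_exp_of_eq_zero (hℓ : IsDecayingOn K ℓ) (hr : 0 < r) {M : ℝ}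
    (hM : ∀ x ∈ truncatedCone x₀ K h, ‖H x‖ ≤ M)
    (hH : ∀ x ∈ ball x₀ r, H x = 0) (k : ℕ) :
    Tendsto (fun τ : ℝ => τ ^ k •
      ∫ x in truncatedCone x₀ K h, H x * Complex.exp ((τ • ℓ) (x - x₀)))
      atTop (𝓝 0) := by
  obtain ⟨δ, hδ, hdec⟩ := hℓ
  set C := truncatedCone x₀ K h
  have hCfin : volume C < ⊤ := (measure_mono inter_subset_right).trans_lt measure_ball_lt_top
  have hb : Tendsto (fun τ : ℝ => |M| * volume.real C * (τ ^ k * Real.exp (-(δ * r) * τ))) atTop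
      (𝓝 0) := by
    have := (tendsto_rpow_mul_exp_neg_mul_atTop_nhds_zero k (δ * r) (by positivity)).const_mul
      (|M| * volume.real C)
    simpa using this
  refine squeeze_zero_norm' ?_ hb
  filter_upwards [eventually_gt_atTop 0] with τ hτ
  have h1 : ‖∫ x in C, H x * Complex.exp ((τ • ℓ) (x - x₀))‖ ≤
      (|M| * Real.exp (-(δ * r) * τ)) * volume.real C := by
    refine norm_setIntegral_le_of_norm_le_const hCfin fun x hx => ?_
    by_cases hxr : x ∈ ball x₀ r
    · rw [hH x hxr]
      simp only [zero_mul, norm_zero]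
      positivity
    · rw [norm_mul, Complex.norm_exp]
      have h2 : r ≤ ‖x - x₀‖ := by
        simpa [dist_eq_norm] using hxr
      have h3 := hdec _ hx.1
      gcongr
      · exact (hM x hx).trans (le_abs_self M)
      · rw [smul_apply, Complex.real_smul, Complex.re_ofReal_mul]
        have h4 : δ * r ≤ δ * ‖x - x₀‖ := by gcongr
        nlinarith
  rw [norm_smul, norm_pow, Real.norm_of_nonneg hτ.le]
  calc _ ≤ τ ^ k * ((|M| * Real.exp (-(δ * r) * τ)) * volume.real C) := by gcongr
    _ = _ := by ring

/-- Continuity on the truncated cone allows blow-up at the sphere of radius `h`; the cutoff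
restricts to a compact part. -/
theorem exists_norm_mul_le (hK : IsSolidCone K) (hw : ContinuousOn w (truncatedCone x₀ K h))
    (hχ : Continuous χ) (hs : s < h) (hχs : tsupport χ ⊆ closedBall x₀ s) :
    ∃ M : ℝ, ∀ x ∈ truncatedCone x₀ K h, ‖w x * χ x‖ ≤ M := by
  obtain ⟨M, hM⟩ := (isCompact_closedTruncatedCone (x₀ := x₀) (r := s) hK).exists_bound_of_continuousOn
    ((hw.mono (closedTruncatedCone_subset hs)).mul hχ.continuousOn)
  refine ⟨max M 0, fun x hx => ?_⟩
  by_cases hxs : x ∈ closedBall x₀ s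
  · exact (hM x ⟨hx.1, hxs⟩).trans (le_max_left _ _)
  · rw [image_eq_zero_of_notMem_tsupport fun h => hxs (hχs h)]
    simp

theorem partialDeriv_mul_exp (hχ : IsTestFun χ) (i : Fin n) :
    partialDeriv i (fun x => χ x * Complex.exp (ℓ (x - x₀))) =
      fun x => (partialDeriv i χ x + ℓ (EuclideanSpace.single i 1) * χ x) *
        Complex.exp (ℓ (x - x₀)) := by
  ext x
  have h1 : HasFDerivAt (fun x => Complex.exp (ℓ (x - x₀))) (Complex.exp (ℓ (x - x₀)) • ℓ) x :=
    (ℓ.hasFDerivAt.comp x ((hasFDerivAt_id x).sub_const x₀)).cexp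
  have h2 := ((hχ.1.differentiable (by simp)).differentiableAt (x := x)).hasFDerivAt.fun_mul h1
  rw [partialDeriv, h2.fderiv]
  simp [partialDeriv]
  ring

theorem IsTestFun.const_mul (hχ : IsTestFun χ) (c : ℂ) : IsTestFun (fun x => c * χ x) :=
  ⟨contDiff_const.mul hχ.1, hχ.2.mul_left⟩

theorem IsTestFun.add (hχ : IsTestFun χ) (hH : IsTestFun H) : IsTestFun (fun x => χ x + H x) :=
  ⟨hχ.1.add hH.1, hχ.2.add hH.2⟩

theorem IsTestFun.mul_exp (hχ : IsTestFun χ) :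
    IsTestFun (fun x => χ x * Complex.exp (ℓ (x - x₀))) :=
  ⟨hχ.1.mul (ℓ.contDiff.comp (contDiff_id.sub contDiff_const)).cexp, hχ.2.mul_right⟩

theorem partialDeriv_add_const_mul (hχ : IsTestFun χ) (hH : IsTestFun H) (c : ℂ) (i : Fin n)
    (x : EuclideanSpace ℝ (Fin n)) :
    partialDeriv i (fun x => χ x + c * H x) x = partialDeriv i χ x + c * partialDeriv i H x := by
  have h1 := ((hχ.1.differentiable (by simp)).differentiableAt (x := x)).hasFDerivAt.fun_add
    (((hH.1.differentiable (by simp)).differentiableAt (x := x)).hasFDerivAt.const_mul c)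
  rw [partialDeriv, h1.fderiv]
  simp [partialDeriv]

theorem smoothLaplacian_mul_exp (hχ : IsTestFun χ) (x : EuclideanSpace ℝ (Fin n)) :
    smoothLaplacian (fun x => χ x * Complex.exp (ℓ (x - x₀))) x =
      (smoothLaplacian χ x + 2 * ∑ i, ℓ (EuclideanSpace.single i 1) * partialDeriv i χ x +
        covectorSq ℓ * χ x) * Complex.exp (ℓ (x - x₀)) := by
  have h1 : ∀ i, partialDeriv i (partialDeriv i (fun x => χ x * Complex.exp (ℓ (x - x₀)))) x =
      (partialDeriv i (partialDeriv i χ) x +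
        2 * (ℓ (EuclideanSpace.single i 1) * partialDeriv i χ x) +
        ℓ (EuclideanSpace.single i 1) ^ 2 * χ x) * Complex.exp (ℓ (x - x₀)) := by
    intro i
    rw [partialDeriv_mul_exp hχ,
      partialDeriv_mul_exp ((hχ.partialDeriv i).add (hχ.const_mul _))]
    simp only [partialDeriv_add_const_mul (hχ.partialDeriv i) hχ]
    ring
  simp_rw [smoothLaplacian, h1, covectorSq, ← Finset.sum_mul, Finset.sum_add_distrib,
    Finset.sum_mul, Finset.mul_sum]

theorem covectorSq_smul (τ : ℝ) : covectorSq (τ • ℓ) = (τ : ℂ) ^ 2 * covectorSq ℓ := by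
  simp [covectorSq, mul_pow, Finset.mul_sum]

/-- The asymptotic form of the weak equation tested with exponentials. -/
theorem IsWeakCauchySolution.tendsto_exp (hK : IsSolidCone K)
    (hwg : IsWeakCauchySolution x₀ K h w g) (hw : ContinuousOn w (truncatedCone x₀ K h)) (hχ : IsTestFun χ) (hr : 0 < r) (hs : s < h)
    (hχs : tsupport χ ⊆ closedBall x₀ s) (hχ1 : ∀ x ∈ closedBall x₀ r, χ x = 1)
    (hℓ : IsDecayingOn K ℓ) :
    Tendsto (fun τ : ℝ =>
      covectorSq (τ • ℓ) * (τ ^ n • ∫ x in truncatedCone x₀ K h,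
        (w x * χ x) * Complex.exp ((τ • ℓ) (x - x₀))) -
      τ ^ n • ∫ x in truncatedCone x₀ K h, (g x * χ x) * Complex.exp ((τ • ℓ) (x - x₀)))
      atTop (𝓝 0) := by
  set C := truncatedCone x₀ K h
  set χ₁ : EuclideanSpace ℝ (Fin n) → ℂ := smoothLaplacian χ with hχ₁
  set χ₂ : EuclideanSpace ℝ (Fin n) → ℂ := fun x =>
    ∑ i, ℓ (EuclideanSpace.single i 1) * partialDeriv i χ x with hχ₂
  have hd : ∀ i, tsupport (partialDeriv i χ) ⊆ tsupport χ := fun i =>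
    closure_minimal (support_partialDeriv_subset χ i) (isClosed_tsupport χ)
  have c1 : Continuous χ₁ :=
    continuous_finsetSum _ fun i _ => ((hχ.partialDeriv i).partialDeriv i).1.continuous
  have c2 : Continuous χ₂ :=
    continuous_finsetSum _ fun i _ => continuous_const.mul (hχ.partialDeriv i).1.continuous
  have s1 : tsupport χ₁ ⊆ closedBall x₀ s := by
    refine (closure_minimal (fun x hx => ?_) (isClosed_tsupport χ)).trans hχs
    by_contra h0
    refine hx (Finset.sum_eq_zero fun i _ => ?_)
    by_contra h1
    exact h0 (hd i (support_partialDeriv_subset _ i h1))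
  have s2 : tsupport χ₂ ⊆ closedBall x₀ s := by
    refine (closure_minimal (fun x hx => ?_) (isClosed_tsupport χ)).trans hχs
    by_contra h0
    refine hx (Finset.sum_eq_zero fun i _ => ?_)
    by_contra h1
    exact h0 (support_partialDeriv_subset _ i (right_ne_zero_of_mul h1))
  have hnear : ∀ x ∈ ball x₀ r, ∀ i, partialDeriv i χ x = 0 := fun x hx i =>
    partialDeriv_eq_zero_of_eventuallyEq_const (c := 1) (by
      filter_upwards [isOpen_ball.mem_nhds hx] with y hy
      exact hχ1 y (ball_subset_closedBall hy)) i
  have z1 : ∀ x ∈ ball x₀ r, w x * χ₁ x = 0 := fun x hx => by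
    have : χ₁ x = 0 := Finset.sum_eq_zero fun i _ =>
      partialDeriv_eq_zero_of_eventuallyEq_const (c := 0) (by
        filter_upwards [isOpen_ball.mem_nhds hx] with y hy using hnear y hy i) i
    rw [this, mul_zero]
  have z2 : ∀ x ∈ ball x₀ r, w x * χ₂ x = 0 := fun x hx => by
    have : χ₂ x = 0 := Finset.sum_eq_zero fun i _ => by rw [hnear x hx i, mul_zero]
    rw [this, mul_zero]
  obtain ⟨M, hM⟩ := exists_norm_mul_le hK hw hχ.1.continuous hs hχs
  obtain ⟨M₁, hM₁⟩ := exists_norm_mul_le hK hw c1 hs s1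
  obtain ⟨M₂, hM₂⟩ := exists_norm_mul_le hK hw c2 hs s2
  have hint : ∀ {k : EuclideanSpace ℝ (Fin n) → ℂ}, Continuous k → ∀ M,
      (∀ x ∈ C, ‖w x * k x‖ ≤ M) → ∀ τ : ℝ,
      IntegrableOn (fun x => (w x * k x) * Complex.exp ((τ • ℓ) (x - x₀))) C := by
    intro k hk M hM τ
    have hC : MeasurableSet C := measurableSet_truncatedCone hK
    have hCfin : volume C < ⊤ := (measure_mono inter_subset_right).trans_lt measure_ball_lt_top
    have hm : AEStronglyMeasurable (fun x => (w x * k x) * Complex.exp ((τ • ℓ) (x - x₀)))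
        (volume.restrict C) :=
      ((hw.mul hk.continuousOn).mul (by fun_prop : Continuous fun x =>
        Complex.exp ((τ • ℓ) (x - x₀))).continuousOn).aestronglyMeasurable hC
    obtain ⟨B, hB⟩ := (isCompact_closedBall x₀ h).exists_bound_of_continuousOn
      (f := fun x => Complex.exp ((τ • ℓ) (x - x₀))) (by fun_prop)
    refine (integrableOn_const (C := M * B) hCfin.ne).mono' hm ?_
    filter_upwards [ae_restrict_mem hC] with x hx
    rw [norm_mul]
    have h1 := hM x hx
    exact mul_le_mul h1 (hB x (ball_subset_closedBall hx.2)) (norm_nonneg _)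
      ((norm_nonneg _).trans h1)
  have l1 := tendsto_pow_smul_integral_exp_of_eq_zero hℓ hr hM₁ z1 n
  -- The power `n + 1` absorbs the extra factor $\tau$ from the cross term $2\nabla\chi\cdot\nabla
  -- e^{\tau\ell}$.
  have l2 := tendsto_pow_smul_integral_exp_of_eq_zero hℓ hr hM₂ z2 (n + 1)
  have l3 := (l1.add (l2.const_mul 2)).neg
  simp only [mul_zero, add_zero, neg_zero] at l3
  refine l3.congr fun τ => ?_
  have heq := hwg (fun x => χ x * Complex.exp ((τ • ℓ) (x - x₀))) s hχ.mul_exp hs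
    ((tsupport_mul_subset_left).trans hχs)
  have e1 : ∀ x, w x * smoothLaplacian (fun x => χ x * Complex.exp ((τ • ℓ) (x - x₀))) x =
      (w x * χ₁ x) * Complex.exp ((τ • ℓ) (x - x₀)) +
      (2 * (τ : ℂ)) * ((w x * χ₂ x) * Complex.exp ((τ • ℓ) (x - x₀))) +
      covectorSq (τ • ℓ) * ((w x * χ x) * Complex.exp ((τ • ℓ) (x - x₀))) := by
    intro x
    rw [smoothLaplacian_mul_exp hχ]
    have : ∑ i, (τ • ℓ) (EuclideanSpace.single i 1) * partialDeriv i χ x = τ * χ₂ x := by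
      simp [hχ₂, Finset.mul_sum, mul_assoc]
    rw [this]
    ring
  simp_rw [e1, ← mul_assoc (g _)] at heq
  have i12 : IntegrableOn (fun x => (w x * χ₁ x) * Complex.exp ((τ • ℓ) (x - x₀)) +
      (2 * (τ : ℂ)) * ((w x * χ₂ x) * Complex.exp ((τ • ℓ) (x - x₀)))) C :=
    (hint c1 M₁ hM₁ τ).add ((hint c2 M₂ hM₂ τ).const_mul _)
  rw [integral_add i12 ((hint hχ.1.continuous M hM τ).const_mul _), integral_add (hint c1 M₁ hM₁ τ)
    ((hint c2 M₂ hM₂ τ).const_mul _), integral_const_mul, integral_const_mul] at heq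
  simp only [Complex.real_smul, Complex.ofReal_pow] at heq ⊢
  linear_combination (-(τ : ℂ) ^ n) * heq

/-- The real covector $-\langle a,\cdot\rangle$, with `a` positive on the cone, works: its transform
integrates a positive function over a set of positive measure, and its square is $|a|^2$. -/
theorem exists_isDecayingOn_laplaceIntegral_ne_zero (hK : IsSolidCone K) :
    ∃ ℓ : EuclideanSpace ℝ (Fin n) →L[ℝ] ℂ, IsDecayingOn K ℓ ∧ laplaceIntegral K ℓ ≠ 0 ∧
      (n ≠ 0 → covectorSq ℓ ≠ 0) := by
  obtain ⟨a, δ, hδ, ha⟩ := hK.exists_norm_le_inner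
  have hval : ∀ y, (Complex.ofRealCLM ∘L (-(innerSL ℝ a))) y = ((-inner ℝ a y : ℝ) : ℂ) :=
    fun y => by simp
  have hKm : MeasurableSet K := hK.isClosed.measurableSet
  refine ⟨Complex.ofRealCLM ∘L (-(innerSL ℝ a)), ⟨δ, hδ, fun y hy => ?_⟩, ?_, fun hn => ?_⟩
  · rw [hval, Complex.ofReal_re]
    linarith [ha y hy]
  · rw [laplaceIntegral]
    simp_rw [hval, ← Complex.ofReal_exp]
    rw [integral_complex_ofReal, Complex.ofReal_ne_zero]
    have hpos : 0 < volume K := (isOpen_interior.measure_pos volume hK.interior_nonempty).trans_le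
      (measure_mono interior_subset)
    have : NeZero (volume.restrict K) := ⟨by simpa using hpos.ne'⟩
    refine (integral_exp_pos ?_).ne'
    refine (integrable_exp_neg_mul_norm volume hδ).integrableOn.mono' (by fun_prop) ?_
    filter_upwards [ae_restrict_mem hKm] with y hy
    rw [Real.norm_of_nonneg (Real.exp_pos _).le, Real.exp_le_exp]
    linarith [ha y hy]
  · have hsq : covectorSq (Complex.ofRealCLM ∘L (-(innerSL ℝ a))) = ((‖a‖ ^ 2 : ℝ) : ℂ) := by
      rw [EuclideanSpace.norm_sq_eq, covectorSq]
      simp [EuclideanSpace.inner_single_right]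
    rw [hsq, Complex.ofReal_ne_zero]
    refine pow_ne_zero 2 (norm_ne_zero_iff.2 fun ha0 => ?_)
    have : Nonempty (Fin n) := ⟨⟨0, Nat.pos_of_ne_zero hn⟩⟩
    have hsub : K ⊆ {0} := fun y hy => by
      have := ha y hy
      rw [ha0, inner_zero_left] at this
      exact norm_le_zero_iff.1 (nonpos_of_mul_nonpos_right this hδ)
    obtain ⟨y, hy⟩ := hK.interior_nonempty
    have := interior_mono hsub hy
    rw [interior_singleton] at this
    exact this

/-- With $\ell\cdot\ell\ne0$ the `w`-term carries the factor $\tau^2$, while the rescaled `g`-term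
converges. Division by $\tau^2$ leaves only $(\ell\cdot\ell)\,w(x_0)F(\ell)=0$. -/
theorem IsWeakCauchySolution.apex_eq_zero (hn : n ≠ 0) (hK : IsSolidCone K) (hh : 0 < h)
    (hwg : IsWeakCauchySolution x₀ K h w g) (hw : ContinuousOn w (truncatedCone x₀ K h))
    (hg : ContinuousOn g (truncatedCone x₀ K h)) : w x₀ = 0 := by
  obtain ⟨ℓ, hℓ, hF, hq⟩ := exists_isDecayingOn_laplaceIntegral_ne_zero hK
  obtain ⟨s, hs0, hs⟩ := exists_between hh
  obtain ⟨r, hr, hrs⟩ := exists_between hs0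
  obtain ⟨χ, hχ, hχs, hχ1⟩ := exists_isTestFun_eq_one x₀ hr hrs
  obtain ⟨M, hM⟩ := exists_norm_mul_le hK hw hχ.1.continuous hs hχs
  obtain ⟨M', hM'⟩ := exists_norm_mul_le hK hg hχ.1.continuous hs hχs
  have l1 := tendsto_pow_smul_integral_exp hK hh hℓ (hw.mul hχ.1.continuous.continuousOn) hM
  have l2 := tendsto_pow_smul_integral_exp hK hh hℓ (hg.mul hχ.1.continuous.continuousOn) hM'
  have l3 := hwg.tendsto_exp hK hw hχ hr hs hχs hχ1 hℓ
  have hτ : Tendsto (fun τ : ℝ => ((τ : ℂ) ^ 2)⁻¹) atTop (𝓝 0) := by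
    have : Tendsto (fun τ : ℝ => (((τ ^ 2)⁻¹ : ℝ) : ℂ)) atTop (𝓝 ((0 : ℝ) : ℂ)) :=
      (Complex.continuous_ofReal.tendsto 0).comp
        (tendsto_inv_atTop_zero.comp (tendsto_pow_atTop two_ne_zero))
    simpa using this
  have l4 := (hτ.mul l3).add (hτ.mul l2)
  have l5 := tendsto_nhds_unique (l4.congr' (f₂ := fun τ : ℝ => covectorSq ℓ * (τ ^ n •
    ∫ x in truncatedCone x₀ K h, (w x * χ x) * Complex.exp ((τ • ℓ) (x - x₀)))) (by
      filter_upwards [eventually_gt_atTop 0] with τ hτ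
      have : (τ : ℂ) ≠ 0 := by exact_mod_cast hτ.ne'
      simp only [covectorSq_smul, Complex.real_smul, Pi.mul_apply]
      field_simp
      ring)) (l1.const_mul (covectorSq ℓ))
  simp only [zero_mul, add_zero] at l5
  have h1 : χ x₀ = 1 := hχ1 x₀ (mem_closedBall_self hr.le)
  simpa [h1, hF, hq hn] using l5.symm

/-- For a null covector the exponential is harmonic, so `w` survives only in the exponentially small
cutoff terms and the limit isolates $g(x_0)F(\ell)$. -/
theorem IsWeakCauchySolution.laplacian_apex_eq_zero (hK : IsSolidCone K) (hh : 0 < h)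
    (hwg : IsWeakCauchySolution x₀ K h w g) (hw : ContinuousOn w (truncatedCone x₀ K h))
    (hg : ContinuousOn g (truncatedCone x₀ K h)) (hℓ : IsDecayingOn K ℓ)
    (hnull : covectorSq ℓ = 0) (hF : laplaceIntegral K ℓ ≠ 0) : g x₀ = 0 := by
  obtain ⟨s, hs0, hs⟩ := exists_between hh
  obtain ⟨r, hr, hrs⟩ := exists_between hs0
  obtain ⟨χ, hχ, hχs, hχ1⟩ := exists_isTestFun_eq_one x₀ hr hrs
  obtain ⟨M', hM'⟩ := exists_norm_mul_le hK hg hχ.1.continuous hs hχs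
  have l2 := tendsto_pow_smul_integral_exp hK hh hℓ (hg.mul hχ.1.continuous.continuousOn) hM'
  have l3 := hwg.tendsto_exp hK hw hχ hr hs hχs hχ1 hℓ
  simp only [covectorSq_smul, hnull, mul_zero, zero_mul, zero_sub] at l3
  have l4 := tendsto_nhds_unique l2.neg l3
  have h1 : χ x₀ = 1 := hχ1 x₀ (mem_closedBall_self hr.le)
  simpa [h1, hF] using l4

end Exponential

/-! ### Null covectors with nonvanishing Laplace transform -/

/-- The complex covector `y ↦ ⟪α, y⟫ + i ⟪β, y⟫`. -/
noncomputable def complexCovector {n : ℕ} (α β : EuclideanSpace ℝ (Fin n)) :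
    EuclideanSpace ℝ (Fin n) →L[ℝ] ℂ :=
  Complex.ofRealCLM ∘L innerSL ℝ α + Complex.I • (Complex.ofRealCLM ∘L innerSL ℝ β)

section Coordinates

variable {n : ℕ}

theorem complexCovector_apply (α β y : EuclideanSpace ℝ (Fin n)) :
    complexCovector α β y = (inner ℝ α y : ℝ) + Complex.I * (inner ℝ β y : ℝ) := by
  simp [complexCovector]

theorem complexCovector_apply_re (α β y : EuclideanSpace ℝ (Fin n)) :
    (complexCovector α β y).re = inner ℝ α y := by
  simp [complexCovector_apply]

/-- Hence null covectors are exactly those whose real and imaginary parts are orthogonal and of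
equal length. -/
theorem covectorSq_complexCovector (α β : EuclideanSpace ℝ (Fin n)) :
    covectorSq (complexCovector α β) =
      ((‖α‖ ^ 2 - ‖β‖ ^ 2 : ℝ) : ℂ) + 2 * Complex.I * (inner ℝ α β : ℝ) := by
  have h1 : ∀ i, complexCovector α β (EuclideanSpace.single i 1) ^ 2 =
      ((α i ^ 2 - β i ^ 2 : ℝ) : ℂ) + 2 * Complex.I * ((α i * β i : ℝ) : ℂ) := by
    intro i
    rw [complexCovector_apply]
    simp only [EuclideanSpace.inner_single_right, one_mul, conj_trivial]
    push_cast
    ring_nf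
    rw [Complex.I_sq]
    ring
  simp_rw [covectorSq, h1, Finset.sum_add_distrib, ← Finset.mul_sum, ← Complex.ofReal_sum]
  rw [Finset.sum_sub_distrib, EuclideanSpace.norm_sq_eq, EuclideanSpace.norm_sq_eq,
    PiLp.inner_apply]
  simp [mul_comm]

theorem exists_measurableEquiv_inner_two
    (b : OrthonormalBasis (Fin 2) ℝ (EuclideanSpace ℝ (Fin 2))) :
    ∃ e : EuclideanSpace ℝ (Fin 2) ≃ᵐ ℝ × ℝ, MeasurePreserving e ∧
      ∀ y, e y = (inner ℝ (b 0) y, inner ℝ (b 1) y) := by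
  refine ⟨(b.measurableEquiv.trans (MeasurableEquiv.toLp 2 (Fin 2 → ℝ)).symm).trans
    MeasurableEquiv.finTwoArrow, ?_, fun y => ?_⟩
  · exact (volume_preserving_finTwoArrow ℝ).comp
      ((EuclideanSpace.volume_preserving_symm_measurableEquiv_toLp (Fin 2)).comp
        b.measurePreserving_measurableEquiv)
  · simp [MeasurableEquiv.finTwoArrow, OrthonormalBasis.measurableEquiv, b.repr_apply_apply]

theorem exists_measurableEquiv_inner_three
    (b : OrthonormalBasis (Fin 3) ℝ (EuclideanSpace ℝ (Fin 3))) :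
    ∃ e : EuclideanSpace ℝ (Fin 3) ≃ᵐ ℝ × ℝ × ℝ, MeasurePreserving e ∧
      ∀ y, e y = (inner ℝ (b 0) y, inner ℝ (b 1) y, inner ℝ (b 2) y) := by
  refine ⟨((b.measurableEquiv.trans (MeasurableEquiv.toLp 2 (Fin 3 → ℝ)).symm).trans
    (MeasurableEquiv.piFinSuccAbove (fun _ => ℝ) 0)).trans
    ((MeasurableEquiv.refl ℝ).prodCongr MeasurableEquiv.finTwoArrow), ?_, fun y => ?_⟩
  · exact ((MeasurePreserving.id volume).prod (volume_preserving_finTwoArrow ℝ)).comp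
      ((volume_preserving_piFinSuccAbove (fun _ => ℝ) 0).comp
      ((EuclideanSpace.volume_preserving_symm_measurableEquiv_toLp (Fin 3)).comp
        b.measurePreserving_measurableEquiv))
  · simp [MeasurableEquiv.finTwoArrow, OrthonormalBasis.measurableEquiv, b.repr_apply_apply,
      MeasurableEquiv.piFinSuccAbove, Fin.insertNthEquiv]
    change (_, Fin.tail (b.repr y).ofLp 0, Fin.tail (b.repr y).ofLp 1) = _
    simp [Fin.tail, b.repr_apply_apply]

theorem norm_sq_eq_two (b : OrthonormalBasis (Fin 2) ℝ (EuclideanSpace ℝ (Fin 2)))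
    (y : EuclideanSpace ℝ (Fin 2)) :
    ‖y‖ ^ 2 = inner ℝ (b 0) y ^ 2 + inner ℝ (b 1) y ^ 2 := by
  rw [← b.sum_sq_norm_inner_right y, Fin.sum_univ_two]
  simp

theorem norm_sq_eq_three (b : OrthonormalBasis (Fin 3) ℝ (EuclideanSpace ℝ (Fin 3)))
    (y : EuclideanSpace ℝ (Fin 3)) :
    ‖y‖ ^ 2 = inner ℝ (b 0) y ^ 2 + inner ℝ (b 1) y ^ 2 + inner ℝ (b 2) y ^ 2 := by
  rw [← b.sum_sq_norm_inner_right y, Fin.sum_univ_three]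
  simp

theorem exists_orthonormalBasis_zero_eq [NeZero n] {v : EuclideanSpace ℝ (Fin n)} (hv : ‖v‖ = 1) :
    ∃ b : OrthonormalBasis (Fin n) ℝ (EuclideanSpace ℝ (Fin n)), b 0 = v := by
  have h : Orthonormal ℝ (({0} : Set (Fin n)).domRestrict fun _ => v) := by
    refine ⟨fun _ => hv, fun i j hij => (hij (Subsingleton.elim i j)).elim⟩
  obtain ⟨b, hb⟩ := h.exists_orthonormalBasis_extension_of_card_eq (by simp)
  exact ⟨b, hb 0 rfl⟩

theorem exists_orthonormalBasis_zero_one_eq {v w : EuclideanSpace ℝ (Fin 3)} (hv : ‖v‖ = 1)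
    (hw : ‖w‖ = 1) (hvw : inner ℝ v w = 0) :
    ∃ b : OrthonormalBasis (Fin 3) ℝ (EuclideanSpace ℝ (Fin 3)), b 0 = v ∧ b 1 = w := by
  have h : Orthonormal ℝ (({0, 1} : Set (Fin 3)).domRestrict ![v, w, 0]) := by
    refine ⟨?_, ?_⟩
    · rintro ⟨i, rfl | rfl⟩ <;> simpa
    · rintro ⟨i, rfl | rfl⟩ ⟨j, rfl | rfl⟩ hij
      · exact (hij rfl).elim
      · simpa using hvw
      · simpa [real_inner_comm] using hvw
      · exact (hij rfl).elim
  obtain ⟨b, hb⟩ := h.exists_orthonormalBasis_extension_of_card_eq (by simp)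
  exact ⟨b, by simpa using hb 0 (by simp), by simpa using hb 1 (by simp)⟩

end Coordinates

/-! ### The transform of a planar wedge -/

/-- The planar wedge `{(p, q) : 0 < p, z₁ p ≤ q ≤ z₂ p}`. -/
def planarWedge (z₁ z₂ : ℝ) : Set (ℝ × ℝ) :=
  {x | 0 < x.1 ∧ z₁ * x.1 ≤ x.2 ∧ x.2 ≤ z₂ * x.1}

theorem measurableSet_planarWedge (z₁ z₂ : ℝ) : MeasurableSet (planarWedge z₁ z₂) :=
  (measurableSet_lt measurable_const measurable_fst).inter
    ((measurableSet_le (by fun_prop) measurable_snd).inter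
      (measurableSet_le measurable_snd (by fun_prop)))

theorem integrableOn_planarWedge_exp (z₁ z₂ : ℝ) :
    IntegrableOn (fun x : ℝ × ℝ => Complex.exp (-x.1 + Complex.I * x.2)) (planarWedge z₁ z₂) := by
  set Z := max |z₁| |z₂| + 1
  have hZ : 0 < Z := by positivity
  have hZ1 : 1 ≤ Z := by
    have : 0 ≤ max |z₁| |z₂| := by positivity
    linarith
  refine ((integrable_exp_neg_mul_norm (volume : Measure (ℝ × ℝ))
    (δ := Z⁻¹) (by positivity)).integrableOn).mono' (by fun_prop) ?_
  filter_upwards [ae_restrict_mem (measurableSet_planarWedge z₁ z₂)] with x hx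
  obtain ⟨h0, h1, h2⟩ := hx
  rw [Complex.norm_exp, Real.exp_le_exp]
  simp only [Complex.add_re, Complex.neg_re, Complex.ofReal_re, Complex.mul_re, Complex.I_re,
    Complex.I_im, Complex.ofReal_im]
  have h3 : ‖x‖ ≤ Z * x.1 := by
    refine max_le ?_ ?_
    · rw [Real.norm_of_nonneg h0.le]
      nlinarith
    · rw [Real.norm_eq_abs, abs_le]
      have e1 : -z₁ ≤ Z - 1 := (neg_le_abs z₁).trans (by simp [Z])
      have e2 : z₂ ≤ Z - 1 := (le_abs_self z₂).trans (by simp [Z])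
      constructor <;> nlinarith
  have h4 : Z⁻¹ * ‖x‖ ≤ x.1 := by
    rw [inv_mul_le_iff₀ hZ]
    exact h3
  linarith

theorem integral_exp_neg_add_I_mul (z : ℝ) :
    IntegrableOn (fun p : ℝ => Complex.exp (-(1 - Complex.I * z) * p)) (Ioi 0) ∧
    ∫ p in Ioi (0 : ℝ), Complex.exp (-(1 - Complex.I * z) * p) = (1 - Complex.I * z)⁻¹ := by
  have hre : (-(1 - Complex.I * z)).re < 0 := by simp
  refine ⟨integrableOn_exp_mul_complex_Ioi hre 0, ?_⟩
  rw [integral_exp_mul_complex_Ioi hre]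
  rw [Complex.ofReal_zero, mul_zero, Complex.exp_zero, neg_div_neg_eq, one_div]

/-- Integrating in $q$ and then in $p$ gives $-i\big((1-iz_2)^{-1}-(1-iz_1)^{-1}\big)$, and
$z\mapsto(1-iz)^{-1}$ is injective. -/
theorem integral_planarWedge_exp_ne_zero {z₁ z₂ : ℝ} (hz : z₁ < z₂) :
    ∫ x in planarWedge z₁ z₂, Complex.exp (-x.1 + Complex.I * x.2) ≠ 0 := by
  have hval : ∫ x in planarWedge z₁ z₂, Complex.exp (-x.1 + Complex.I * x.2) =
      -Complex.I * ((1 - Complex.I * z₂)⁻¹ - (1 - Complex.I * z₁)⁻¹) := by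
    rw [← integral_indicator (measurableSet_planarWedge z₁ z₂), Measure.volume_eq_prod,
      integral_prod _ ((integrable_indicator_iff (measurableSet_planarWedge z₁ z₂)).2
        (integrableOn_planarWedge_exp z₁ z₂))]
    have hin : ∀ p : ℝ, ∫ q : ℝ, (planarWedge z₁ z₂).indicator
        (fun x : ℝ × ℝ => Complex.exp (-x.1 + Complex.I * x.2)) (p, q) =
        (Ioi 0).indicator (fun p : ℝ => -Complex.I * (Complex.exp (-(1 - Complex.I * z₂) * p) -
          Complex.exp (-(1 - Complex.I * z₁) * p))) p := by
      intro p
      by_cases hp : 0 < p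
      · have h1 : ∀ q : ℝ, (planarWedge z₁ z₂).indicator
            (fun x : ℝ × ℝ => Complex.exp (-x.1 + Complex.I * x.2)) (p, q) =
            (Icc (z₁ * p) (z₂ * p)).indicator
              (fun q : ℝ => Complex.exp (-p) * Complex.exp (Complex.I * q)) q := by
          intro q
          by_cases hq : q ∈ Icc (z₁ * p) (z₂ * p)
          · rw [indicator_of_mem hq, indicator_of_mem (show (p, q) ∈ planarWedge z₁ z₂ from
              ⟨hp, hq.1, hq.2⟩), ← Complex.exp_add]
          · rw [indicator_of_notMem hq, indicator_of_notMem fun h => hq ⟨h.2.1, h.2.2⟩]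
        simp_rw [h1]
        rw [integral_indicator measurableSet_Icc, integral_Icc_eq_integral_Ioc,
          ← intervalIntegral.integral_of_le (by nlinarith), intervalIntegral.integral_const_mul,
          integral_exp_mul_complex Complex.I_ne_zero, indicator_of_mem (show p ∈ Ioi 0 from hp),
          div_eq_mul_inv, Complex.inv_I]
        have e : ∀ z : ℝ, Complex.exp (-(1 - Complex.I * z) * p) =
            Complex.exp (-p) * Complex.exp (Complex.I * ((z * p : ℝ) : ℂ)) := fun z => by
          rw [← Complex.exp_add]
          congr 1
          push_cast
          ring
        rw [e, e]
        ring
      · rw [indicator_of_notMem (show p ∉ Ioi 0 from hp)]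
        refine integral_eq_zero_of_ae (ae_of_all _ fun q => ?_)
        exact indicator_of_notMem (fun h => hp h.1) _
    simp_rw [hin]
    rw [integral_indicator measurableSet_Ioi, integral_const_mul,
      integral_sub (integral_exp_neg_add_I_mul z₂).1 (integral_exp_neg_add_I_mul z₁).1,
      (integral_exp_neg_add_I_mul z₁).2, (integral_exp_neg_add_I_mul z₂).2]
  rw [hval]
  refine mul_ne_zero (by simp) (sub_ne_zero.2 fun h => hz.ne ?_)
  have := congrArg Complex.im (inv_injective h)
  simp at this
  linarith

/-! ### Circular cones -/

/-- The closed circular cone with unit axis `v` and half opening angle `arccos κ`. -/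
def circularCone {n : ℕ} (v : EuclideanSpace ℝ (Fin n)) (κ : ℝ) :
    Set (EuclideanSpace ℝ (Fin n)) :=
  {y | κ * ‖y‖ ≤ inner ℝ v y}

section CircularCone

variable {n : ℕ} {v : EuclideanSpace ℝ (Fin n)} {κ : ℝ}

theorem isSolidCone_circularCone (hv : ‖v‖ = 1) (h0 : 0 < κ) (h1 : κ < 1) :
    IsSolidCone (circularCone v κ) where
  isClosed := isClosed_le (by fun_prop) (by fun_prop)
  smul_mem t ht y hy := by
    have hy : κ * ‖y‖ ≤ inner ℝ v y := hy
    change κ * ‖t • y‖ ≤ inner ℝ v (t • y)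
    rw [norm_smul, Real.norm_of_nonneg ht, inner_smul_right]
    nlinarith
  add_mem y hy z hz := by
    have hy : κ * ‖y‖ ≤ inner ℝ v y := hy
    have hz : κ * ‖z‖ ≤ inner ℝ v z := hz
    change κ * ‖y + z‖ ≤ inner ℝ v (y + z)
    rw [inner_add_right]
    have := mul_le_mul_of_nonneg_left (norm_add_le y z) h0.le
    linarith
  interior_nonempty := by
    refine ⟨v, mem_interior.2 ⟨{y | κ * ‖y‖ < inner ℝ v y}, fun y hy =>
      le_of_lt (show κ * ‖y‖ < inner ℝ v y from hy),
      isOpen_lt (by fun_prop) (by fun_prop), ?_⟩⟩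
    simp [hv, h1]
  exists_norm_le_inner := ⟨v, κ, h0, fun _ hy => hy⟩

theorem isDecayingOn_circularCone (h0 : 0 < κ) (w : EuclideanSpace ℝ (Fin n)) :
    IsDecayingOn (circularCone v κ) (complexCovector (-v) w) := by
  refine ⟨κ, h0, fun y hy => ?_⟩
  rw [complexCovector_apply_re, inner_neg_left]
  exact neg_le_neg hy

theorem covectorSq_complexCovector_neg_eq_zero {w : EuclideanSpace ℝ (Fin n)} (hv : ‖v‖ = 1)
    (hw : ‖w‖ = 1) (hvw : inner ℝ v w = 0) : covectorSq (complexCovector (-v) w) = 0 := by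
  rw [covectorSq_complexCovector, norm_neg, hv, hw, inner_neg_left, hvw]
  simp

/-- Here $p$ is the axial coordinate and $R$ the squared distance from the axis;
$\sqrt{1-\kappa^2}/\kappa$ is the tangent of the half angle $\arccos\kappa$. Removing the apex makes
$p>0$ strict, and then squaring is reversible. -/
theorem mem_circularCone_diff_zero_iff (h0 : 0 < κ) (h1 : κ < 1)
    {y : EuclideanSpace ℝ (Fin n)} {p R : ℝ} (hp : inner ℝ v y = p) (hR : ‖y‖ ^ 2 = p ^ 2 + R) :
    y ∈ circularCone v κ \ {0} ↔ 0 < p ∧ R ≤ (√(1 - κ ^ 2) / κ * p) ^ 2 := by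
  have ht : (√(1 - κ ^ 2) / κ * p) ^ 2 = (1 - κ ^ 2) / κ ^ 2 * p ^ 2 := by
    rw [mul_pow, div_pow, Real.sq_sqrt (by nlinarith)]
  have h2 : R ≤ (1 - κ ^ 2) / κ ^ 2 * p ^ 2 ↔ (κ * ‖y‖) ^ 2 ≤ p ^ 2 := by
    rw [mul_pow, hR, div_mul_eq_mul_div, le_div_iff₀ (by positivity)]
    constructor <;> intro h <;> nlinarith
  have hk : κ * ‖y‖ = |κ * ‖y‖| := (abs_of_nonneg (by positivity)).symm
  rw [ht, h2, sq_le_sq, ← hk]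
  change (κ * ‖y‖ ≤ inner ℝ v y ∧ y ≠ 0) ↔ _
  rw [hp]
  constructor
  · rintro ⟨h3, h4⟩
    have : 0 < κ * ‖y‖ := mul_pos h0 (norm_pos_iff.2 h4)
    exact ⟨by linarith, h3.trans (le_abs_self p)⟩
  · rintro ⟨h3, h4⟩
    rw [abs_of_pos h3] at h4
    refine ⟨h4, fun hy => h3.ne' ?_⟩
    rw [← hp, hy, inner_zero_right]

theorem laplaceIntegral_eq_setIntegral_diff [NeZero n] (K : Set (EuclideanSpace ℝ (Fin n)))
    (ℓ : EuclideanSpace ℝ (Fin n) →L[ℝ] ℂ) :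
    laplaceIntegral K ℓ = ∫ y in K \ {0}, Complex.exp (ℓ y) := by
  have : Nonempty (Fin n) := ⟨0⟩
  exact (setIntegral_congr_set (sdiff_null_ae_eq_self (measure_singleton 0))).symm

/-- With real part along the negative axis and imaginary part along the orthogonal unit vector, the
transform is that of a symmetric wedge $|q|\le tp$. -/
theorem exists_null_covector_circularCone_two {v : EuclideanSpace ℝ (Fin 2)} {κ : ℝ}
    (hv : ‖v‖ = 1) (h0 : 0 < κ) (h1 : κ < 1) :
    ∃ ℓ : EuclideanSpace ℝ (Fin 2) →L[ℝ] ℂ, IsDecayingOn (circularCone v κ) ℓ ∧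
      covectorSq ℓ = 0 ∧ laplaceIntegral (circularCone v κ) ℓ ≠ 0 := by
  obtain ⟨b, rfl⟩ := exists_orthonormalBasis_zero_eq hv
  obtain ⟨e, he, hey⟩ := exists_measurableEquiv_inner_two b
  refine ⟨complexCovector (-b 0) (b 1), isDecayingOn_circularCone h0 _,
    covectorSq_complexCovector_neg_eq_zero hv (b.norm_eq_one 1)
      (b.inner_eq_zero (by decide)), ?_⟩
  set t := √(1 - κ ^ 2) / κ
  have ht : 0 < t := div_pos (Real.sqrt_pos.2 (by nlinarith)) h0
  have hset : circularCone (b 0) κ \ {0} = e ⁻¹' planarWedge (-t) t := by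
    ext y
    rw [mem_circularCone_diff_zero_iff h0 h1 rfl (norm_sq_eq_two b y), mem_preimage, hey]
    refine and_congr_right fun hp => ?_
    rw [sq_le_sq, abs_of_pos (mul_pos ht hp), abs_le, neg_mul]
  rw [laplaceIntegral_eq_setIntegral_diff, hset]
  have h2 := he.setIntegral_preimage_emb e.measurableEmbedding
    (fun x : ℝ × ℝ => Complex.exp (-x.1 + Complex.I * x.2)) (planarWedge (-t) t)
  have h3 : ∀ y, Complex.exp (complexCovector (-b 0) (b 1) y) =
      Complex.exp (-((e y).1 : ℂ) + Complex.I * ((e y).2 : ℂ)) := fun y => by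
    rw [complexCovector_apply, hey, inner_neg_left, Complex.ofReal_neg]
  simp_rw [h3]
  rw [h2]
  exact integral_planarWedge_exp_ne_zero (by linarith)

/-! ### The transform of a circular cone in space -/

/-- The round cone `{(p, r, q) : 0 < p, r² + q² ≤ (t p)²}`. -/
def roundCone (t : ℝ) : Set (ℝ × ℝ × ℝ) :=
  {x | 0 < x.1 ∧ x.2.1 ^ 2 + x.2.2 ^ 2 ≤ (t * x.1) ^ 2}

theorem measurableSet_roundCone (t : ℝ) : MeasurableSet (roundCone t) :=
  (measurableSet_lt measurable_const measurable_fst).inter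
    (measurableSet_le (f := fun x : ℝ × ℝ × ℝ => x.2.1 ^ 2 + x.2.2 ^ 2)
      (g := fun x : ℝ × ℝ × ℝ => (t * x.1) ^ 2) (by fun_prop) (by fun_prop))

theorem integrableOn_mul_exp_neg : IntegrableOn (fun p : ℝ => p * Real.exp (-p)) (Ioi 0) := by
  have := Real.GammaIntegral_convergent (s := 2) two_pos
  refine this.congr_fun (fun p hp => ?_) measurableSet_Ioi
  norm_num
  ring

theorem integral_mul_exp_neg_mul_sin (m : ℝ) :
    ∫ p in Ioi (0 : ℝ), p * Real.exp (-p) * Real.sin (p * m) = 2 * m / (1 + m ^ 2) ^ 2 := by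
  have hm : 1 + m ^ 2 ≠ 0 := by positivity
  -- The imaginary part of $-e^{-ap}(p/a+1/a^2)$ with $a=1-im$, a primitive of $pe^{-ap}$.
  set A : ℝ → ℝ := fun p => -Real.exp (-p) * (p / (1 + m ^ 2) * (m * Real.cos (p * m) +
    Real.sin (p * m)) + (2 * m * Real.cos (p * m) + (1 - m ^ 2) * Real.sin (p * m)) /
      (1 + m ^ 2) ^ 2) with hA
  have hderiv : ∀ p : ℝ, HasDerivAt A (p * Real.exp (-p) * Real.sin (p * m)) p := by
    intro p
    have he : HasDerivAt (fun p : ℝ => Real.exp (-p)) (-Real.exp (-p)) p := by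
      simpa using (hasDerivAt_neg p).exp
    have hlin : HasDerivAt (fun p : ℝ => p * m) m p := by
      simpa using (hasDerivAt_id p).mul_const m
    have hc := hlin.cos
    have hs := hlin.sin
    have := he.neg.mul ((((hasDerivAt_id p).div_const (1 + m ^ 2)).mul
      ((hc.const_mul m).add hs)).add
      (((hc.const_mul (2 * m)).add (hs.const_mul (1 - m ^ 2))).div_const ((1 + m ^ 2) ^ 2)))
    refine this.congr_deriv ?_
    simp only [Pi.add_apply, Pi.mul_apply, Pi.neg_apply, id]
    field_simp
    ring
  have hint : IntegrableOn (fun p : ℝ => p * Real.exp (-p) * Real.sin (p * m)) (Ioi 0) := by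
    refine integrableOn_mul_exp_neg.mul_bdd (c := 1) (by fun_prop) (ae_of_all _ fun p => ?_)
    exact Real.abs_sin_le_one _
  have hlim : Tendsto A atTop (𝓝 0) := by
    have e1 : Tendsto (fun p : ℝ => p * Real.exp (-p)) atTop (𝓝 0) := by
      simpa using Real.tendsto_pow_mul_exp_neg_atTop_nhds_zero 1
    have e0 : Tendsto (fun p : ℝ => Real.exp (-p)) atTop (𝓝 0) :=
      Real.tendsto_exp_neg_atTop_nhds_zero
    have hb : Tendsto (fun p : ℝ => (p * Real.exp (-p)) * (|m| + 1) +
        Real.exp (-p) * (2 * |m| + |1 - m ^ 2|)) atTop (𝓝 0) := by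
      simpa using (e1.mul_const (|m| + 1)).add (e0.mul_const (2 * |m| + |1 - m ^ 2|))
    refine squeeze_zero_norm' ?_ hb
    filter_upwards [eventually_ge_atTop 0] with p hp
    have hc := Real.abs_cos_le_one (p * m)
    have hs := Real.abs_sin_le_one (p * m)
    have hm1 : 1 ≤ 1 + m ^ 2 := by nlinarith [sq_nonneg m]
    have b1 : |m * Real.cos (p * m) + Real.sin (p * m)| ≤ |m| + 1 := by
      refine (abs_add_le _ _).trans (add_le_add ?_ hs)
      rw [abs_mul]
      exact mul_le_of_le_one_right (abs_nonneg _) hc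
    have b2 : |2 * m * Real.cos (p * m) + (1 - m ^ 2) * Real.sin (p * m)| ≤
        2 * |m| + |1 - m ^ 2| := by
      refine (abs_add_le _ _).trans (add_le_add ?_ ?_)
      · rw [abs_mul, abs_mul, abs_two]
        exact mul_le_of_le_one_right (by positivity) hc
      · rw [abs_mul]
        exact mul_le_of_le_one_right (abs_nonneg _) hs
    have b3 : |p / (1 + m ^ 2)| ≤ p := by
      rw [abs_of_nonneg (by positivity)]
      exact div_le_self hp hm1
    have b4 : ∀ x : ℝ, |x / (1 + m ^ 2) ^ 2| ≤ |x| := fun x => by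
      rw [abs_div, abs_of_nonneg (show (0 : ℝ) ≤ (1 + m ^ 2) ^ 2 by positivity)]
      exact div_le_self (abs_nonneg _) (one_le_pow₀ hm1)
    rw [hA, Real.norm_eq_abs, abs_mul, abs_neg, abs_of_pos (Real.exp_pos _)]
    calc _ ≤ Real.exp (-p) * (p * (|m| + 1) + (2 * |m| + |1 - m ^ 2|)) := by
          gcongr
          refine (abs_add_le _ _).trans (add_le_add ?_ ((b4 _).trans b2))
          rw [abs_mul]
          gcongr
      _ = _ := by ring
  rw [integral_Ioi_of_hasDerivAt_of_tendsto' (fun p _ => hderiv p) hint hlim]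
  simp [hA]

theorem integral_Icc_exp_I_mul (a : ℝ) (ha : 0 ≤ a) :
    ∫ q in Icc (-a) a, Complex.exp (Complex.I * q) = ((2 * Real.sin a : ℝ) : ℂ) := by
  rw [integral_Icc_eq_integral_Ioc, ← intervalIntegral.integral_of_le (by linarith),
    integral_exp_mul_complex Complex.I_ne_zero, mul_comm Complex.I, mul_comm Complex.I,
    Complex.exp_mul_I, Complex.exp_mul_I, Complex.ofReal_neg, Complex.cos_neg, Complex.sin_neg,
    div_eq_mul_inv, Complex.inv_I]
  push_cast
  ring_nf
  rw [Complex.I_sq]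
  ring

theorem integrableOn_roundCone_exp {t : ℝ} (ht : 0 < t) :
    IntegrableOn (fun x : ℝ × ℝ × ℝ => Complex.exp (-x.1 + Complex.I * x.2.2)) (roundCone t) := by
  have : (volume : Measure (ℝ × ℝ × ℝ)).IsAddHaarMeasure := by
    have : (volume : Measure (ℝ × ℝ)).IsAddHaarMeasure := inferInstance
    rw [Measure.volume_eq_prod]
    infer_instance
  refine ((integrable_exp_neg_mul_norm (volume : Measure (ℝ × ℝ × ℝ))
    (δ := (t + 1)⁻¹) (by positivity)).integrableOn).mono' (by fun_prop) ?_
  filter_upwards [ae_restrict_mem (measurableSet_roundCone t)] with x hx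
  obtain ⟨h0, h1⟩ := hx
  rw [Complex.norm_exp, Real.exp_le_exp]
  simp only [Complex.add_re, Complex.neg_re, Complex.ofReal_re, Complex.mul_re, Complex.I_re,
    Complex.I_im, Complex.ofReal_im]
  have htp : 0 < t * x.1 := mul_pos ht h0
  have h3 : ‖x‖ ≤ (t + 1) * x.1 := by
    refine max_le ?_ (max_le ?_ ?_)
    · rw [Real.norm_of_nonneg h0.le]
      nlinarith
    · refine (abs_le_of_sq_le_sq (b := t * x.1) (by nlinarith [sq_nonneg x.2.2]) htp.le).trans ?_
      nlinarith
    · refine (abs_le_of_sq_le_sq (b := t * x.1) (by nlinarith [sq_nonneg x.2.1]) htp.le).trans ?_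
      nlinarith
  have h4 : (t + 1)⁻¹ * ‖x‖ ≤ x.1 := by
    rw [inv_mul_le_iff₀ (by positivity)]
    exact h3
  linarith

/-- The $q$-integral over a chord gives $2\sin\sqrt{(tp)^2-r^2}$. Putting $r=ps$ turns this into
$2\sin(p\sqrt{t^2-s^2})$ with Jacobian $p$, and after exchanging the order the $p$-integral is
elementary. What remains is visibly nonnegative. -/
theorem integral_roundCone_exp {t : ℝ} (ht : 0 < t) :
    ∫ x in roundCone t, Complex.exp (-x.1 + Complex.I * x.2.2) =
      ((∫ s : ℝ, 4 * √(t ^ 2 - s ^ 2) / (1 + √(t ^ 2 - s ^ 2) ^ 2) ^ 2 : ℝ) : ℂ) := by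
  set G : ℝ × ℝ × ℝ → ℂ :=
    (roundCone t).indicator fun x => Complex.exp (-x.1 + Complex.I * x.2.2) with hG
  have hGi : Integrable G :=
    (integrable_indicator_iff (measurableSet_roundCone t)).2 (integrableOn_roundCone_exp ht)
  have hq : ∀ p > 0, ∀ r : ℝ, ∫ q : ℝ, G (p, r, q) =
      ((Real.exp (-p) * (2 * Real.sin √((t * p) ^ 2 - r ^ 2)) : ℝ) : ℂ) := by
    intro p hp r
    by_cases hr : r ^ 2 ≤ (t * p) ^ 2
    · have h1 : ∀ q : ℝ, G (p, r, q) = (Icc (-√((t * p) ^ 2 - r ^ 2)) √((t * p) ^ 2 - r ^ 2)).indicator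
          (fun q : ℝ => Complex.exp (-p) * Complex.exp (Complex.I * q)) q := by
        intro q
        have hiff : (p, r, q) ∈ roundCone t ↔
            q ∈ Icc (-√((t * p) ^ 2 - r ^ 2)) √((t * p) ^ 2 - r ^ 2) := by
          rw [mem_Icc, ← abs_le, ← Real.sqrt_sq_eq_abs,
            Real.sqrt_le_sqrt_iff (sub_nonneg.2 hr)]
          change (0 < p ∧ r ^ 2 + q ^ 2 ≤ (t * p) ^ 2) ↔ _
          constructor
          · rintro ⟨-, h⟩
            linarith
          · intro h
            exact ⟨hp, by linarith⟩
        by_cases hm : (p, r, q) ∈ roundCone t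
        · rw [hG, indicator_of_mem hm, indicator_of_mem (hiff.1 hm), ← Complex.exp_add]
        · rw [hG, indicator_of_notMem hm, indicator_of_notMem fun h => hm (hiff.2 h)]
      simp_rw [h1]
      rw [integral_indicator measurableSet_Icc, integral_const_mul,
        integral_Icc_exp_I_mul _ (Real.sqrt_nonneg _)]
      push_cast
      rfl
    · have h1 : ∀ q : ℝ, G (p, r, q) = 0 := fun q =>
        indicator_of_notMem (fun h => hr (by nlinarith [h.2, sq_nonneg q])) _
      simp_rw [h1]
      -- Off the cone the formula persists, since the real square root of a negative number is 0.
      rw [Real.sqrt_eq_zero_of_nonpos (by linarith)]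
      simp
  have hp0 : ∀ p ≤ 0, ∀ x, G (p, x) = 0 := fun p hp x =>
    indicator_of_notMem (fun h => absurd h.1 (not_lt.2 hp)) _
  have hslice : ∀ᵐ p : ℝ, ∫ x : ℝ × ℝ, G (p, x) = (Ioi (0 : ℝ)).indicator (fun p =>
      ((∫ s : ℝ, 2 * (p * Real.exp (-p) * Real.sin (p * √(t ^ 2 - s ^ 2))) : ℝ) : ℂ)) p := by
    filter_upwards [hGi.prod_right_ae] with p hpi
    by_cases hp : 0 < p
    · rw [indicator_of_mem (show p ∈ Ioi (0 : ℝ) from hp), Measure.volume_eq_prod,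
        integral_prod _ hpi]
      simp_rw [hq p hp]
      rw [integral_complex_ofReal]
      congr 1
      have h2 := Measure.integral_comp_inv_mul_left
        (fun s : ℝ => 2 * (p * Real.exp (-p) * Real.sin (p * √(t ^ 2 - s ^ 2)))) p
      rw [abs_of_pos hp, smul_eq_mul] at h2
      rw [← mul_right_inj' hp.ne', ← h2, ← integral_const_mul]
      refine integral_congr_ae (ae_of_all _ fun r => ?_)
      have h3 : p * √(t ^ 2 - (p⁻¹ * r) ^ 2) = √((t * p) ^ 2 - r ^ 2) := by
        nth_rw 1 [← Real.sqrt_sq hp.le]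
        rw [← Real.sqrt_mul (sq_nonneg p)]
        congr 1
        field_simp
      simp only [h3]
      ring
    · rw [indicator_of_notMem (show p ∉ Ioi (0 : ℝ) from hp)]
      simp [hp0 p (not_lt.1 hp)]
  have hswap : Integrable (Function.uncurry fun p s : ℝ =>
      2 * (p * Real.exp (-p) * Real.sin (p * √(t ^ 2 - s ^ 2))))
      ((volume.restrict (Ioi (0 : ℝ))).prod volume) := by
    have h1 : Integrable (fun x : ℝ × ℝ => (x.1 * Real.exp (-x.1)) *
        (Icc (-t) t).indicator (fun _ => (2 : ℝ)) x.2)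
        ((volume.restrict (Ioi (0 : ℝ))).prod volume) :=
      Integrable.mul_prod integrableOn_mul_exp_neg
        ((integrable_indicator_iff measurableSet_Icc).2 (by simp))
    refine h1.mono ?_ (ae_of_all _ fun x => ?_)
    · refine Continuous.aestronglyMeasurable ?_
      unfold Function.uncurry
      fun_prop
    · simp only [Function.uncurry]
      by_cases hx : x.2 ∈ Icc (-t) t
      · rw [indicator_of_mem hx, norm_mul, norm_mul _ (Real.sin _), norm_mul _ (2 : ℝ), mul_comm]
        gcongr
        exact mul_le_of_le_one_right (norm_nonneg _) (Real.abs_sin_le_one _)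
      · have : t ^ 2 - x.2 ^ 2 ≤ 0 := by
          by_contra h
          push Not at h
          exact hx (abs_le.1 (abs_le_of_sq_le_sq (by linarith) ht.le))
        rw [Real.sqrt_eq_zero_of_nonpos this, indicator_of_notMem hx]
        simp
  rw [← integral_indicator (measurableSet_roundCone t), Measure.volume_eq_prod,
    integral_prod _ hGi, integral_congr_ae hslice, integral_indicator measurableSet_Ioi,
    integral_complex_ofReal, integral_integral_swap hswap]
  congr 1
  refine integral_congr_ae (ae_of_all _ fun s => ?_)
  simp only
  rw [integral_const_mul, integral_mul_exp_neg_mul_sin]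
  ring

theorem integral_roundCone_exp_ne_zero {t : ℝ} (ht : 0 < t) :
    ∫ x in roundCone t, Complex.exp (-x.1 + Complex.I * x.2.2) ≠ 0 := by
  rw [integral_roundCone_exp ht, Complex.ofReal_ne_zero]
  refine (Continuous.integral_pos_of_hasCompactSupport_nonneg_nonzero (x := 0) ?_ ?_ ?_ ?_).ne'
  · refine Continuous.div (by fun_prop) (by fun_prop) fun s => ?_
    have : 0 < 1 + √(t ^ 2 - s ^ 2) ^ 2 := by positivity
    exact (pow_pos this 2).ne'
  · refine HasCompactSupport.intro (isCompact_Icc (a := -t) (b := t)) fun s hs => ?_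
    have : t ^ 2 - s ^ 2 ≤ 0 := by
      by_contra h
      push Not at h
      exact hs (abs_le.1 (abs_le_of_sq_le_sq (by linarith) ht.le))
    rw [Real.sqrt_eq_zero_of_nonpos this]
    simp
  · intro s
    rw [Pi.zero_apply]
    positivity
  · have : 0 < √(t ^ 2 - 0 ^ 2) := Real.sqrt_pos.2 (by simpa using pow_pos ht 2)
    positivity

theorem exists_null_covector_circularCone_three {v : EuclideanSpace ℝ (Fin 3)} {κ : ℝ}
    (hv : ‖v‖ = 1) (h0 : 0 < κ) (h1 : κ < 1) :
    ∃ ℓ : EuclideanSpace ℝ (Fin 3) →L[ℝ] ℂ, IsDecayingOn (circularCone v κ) ℓ ∧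
      covectorSq ℓ = 0 ∧ laplaceIntegral (circularCone v κ) ℓ ≠ 0 := by
  obtain ⟨b, rfl⟩ := exists_orthonormalBasis_zero_eq hv
  obtain ⟨e, he, hey⟩ := exists_measurableEquiv_inner_three b
  refine ⟨complexCovector (-b 0) (b 2), isDecayingOn_circularCone h0 _,
    covectorSq_complexCovector_neg_eq_zero hv (b.norm_eq_one 2)
      (b.inner_eq_zero (by decide)), ?_⟩
  set t := √(1 - κ ^ 2) / κ
  have ht : 0 < t := div_pos (Real.sqrt_pos.2 (by nlinarith)) h0
  have hset : circularCone (b 0) κ \ {0} = e ⁻¹' roundCone t := by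
    ext y
    rw [mem_circularCone_diff_zero_iff h0 h1 rfl
      ((norm_sq_eq_three b y).trans (add_assoc _ _ _)), mem_preimage, hey]
    rfl
  rw [laplaceIntegral_eq_setIntegral_diff, hset]
  have h2 := he.setIntegral_preimage_emb e.measurableEmbedding
    (fun x : ℝ × ℝ × ℝ => Complex.exp (-x.1 + Complex.I * x.2.2)) (roundCone t)
  have h3 : ∀ y, Complex.exp (complexCovector (-b 0) (b 2) y) =
      Complex.exp (-((e y).1 : ℂ) + Complex.I * ((e y).2.2 : ℂ)) := fun y => by
    rw [complexCovector_apply, hey, inner_neg_left, Complex.ofReal_neg]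
  simp_rw [h3]
  rw [h2]
  exact integral_roundCone_exp_ne_zero ht

end CircularCone

/-! ### Polyhedral cones -/

section EdgeCone

variable {K : Set (EuclideanSpace ℝ (Fin 3))}

theorem IsDecayingOn.integrableOn_exp {n : ℕ} {K : Set (EuclideanSpace ℝ (Fin n))}
    {ℓ : EuclideanSpace ℝ (Fin n) →L[ℝ] ℂ} (hℓ : IsDecayingOn K ℓ) (hK : MeasurableSet K) :
    IntegrableOn (fun y => Complex.exp (ℓ y)) K := by
  obtain ⟨δ, hδ, h⟩ := hℓ
  refine (integrable_exp_neg_mul_norm volume hδ).integrableOn.mono' (by fun_prop) ?_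
  filter_upwards [ae_restrict_mem hK] with y hy
  rw [Complex.norm_exp, Real.exp_le_exp]
  exact h y hy

/-- Only negative $s$ matters; then $|\varepsilon s|\le\varepsilon Mp\le p/4$, and replacing
$\varepsilon s$ by $|\varepsilon s|$ costs twice that, at most $p/2$. -/
theorem exp_edge_estimate {s p M ε : ℝ} (hp : 0 ≤ p) (hε : 0 < ε) (hεM : ε * M ≤ 1 / 4)
    (hs : -(M * p) ≤ s) : |ε * s| + p / 2 ≤ ε * s + p := by
  rcases abs_cases (ε * s) with ⟨h, -⟩ | ⟨h, -⟩ <;> rw [h] <;> nlinarith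

/-- As the real part of the covector tends to a covector that vanishes along an edge of `K`, the
Laplace transform of `K`, suitably scaled, tends to that of the wedge that `K` spans transversally
to the edge. -/
theorem exists_null_covector_of_edge (hK : IsSolidCone K)
    (b : OrthonormalBasis (Fin 3) ℝ (EuclideanSpace ℝ (Fin 3))) {M z₁ z₂ : ℝ}
    (hz : z₁ < z₂) (hb : b 0 ∈ K) (hs : ∀ y ∈ K, -(M * inner ℝ (b 1) y) ≤ inner ℝ (b 0) y)
    (hp : ∀ y ∈ K, 0 ≤ inner ℝ (b 1) y)
    (hq₁ : ∀ y ∈ K, z₁ * inner ℝ (b 1) y ≤ inner ℝ (b 2) y)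
    (hq₂ : ∀ y ∈ K, inner ℝ (b 2) y ≤ z₂ * inner ℝ (b 1) y)
    (hsurj : ∀ x ∈ planarWedge z₁ z₂, ∃ y ∈ K, inner ℝ (b 1) y = x.1 ∧ inner ℝ (b 2) y = x.2) :
    ∃ ℓ : EuclideanSpace ℝ (Fin 3) →L[ℝ] ℂ, IsDecayingOn K ℓ ∧
      covectorSq ℓ = 0 ∧ laplaceIntegral K ℓ ≠ 0 := by
  obtain ⟨e, he, hey⟩ := exists_measurableEquiv_inner_three b
  have hKm : MeasurableSet K := hK.isClosed.measurableSet
  have h3 : (volume : Measure (ℝ × ℝ × ℝ)).IsAddHaarMeasure := by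
    have : (volume : Measure (ℝ × ℝ)).IsAddHaarMeasure := inferInstance
    rw [Measure.volume_eq_prod]
    infer_instance
  set Z := max |z₁| |z₂| + 1 with hZdef
  have hZ : 1 ≤ Z := by
    have : 0 ≤ max |z₁| |z₂| := by positivity
    linarith
  have hqZ : ∀ y ∈ K, |inner ℝ (b 2) y| ≤ Z * inner ℝ (b 1) y := fun y hy => by
    have e1 : -z₁ ≤ Z := (neg_le_abs z₁).trans ((le_max_left _ |z₂|).trans (by simp [Z]))
    have e2 : z₂ ≤ Z := (le_abs_self z₂).trans ((le_max_right |z₁| _).trans (by simp [Z]))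
    have e3 := hp y hy
    have e4 := hq₁ y hy
    have e5 := hq₂ y hy
    rw [abs_le]
    constructor <;> nlinarith
  -- This is the length of $\varepsilon b_0+b_1$, so the imaginary part $\kappa b_2$ makes the
  -- covector null. Here $b_0$ points along the edge and $b_1$ is nonnegative on the cone.
  set κ : ℝ → ℝ := fun ε => √(1 + ε ^ 2) with hκ
  set ℓ : ℝ → EuclideanSpace ℝ (Fin 3) →L[ℝ] ℂ := fun ε =>
    complexCovector (-(ε • b 0 + b 1)) (κ ε • b 2) with hℓdef
  have hnull : ∀ ε, covectorSq (ℓ ε) = 0 := by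
    intro ε
    have h01 : inner ℝ (b 0) (b 1) = 0 := b.inner_eq_zero (by decide)
    have h02 : inner ℝ (b 0) (b 2) = 0 := b.inner_eq_zero (by decide)
    have h12 : inner ℝ (b 1) (b 2) = 0 := b.inner_eq_zero (by decide)
    have hn : ‖ε • b 0 + b 1‖ ^ 2 = 1 + ε ^ 2 := by
      rw [norm_add_sq_real, norm_smul, inner_smul_left, h01, b.norm_eq_one, b.norm_eq_one]
      simp [add_comm]
    have hκn : ‖κ ε • b 2‖ ^ 2 = 1 + ε ^ 2 := by
      rw [norm_smul, b.norm_eq_one, mul_one, Real.norm_eq_abs, sq_abs,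
        Real.sq_sqrt (by positivity)]
    rw [covectorSq_complexCovector, norm_neg, hn, hκn, inner_neg_left, inner_add_left,
      inner_smul_left, inner_smul_right, inner_smul_right, h02, h12]
    simp
  have hdec : ∀ ε, 0 < ε → ε * M ≤ 1 / 4 → IsDecayingOn K (ℓ ε) := by
    intro ε hε hεM
    refine ⟨min ε (1 / (2 * (1 + Z))), lt_min hε (by positivity), fun y hy => ?_⟩
    rw [complexCovector_apply_re, inner_neg_left, inner_add_left, real_inner_smul_left]
    have h1 := exp_edge_estimate (hp y hy) hε hεM (hs y hy)
    rw [abs_mul, abs_of_pos hε] at h1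
    have hp' := hp y hy
    have hn : ‖y‖ ≤ |inner ℝ (b 0) y| + (1 + Z) * inner ℝ (b 1) y := by
      refine abs_le_of_sq_le_sq ?_ (by positivity) |> (abs_norm y ▸ ·)
      rw [norm_sq_eq_three b y, ← sq_abs (inner ℝ (b 0) y), ← sq_abs (inner ℝ (b 2) y)]
      have h2 := hqZ y hy
      have h4 := abs_nonneg (inner ℝ (b 2) y)
      have h5 := abs_nonneg (inner ℝ (b 0) y)
      have h6 : |inner ℝ (b 0) y| + inner ℝ (b 1) y + |inner ℝ (b 2) y| ≤
        |inner ℝ (b 0) y| + (1 + Z) * inner ℝ (b 1) y := by linarith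
      refine le_trans ?_ (pow_le_pow_left₀ (by positivity) h6 2)
      nlinarith [mul_nonneg h5 hp', mul_nonneg h5 h4, mul_nonneg hp' h4]
    have h7 : min ε (1 / (2 * (1 + Z))) * ‖y‖ ≤
        ε * |inner ℝ (b 0) y| + 1 / (2 * (1 + Z)) * ((1 + Z) * inner ℝ (b 1) y) := by
      refine (mul_le_mul_of_nonneg_left hn (le_min hε.le (by positivity))).trans ?_
      rw [mul_add]
      gcongr
      · exact min_le_left _ _
      · exact min_le_right _ _
    have h8 : 1 / (2 * (1 + Z)) * ((1 + Z) * inner ℝ (b 1) y) = inner ℝ (b 1) y / 2 := by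
      field_simp
    linarith
  set S : Set (ℝ × ℝ × ℝ) := e.symm ⁻¹' K with hSdef
  have hSm : MeasurableSet S := e.symm.measurable hKm
  have hS : ∀ x ∈ S, ∃ y ∈ K, inner ℝ (b 0) y = x.1 ∧ inner ℝ (b 1) y = x.2.1 ∧
      inner ℝ (b 2) y = x.2.2 := fun x hx => by
    have h1 := hey (e.symm x)
    rw [e.apply_symm_apply] at h1
    exact ⟨e.symm x, hx, (congrArg Prod.fst h1).symm, (congrArg (fun z => z.2.1) h1).symm,
      (congrArg (fun z => z.2.2) h1).symm⟩
  set Φ : ℝ → ℝ × ℝ × ℝ → ℂ := fun ε => S.indicator fun x =>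
    Complex.exp (-(ε * x.1 : ℝ) - x.2.1 + Complex.I * (κ ε * x.2.2 : ℝ)) with hΦ
  have hKS : K = e ⁻¹' S := by
    ext y
    simp [hSdef]
  have hcomp : ∀ ε y, Complex.exp (ℓ ε y) = Complex.exp (-(ε * (e y).1 : ℝ) - (e y).2.1 +
      Complex.I * (κ ε * (e y).2.2 : ℝ)) := fun ε y => by
    rw [complexCovector_apply, hey, inner_neg_left, inner_add_left, real_inner_smul_left,
      real_inner_smul_left]
    congr 1
    push_cast
    ring
  have hΦint : ∀ ε, ∫ x, Φ ε x = laplaceIntegral K (ℓ ε) := by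
    intro ε
    rw [laplaceIntegral, hKS]
    simp_rw [hcomp]
    rw [he.setIntegral_preimage_emb e.measurableEmbedding (fun x : ℝ × ℝ × ℝ =>
      Complex.exp (-(ε * x.1 : ℝ) - x.2.1 + Complex.I * (κ ε * x.2.2 : ℝ))) S,
      ← integral_indicator hSm]
  have hΦi : ∀ ε, 0 < ε → ε * M ≤ 1 / 4 → Integrable (Φ ε) := by
    intro ε hε hεM
    have h1 := (hdec ε hε hεM).integrableOn_exp hKm
    simp_rw [hcomp] at h1
    rw [integrable_indicator_iff hSm]
    rw [hKS] at h1
    exact (he.integrableOn_comp_preimage e.measurableEmbedding (f := fun x : ℝ × ℝ × ℝ =>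
      Complex.exp (-(ε * x.1 : ℝ) - x.2.1 + Complex.I * (κ ε * x.2.2 : ℝ)))).1 h1
  -- As $\varepsilon\to0$ the decay along the edge is lost. Stretching the edge coordinate by
  -- $\varepsilon^{-1}$ restores it, with a majorant independent of $\varepsilon$.
  have hbound : ∀ ε, 0 < ε → ε * M ≤ 1 / 4 → ∀ x : ℝ × ℝ × ℝ,
      ‖Φ ε (ε⁻¹ * x.1, x.2)‖ ≤ Real.exp (-((2 * Z)⁻¹ * ‖x‖)) := by
    intro ε hε hεM x
    by_cases hx : (ε⁻¹ * x.1, x.2) ∈ S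
    · obtain ⟨y, hy, h0, h1, h2⟩ := hS _ hx
      simp only [hΦ]
      rw [indicator_of_mem hx, Complex.norm_exp, Real.exp_le_exp]
      have h4 := exp_edge_estimate (hp y hy) hε hεM (hs y hy)
      have h5 := hqZ y hy
      have h6 := hp y hy
      simp only at h0 h1 h2
      rw [h0, h1] at h4
      rw [h1, h2] at h5
      rw [h1] at h6
      rw [mul_inv_cancel_left₀ hε.ne'] at h4
      simp only [mul_inv_cancel_left₀ hε.ne', Complex.add_re, Complex.sub_re, Complex.neg_re,
        Complex.ofReal_re, Complex.mul_re, Complex.I_re, Complex.I_im, Complex.ofReal_im]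
      have h7 : (2 * Z)⁻¹ * ‖x‖ ≤ |x.1| + x.2.1 / 2 := by
        rw [inv_mul_le_iff₀ (by positivity)]
        have := abs_nonneg x.1
        refine max_le ?_ (max_le ?_ ?_)
        · rw [Real.norm_eq_abs]
          nlinarith
        · rw [Real.norm_of_nonneg h6]
          nlinarith
        · rw [Real.norm_eq_abs]
          nlinarith
      linarith
    · simp only [hΦ, indicator_of_notMem hx, norm_zero]
      positivity
  have hscale : ∀ ε, 0 < ε → ε * M ≤ 1 / 4 →
      ∫ x : ℝ × ℝ × ℝ, Φ ε (ε⁻¹ * x.1, x.2) = ε * laplaceIntegral K (ℓ ε) := by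
    intro ε hε hεM
    have hmeas : Measurable (Φ ε) := Measurable.indicator (by fun_prop) hSm
    have hi : Integrable (fun x : ℝ × ℝ × ℝ => Φ ε (ε⁻¹ * x.1, x.2)) :=
      (integrable_exp_neg_mul_norm volume (δ := (2 * Z)⁻¹) (by positivity)).mono'
        (hmeas.comp (by fun_prop)).aestronglyMeasurable (ae_of_all _ (hbound ε hε hεM))
    have h1 := integral_prod_symm _ hi
    have h2 := integral_prod_symm _ (hΦi ε hε hεM)
    rw [← hΦint, Measure.volume_eq_prod, h1, h2, ← integral_const_mul]
    refine integral_congr_ae (ae_of_all _ fun x => ?_)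
    have h5 := Measure.integral_comp_inv_mul_left (fun s => Φ ε (s, x)) ε
    rw [abs_of_pos hε, Complex.real_smul] at h5
    exact h5
  -- In the stretched coordinates the cone converges, up to null sets, to the product of a half-line
  -- and the transversal wedge, so the limit integrand factorizes.
  set G : ℝ × ℝ × ℝ → ℂ := fun x => (Ioi (0 : ℝ)).indicator (fun s : ℝ => Complex.exp (-s)) x.1 *
    (planarWedge z₁ z₂).indicator (fun x => Complex.exp (-x.1 + Complex.I * x.2)) x.2 with hG
  have hlim : Tendsto (fun ε : ℝ => ∫ x : ℝ × ℝ × ℝ, Φ ε (ε⁻¹ * x.1, x.2)) (𝓝[>] 0)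
      (𝓝 (∫ x, G x)) := by
    have hev : ∀ᶠ ε : ℝ in 𝓝[>] 0, 0 < ε ∧ ε * M ≤ 1 / 4 := by
      refine (eventually_mem_nhdsWithin).and ?_
      have : Tendsto (fun ε : ℝ => ε * M) (𝓝[>] 0) (𝓝 (0 * M)) :=
        ((continuous_id.mul continuous_const).tendsto 0).mono_left nhdsWithin_le_nhds
      rw [zero_mul] at this
      exact this.eventually_le_const (by norm_num)
    refine tendsto_integral_filter_of_dominated_convergence
      (fun x => Real.exp (-((2 * Z)⁻¹ * ‖x‖))) ?_ ?_
      (integrable_exp_neg_mul_norm volume (by positivity)) ?_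
    · filter_upwards with ε
      have hmeas : Measurable (Φ ε) := Measurable.indicator (by fun_prop) hSm
      exact (hmeas.comp (by fun_prop)).aestronglyMeasurable
    · filter_upwards [hev] with ε hε
      exact ae_of_all _ (hbound ε hε.1 hε.2)
    · have hne : ∀ᵐ s : ℝ, s ≠ 0 := compl_mem_ae_iff.2 (measure_singleton 0)
      have hne1 : ∀ᵐ x : ℝ × ℝ × ℝ, x.1 ≠ 0 := Measure.quasiMeasurePreserving_fst.ae hne
      have hne2 : ∀ᵐ x : ℝ × ℝ × ℝ, x.2.1 ≠ 0 :=
        (Measure.quasiMeasurePreserving_fst.comp Measure.quasiMeasurePreserving_snd).ae hne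
      filter_upwards [hne1, hne2] with x hx1 hx2
      by_cases hw : x.2 ∈ planarWedge z₁ z₂
      · rcases hx1.lt_or_gt with hneg | hpos
        · have hz : G x = 0 := by
            rw [hG]
            simp only
            rw [indicator_of_notMem (show x.1 ∉ Ioi (0 : ℝ) from not_lt.2 hneg.le), zero_mul]
          rw [hz]
          refine tendsto_const_nhds.congr' ?_
          -- A negative edge coordinate, once stretched, violates the lower bound $s\ge-Mp$ and
          -- leaves the cone.
          have hsm : ∀ᶠ ε : ℝ in 𝓝[>] 0, ε * (M * x.2.1) < -x.1 := by
            have : Tendsto (fun ε : ℝ => ε * (M * x.2.1)) (𝓝[>] 0) (𝓝 (0 * (M * x.2.1))) :=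
              ((continuous_id.mul continuous_const).tendsto 0).mono_left nhdsWithin_le_nhds
            rw [zero_mul] at this
            exact this.eventually_lt_const (by linarith)
          filter_upwards [hsm, self_mem_nhdsWithin] with ε h1 hε
          have hε : 0 < ε := hε
          refine (indicator_of_notMem (fun hx => ?_) _).symm
          obtain ⟨y, hy, h0, h1', -⟩ := hS _ hx
          have := hs y hy
          rw [h0, h1'] at this
          have h2 := mul_le_mul_of_nonneg_left this hε.le
          rw [mul_inv_cancel_left₀ hε.ne'] at h2
          linarith
        · have hg : G x = Complex.exp (-(x.1 : ℝ) - x.2.1 + Complex.I * (κ 0 * x.2.2 : ℝ)) := by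
            rw [hG]
            simp only
            rw [indicator_of_mem (show x.1 ∈ Ioi (0 : ℝ) from hpos), indicator_of_mem hw,
              ← Complex.exp_add]
            congr 1
            simp [hκ]
            ring
          rw [hg]
          have hc : Continuous fun ε : ℝ =>
              Complex.exp (-(x.1 : ℝ) - x.2.1 + Complex.I * (κ ε * x.2.2 : ℝ)) := by
            fun_prop
          refine ((hc.tendsto 0).mono_left nhdsWithin_le_nhds).congr' ?_
          -- Any point of the cone over the given wedge point can be pushed along the edge direction
          -- without leaving the cone, and so reaches every large edge coordinate.
          obtain ⟨y, hy, h1, h2⟩ := hsurj _ hw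
          have hsm : ∀ᶠ ε : ℝ in 𝓝[>] 0, ε * inner ℝ (b 0) y < x.1 := by
            have : Tendsto (fun ε : ℝ => ε * inner ℝ (b 0) y) (𝓝[>] 0)
                (𝓝 (0 * inner ℝ (b 0) y)) :=
              ((continuous_id.mul continuous_const).tendsto 0).mono_left nhdsWithin_le_nhds
            rw [zero_mul] at this
            exact this.eventually_lt_const hpos
          filter_upwards [hsm, self_mem_nhdsWithin] with ε h4 hε
          have hε : 0 < ε := hε
          have hmem : (ε⁻¹ * x.1, x.2) ∈ S := by
            have h5 : e (y + (ε⁻¹ * x.1 - inner ℝ (b 0) y) • b 0) = (ε⁻¹ * x.1, x.2) := by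
              have i1 : inner ℝ (b 1) (b 0) = 0 := b.inner_eq_zero (by decide)
              have i2 : inner ℝ (b 2) (b 0) = 0 := b.inner_eq_zero (by decide)
              rw [hey, inner_add_right, inner_add_right, inner_add_right, inner_smul_right,
                inner_smul_right, inner_smul_right, i1, i2, h1, h2, real_inner_self_eq_norm_sq,
                b.norm_eq_one]
              simp
            rw [hSdef, mem_preimage, ← h5, e.symm_apply_apply]
            refine hK.add_mem _ hy _ (hK.smul_mem _ ?_ _ hb)
            rw [sub_nonneg, le_inv_mul_iff₀ hε]
            exact h4.le
          rw [hΦ]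
          simp only
          rw [indicator_of_mem hmem]
          simp only [mul_inv_cancel_left₀ hε.ne']
      · have hz : G x = 0 := by
          rw [hG]
          simp only
          rw [indicator_of_notMem hw, mul_zero]
        rw [hz]
        refine tendsto_const_nhds.congr fun ε => (indicator_of_notMem (fun hx => hw ?_) _).symm
        obtain ⟨y, hy, -, h1, h2⟩ := hS _ hx
        have e1 := hp y hy
        have e2 := hq₁ y hy
        have e3 := hq₂ y hy
        rw [h1] at e1 e2 e3
        rw [h2] at e2 e3
        exact ⟨lt_of_le_of_ne e1 hx2.symm, e2, e3⟩
  have hGne : ∫ x, G x ≠ 0 := by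
    rw [hG, Measure.volume_eq_prod, integral_prod_mul, integral_indicator measurableSet_Ioi,
      integral_indicator (measurableSet_planarWedge z₁ z₂)]
    refine mul_ne_zero ?_ (integral_planarWedge_exp_ne_zero hz)
    have := (integral_exp_neg_add_I_mul 0).2
    simp only [Complex.ofReal_zero, mul_zero, sub_zero, neg_mul, one_mul, inv_one] at this
    rw [this]
    exact one_ne_zero
  have hev : ∀ᶠ ε : ℝ in 𝓝[>] 0, 0 < ε ∧ ε * M ≤ 1 / 4 := by
    refine (eventually_mem_nhdsWithin).and ?_
    have : Tendsto (fun ε : ℝ => ε * M) (𝓝[>] 0) (𝓝 (0 * M)) :=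
      ((continuous_id.mul continuous_const).tendsto 0).mono_left nhdsWithin_le_nhds
    rw [zero_mul] at this
    exact this.eventually_le_const (by norm_num)
  obtain ⟨ε, ⟨hε, hεM⟩, hne⟩ := (hev.and (hlim.eventually_ne hGne)).exists
  refine ⟨ℓ ε, hdec ε hε hεM, hnull ε, fun h => hne ?_⟩
  rw [hscale ε hε hεM, h, mul_zero]

end EdgeCone

/-! ### Finitely generated cones and an exposed edge -/

section Polyhedral

/-- The cone spanned by the vectors `e j`, with apex `0`. -/
def finiteCone {ℓ : ℕ} (e : Fin ℓ → EuclideanSpace ℝ (Fin 3)) : Set (EuclideanSpace ℝ (Fin 3)) :=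
  {y | ∃ t : Fin ℓ → ℝ, (∀ j, 0 ≤ t j) ∧ y = ∑ j, t j • e j}

variable {ℓ : ℕ} {e : Fin ℓ → EuclideanSpace ℝ (Fin 3)} {v : EuclideanSpace ℝ (Fin 3)} {κ : ℝ}

theorem mem_finiteCone_self (j : Fin ℓ) : e j ∈ finiteCone e :=
  ⟨Pi.single j 1, fun i => by
    by_cases h : i = j
    · subst h; simp
    · simp [h], by simp [Pi.single_apply, Finset.sum_ite_eq']⟩

theorem smul_mem_finiteCone {t : ℝ} (ht : 0 ≤ t) {y : EuclideanSpace ℝ (Fin 3)}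
    (hy : y ∈ finiteCone e) : t • y ∈ finiteCone e := by
  obtain ⟨c, hc, rfl⟩ := hy
  exact ⟨fun j => t * c j, fun j => mul_nonneg ht (hc j), by simp [Finset.smul_sum, smul_smul]⟩

theorem add_mem_finiteCone {y z : EuclideanSpace ℝ (Fin 3)} (hy : y ∈ finiteCone e)
    (hz : z ∈ finiteCone e) : y + z ∈ finiteCone e := by
  obtain ⟨c, hc, rfl⟩ := hy
  obtain ⟨d, hd, rfl⟩ := hz
  exact ⟨fun j => c j + d j, fun j => add_nonneg (hc j) (hd j),
    by simp [add_smul, Finset.sum_add_distrib]⟩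

theorem inner_le_inner_of_mem_finiteCone {a c : EuclideanSpace ℝ (Fin 3)}
    (h : ∀ j, inner ℝ a (e j) ≤ inner ℝ c (e j)) {y : EuclideanSpace ℝ (Fin 3)}
    (hy : y ∈ finiteCone e) : inner ℝ a y ≤ inner ℝ c y := by
  obtain ⟨t, ht, rfl⟩ := hy
  simp_rw [inner_sum, inner_smul_right]
  exact Finset.sum_le_sum fun j _ => mul_le_mul_of_nonneg_left (h j) (ht j)

theorem inner_pos_of_finiteCone_subset (h0 : 0 < κ) (he : ∀ j, e j ≠ 0)
    (hsub : finiteCone e ⊆ circularCone v κ) (j : Fin ℓ) : 0 < inner ℝ v (e j) :=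
  (mul_pos h0 (norm_pos_iff.2 (he j))).trans_le (hsub (mem_finiteCone_self j))

/-- Since `v` is positive on every generator, the coefficients of a bounded point are bounded.
Locally the cone is therefore contained in the image of a compact box, itself a closed subset of the
cone. -/
theorem isClosed_finiteCone (hv : ‖v‖ = 1) (hpos : ∀ j, 0 < inner ℝ v (e j)) :
    IsClosed (finiteCone e) := by
  refine isClosed_of_closure_subset fun y hy => ?_
  set T : (Fin ℓ → ℝ) → EuclideanSpace ℝ (Fin 3) := fun t => ∑ j, t j • e j
  have hT : Continuous T := by fun_prop
  set R := ‖y‖ + 1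
  have hbox : IsCompact (Icc (0 : Fin ℓ → ℝ) (fun j => R / inner ℝ v (e j))) := isCompact_Icc
  have hclosed : IsClosed (T '' Icc 0 (fun j => R / inner ℝ v (e j))) := (hbox.image hT).isClosed
  have h1 : ball 0 R ∩ finiteCone e ⊆ T '' Icc 0 (fun j => R / inner ℝ v (e j)) := by
    rintro _ ⟨hx, t, ht, rfl⟩
    refine ⟨t, ⟨fun j => ht j, fun j => ?_⟩, rfl⟩
    rw [le_div_iff₀ (hpos j)]
    have h2 : inner ℝ v (∑ j, t j • e j) ≤ R := by
      refine (real_inner_le_norm _ _).trans ?_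
      rw [hv, one_mul]
      exact (mem_ball_zero_iff.1 hx).le
    refine le_trans ?_ h2
    simp_rw [inner_sum, inner_smul_right]
    exact Finset.single_le_sum (f := fun j => t j * inner ℝ v (e j))
      (fun i _ => mul_nonneg (ht i) (hpos i).le) (Finset.mem_univ j)
  have h2 : y ∈ closure (ball 0 R ∩ finiteCone e) :=
    isOpen_ball.inter_closure ⟨by simp [R], hy⟩
  obtain ⟨t, ht, rfl⟩ := closure_minimal h1 hclosed h2
  exact ⟨t, fun j => ht.1 j, rfl⟩

theorem interior_finiteCone_nonempty (hspan : Submodule.span ℝ (range e) = ⊤) :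
    (interior (finiteCone e)).Nonempty := by
  have h0 : (0 : EuclideanSpace ℝ (Fin 3)) ∈ finiteCone e := ⟨0, fun _ => le_rfl, by simp⟩
  have hconv : Convex ℝ (finiteCone e) := fun x hx y hy a b ha hb _ =>
    add_mem_finiteCone (smul_mem_finiteCone ha hx) (smul_mem_finiteCone hb hy)
  rw [hconv.interior_nonempty_iff_affineSpan_eq_top,
    AffineSubspace.affineSpan_eq_top_iff_vectorSpan_eq_top_of_nonempty ℝ _ _ ⟨0, h0⟩, eq_top_iff,
    ← hspan, Submodule.span_le]
  rintro _ ⟨j, rfl⟩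
  simpa using vsub_mem_vectorSpan ℝ (mem_finiteCone_self j) h0

theorem isSolidCone_finiteCone (hv : ‖v‖ = 1) (h0 : 0 < κ) (he : ∀ j, e j ≠ 0)
    (hspan : Submodule.span ℝ (range e) = ⊤) (hsub : finiteCone e ⊆ circularCone v κ) :
    IsSolidCone (finiteCone e) where
  isClosed := isClosed_finiteCone hv (inner_pos_of_finiteCone_subset h0 he hsub)
  smul_mem _ ht _ hy := smul_mem_finiteCone ht hy
  add_mem _ hy _ hz := add_mem_finiteCone hy hz
  interior_nonempty := interior_finiteCone_nonempty hspan
  exists_norm_le_inner := ⟨v, κ, h0, fun _ hy => hsub hy⟩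

/-- A generator whose trace in the cross-section has maximal norm spans an exposed edge. -/
theorem exists_exposed_edge [Nonempty (Fin ℓ)] (hpos : ∀ j, 0 < inner ℝ v (e j))
    (hli : ∀ i j, i ≠ j → LinearIndependent ℝ ![e i, e j]) :
    ∃ (j : Fin ℓ) (a : EuclideanSpace ℝ (Fin 3)), inner ℝ a (e j) = 0 ∧
      ∀ k, k ≠ j → 0 < inner ℝ a (e k) := by
  set c : Fin ℓ → EuclideanSpace ℝ (Fin 3) := fun k => (inner ℝ v (e k))⁻¹ • e k with hc
  have hvc : ∀ k, inner ℝ v (c k) = 1 := fun k => by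
    rw [hc, inner_smul_right, inv_mul_cancel₀ (hpos k).ne']
  have hec : ∀ k, e k = inner ℝ v (e k) • c k := fun k => by
    rw [hc, smul_smul, mul_inv_cancel₀ (hpos k).ne', one_smul]
  obtain ⟨j, hj⟩ := Finite.exists_max fun k => ‖c k‖
  -- On the section $\langle v,\cdot\rangle=1$ this functional is $|c_j|^2-\langle
  -- c_j,\cdot\rangle$. Maximality of $|c_j|$ makes it nonnegative at every $c_k$, with equality
  -- only if $c_k=c_j$, which pairwise independence excludes.
  refine ⟨j, ‖c j‖ ^ 2 • v - c j, ?_, fun k hk => ?_⟩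
  · rw [hec j, inner_smul_right, inner_sub_left, real_inner_smul_left, hvc,
      real_inner_self_eq_norm_sq]
    simp
  · rw [hec k, inner_smul_right, inner_sub_left, real_inner_smul_left, hvc]
    refine mul_pos (hpos k) ?_
    by_contra hneg
    have h1 : ‖c j - c k‖ ^ 2 ≤ 0 := by
      rw [norm_sub_sq_real]
      have := pow_le_pow_left₀ (norm_nonneg _) (hj k) 2
      linarith
    have h2 : c j = c k := by
      rw [← sub_eq_zero, ← norm_eq_zero]
      exact pow_eq_zero_iff two_ne_zero |>.1 (le_antisymm h1 (sq_nonneg _))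
    have h3 := LinearIndependent.pair_iff.1 (hli j k hk.symm) (inner ℝ v (e j))⁻¹
      (-(inner ℝ v (e k))⁻¹) (by
        rw [neg_smul, ← sub_eq_add_neg, sub_eq_zero]
        exact h2)
    exact (inv_pos.2 (hpos j)).ne' h3.1

/-- The orthonormal basis is adapted to an exposed edge: $b_0$ along the edge and $b_1$ along the
functional exposing it. The slopes of the other generators in the $(b_1,b_2)$-plane determine the
transversal wedge. -/
theorem exists_null_covector_finiteCone (hv : ‖v‖ = 1) (h0 : 0 < κ) (hℓ : 3 ≤ ℓ)
    (hli : ∀ i j, i ≠ j → LinearIndependent ℝ ![e i, e j])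
    (hspan : Submodule.span ℝ (range e) = ⊤) (hsub : finiteCone e ⊆ circularCone v κ) :
    IsSolidCone (finiteCone e) ∧
    ∃ ℓ : EuclideanSpace ℝ (Fin 3) →L[ℝ] ℂ, IsDecayingOn (finiteCone e) ℓ ∧
      covectorSq ℓ = 0 ∧ laplaceIntegral (finiteCone e) ℓ ≠ 0 := by
  have : Nontrivial (Fin ℓ) := Fin.nontrivial_iff_two_le.2 (by omega)
  have he : ∀ j, e j ≠ 0 := fun j => by
    obtain ⟨i, hi⟩ := exists_ne j
    simpa using (hli j i hi.symm).ne_zero 0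
  have hK := isSolidCone_finiteCone hv h0 he hspan hsub
  refine ⟨hK, ?_⟩
  have hpos := inner_pos_of_finiteCone_subset h0 he hsub
  obtain ⟨j, a, haj, hak⟩ := exists_exposed_edge hpos hli
  obtain ⟨k₀, hk₀⟩ := exists_ne j
  have ha : a ≠ 0 := fun h => by
    have := hak k₀ hk₀
    rw [h, inner_zero_left] at this
    exact this.false
  obtain ⟨b, hb0, hb1⟩ := exists_orthonormalBasis_zero_one_eq (v := ‖e j‖⁻¹ • e j)
    (w := ‖a‖⁻¹ • a) (norm_smul_inv_norm (𝕜 := ℝ) (he j)) (norm_smul_inv_norm (𝕜 := ℝ) ha)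
    (by rw [real_inner_smul_left, inner_smul_right, real_inner_comm, haj]; simp)
  have hej : e j = ‖e j‖ • b 0 := by
    rw [hb0, smul_smul, mul_inv_cancel₀ (norm_ne_zero_iff.2 (he j)), one_smul]
  have hpj : inner ℝ (b 1) (e j) = 0 := by rw [hb1, real_inner_smul_left, haj, mul_zero]
  have hpk : ∀ k, k ≠ j → 0 < inner ℝ (b 1) (e k) := fun k hk => by
    rw [hb1, real_inner_smul_left]
    exact mul_pos (inv_pos.2 (norm_pos_iff.2 ha)) (hak k hk)
  have hqj : inner ℝ (b 2) (e j) = 0 := by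
    rw [hej, inner_smul_right, b.inner_eq_zero (by decide), mul_zero]
  have hsj : 0 ≤ inner ℝ (b 0) (e j) := by
    rw [hej, inner_smul_right, real_inner_self_eq_norm_sq]
    positivity
  have hne : (Finset.univ.erase j).Nonempty := ⟨k₀, by simp [hk₀]⟩
  obtain ⟨k₁, hk₁, hmin⟩ := Finset.exists_min_image (Finset.univ.erase j)
    (fun k => inner ℝ (b 2) (e k) / inner ℝ (b 1) (e k)) hne
  obtain ⟨k₂, hk₂, hmax⟩ := Finset.exists_max_image (Finset.univ.erase j)
    (fun k => inner ℝ (b 2) (e k) / inner ℝ (b 1) (e k)) hne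
  set z₁ := inner ℝ (b 2) (e k₁) / inner ℝ (b 1) (e k₁)
  set z₂ := inner ℝ (b 2) (e k₂) / inner ℝ (b 1) (e k₂)
  have hp₁ := hpk k₁ (Finset.ne_of_mem_erase hk₁)
  have hp₂ := hpk k₂ (Finset.ne_of_mem_erase hk₂)
  have hz₁ : ∀ k, z₁ * inner ℝ (b 1) (e k) ≤ inner ℝ (b 2) (e k) := fun k => by
    by_cases hk : k = j
    · rw [hk, hpj, hqj, mul_zero]
    · exact (le_div_iff₀ (hpk k hk)).1 (hmin k (by simp [hk]))
  have hz₂ : ∀ k, inner ℝ (b 2) (e k) ≤ z₂ * inner ℝ (b 1) (e k) := fun k => by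
    by_cases hk : k = j
    · rw [hk, hpj, hqj, mul_zero]
    · exact (div_le_iff₀ (hpk k hk)).1 (hmax k (by simp [hk]))
  -- If all slopes agreed, the generators would lie in the plane $q=z_1p$ and could not span.
  have hz : z₁ < z₂ := by
    refine lt_of_le_of_ne (hmin k₂ hk₂) fun heq => ?_
    have h1 : (innerSL ℝ (b 2 - z₁ • b 1) : EuclideanSpace ℝ (Fin 3) →ₗ[ℝ] ℝ) = 0 := by
      refine LinearMap.ext_on_range hspan fun k => ?_
      have h2 := hz₁ k
      have h3 := hz₂ k
      rw [← heq] at h3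
      simp
      linarith
    have h2 := LinearMap.congr_fun h1 (b 2)
    have h3 : inner ℝ (b 1) (b 2) = 0 := b.inner_eq_zero (by decide)
    simp [h3] at h2
  -- The term of the edge itself is a division by zero, hence 0; the bound needed there holds
  -- because its $b_0$-coordinate is nonnegative.
  set M := ∑ k, |inner ℝ (b 0) (e k)| / inner ℝ (b 1) (e k) with hMdef
  have hp : ∀ k, 0 ≤ inner ℝ (b 1) (e k) := fun k => by
    by_cases hk : k = j
    · rw [hk, hpj]
    · exact (hpk k hk).le
  have hMk : ∀ k, |inner ℝ (b 0) (e k)| / inner ℝ (b 1) (e k) ≤ M := fun k =>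
    Finset.single_le_sum (f := fun k => |inner ℝ (b 0) (e k)| / inner ℝ (b 1) (e k))
      (fun i _ => div_nonneg (abs_nonneg _) (hp i)) (Finset.mem_univ k)
  have hsk : ∀ k, -(M * inner ℝ (b 1) (e k)) ≤ inner ℝ (b 0) (e k) := fun k => by
    by_cases hk : k = j
    · rw [hk, hpj, mul_zero, neg_zero]
      exact hsj
    · have h1 := (div_le_iff₀ (hpk k hk)).1 (hMk k)
      have h2 := neg_abs_le (inner ℝ (b 0) (e k))
      linarith
  refine exists_null_covector_of_edge (M := M) hK b hz ?_ (fun y hy => ?_) (fun y hy => ?_)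
    (fun y hy => ?_) (fun y hy => ?_) fun x hx => ?_
  · rw [hb0]
    exact smul_mem_finiteCone (by positivity) (mem_finiteCone_self j)
  · have := inner_le_inner_of_mem_finiteCone (a := -(M • b 1)) (c := b 0) (fun k => by
      rw [inner_neg_left, real_inner_smul_left]; exact hsk k) hy
    rwa [inner_neg_left, real_inner_smul_left] at this
  · have := inner_le_inner_of_mem_finiteCone (a := 0) (c := b 1) (fun k => by
      rw [inner_zero_left]; exact hp k) hy
    rwa [inner_zero_left] at this
  · have := inner_le_inner_of_mem_finiteCone (a := z₁ • b 1) (c := b 2) (fun k => by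
      rw [real_inner_smul_left]; exact hz₁ k) hy
    rwa [real_inner_smul_left] at this
  · have := inner_le_inner_of_mem_finiteCone (a := b 2) (c := z₂ • b 1) (fun k => by
      rw [real_inner_smul_left]; exact hz₂ k) hy
    rwa [real_inner_smul_left] at this
  · obtain ⟨-, hx1, hx2⟩ := hx
    have hzz : 0 < z₂ - z₁ := sub_pos.2 hz
    have hq₁ : inner ℝ (b 2) (e k₁) = z₁ * inner ℝ (b 1) (e k₁) := (div_mul_cancel₀ _ hp₁.ne').symm
    have hq₂ : inner ℝ (b 2) (e k₂) = z₂ * inner ℝ (b 1) (e k₂) := (div_mul_cancel₀ _ hp₂.ne').symm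
    -- A point of the wedge is a nonnegative combination of its two boundary rays, which are the
    -- shadows of the generators with extreme slopes.
    refine ⟨((z₂ * x.1 - x.2) / ((z₂ - z₁) * inner ℝ (b 1) (e k₁))) • e k₁ +
      ((x.2 - z₁ * x.1) / ((z₂ - z₁) * inner ℝ (b 1) (e k₂))) • e k₂, ?_, ?_, ?_⟩
    · exact add_mem_finiteCone
        (smul_mem_finiteCone (div_nonneg (by linarith) (by positivity)) (mem_finiteCone_self _))
        (smul_mem_finiteCone (div_nonneg (by linarith) (by positivity)) (mem_finiteCone_self _))
    · rw [inner_add_right, inner_smul_right, inner_smul_right]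
      field_simp
      ring
    · rw [inner_add_right, inner_smul_right, inner_smul_right, hq₁, hq₂]
      field_simp
      ring

end Polyhedral

/-! ### Corners and the main theorem -/

section Corner

variable {n : ℕ}

theorem mem_conicCone_iff {x₀ v₀ x : EuclideanSpace ℝ (Fin n)} {θ : ℝ} (hv : v₀ ≠ 0) (hθ₀ : 0 < θ)
    (hθ : θ < Real.pi / 2) :
    x ∈ conicCone x₀ v₀ θ ↔ x - x₀ ∈ circularCone (‖v₀‖⁻¹ • v₀) (Real.cos θ) := by
  have hv' : 0 < ‖v₀‖ := norm_pos_iff.2 hv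
  change (x = x₀ ∨ InnerProductGeometry.angle (x - x₀) v₀ ≤ θ) ↔
    Real.cos θ * ‖x - x₀‖ ≤ inner ℝ (‖v₀‖⁻¹ • v₀) (x - x₀)
  rcases eq_or_ne x x₀ with rfl | hx
  · simp
  · have hx' : 0 < ‖x - x₀‖ := norm_pos_iff.2 (sub_ne_zero.2 hx)
    rw [or_iff_right hx, ← Real.strictAntiOn_cos.le_iff_ge ⟨hθ₀.le, by linarith [Real.pi_pos]⟩
      ⟨InnerProductGeometry.angle_nonneg _ _, InnerProductGeometry.angle_le_pi _ _⟩,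
      InnerProductGeometry.cos_angle, le_div_iff₀ (by positivity), real_inner_smul_left,
      real_inner_comm, le_inv_mul_iff₀ hv']
    constructor <;> intro h <;> linarith

theorem norm_inv_norm_smul {v₀ : EuclideanSpace ℝ (Fin n)} (hv : v₀ ≠ 0) :
    ‖‖v₀‖⁻¹ • v₀‖ = 1 :=
  norm_smul_inv_norm (𝕜 := ℝ) hv

theorem cos_pos_and_lt_one {θ : ℝ} (hθ₀ : 0 < θ) (hθ : θ < Real.pi / 2) :
    0 < Real.cos θ ∧ Real.cos θ < 1 := by
  refine ⟨Real.cos_pos_of_mem_Ioo ⟨by linarith, hθ⟩, ?_⟩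
  rw [← Real.cos_zero]
  exact Real.cos_lt_cos_of_nonneg_of_le_pi le_rfl (by linarith [Real.pi_pos]) hθ₀

/-- A convex corner is a truncated solid cone on which some null covector has a nonvanishing
Laplace transform. -/
theorem IsConvexCorner.exists_isSolidCone {x₀ : EuclideanSpace ℝ (Fin n)} {h : ℝ}
    {C : Set (EuclideanSpace ℝ (Fin n))} (hC : IsConvexCorner x₀ h C) :
    0 < h ∧ (n = 2 ∨ n = 3) ∧ ∃ K : Set (EuclideanSpace ℝ (Fin n)), IsSolidCone K ∧
      C = truncatedCone x₀ K h ∧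
      ∃ ℓ : EuclideanSpace ℝ (Fin n) →L[ℝ] ℂ, IsDecayingOn K ℓ ∧ covectorSq ℓ = 0 ∧
        laplaceIntegral K ℓ ≠ 0 := by
  obtain ⟨hh, ⟨hn, v₀, θ, hv, hθ₀, hθ, rfl⟩ |
    ⟨hn, l, e, hl, hli, hspan, ⟨v₀, θ, hv, hθ₀, hθ, hsub⟩, rfl⟩⟩ := hC
  · obtain ⟨hc0, hc1⟩ := cos_pos_and_lt_one hθ₀ hθ
    refine ⟨hh, hn, circularCone (‖v₀‖⁻¹ • v₀) (Real.cos θ),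
      isSolidCone_circularCone (norm_inv_norm_smul hv) hc0 hc1, ?_, ?_⟩
    · ext x
      exact and_congr_left fun _ => mem_conicCone_iff hv hθ₀ hθ
    · rcases hn with rfl | rfl
      · exact exists_null_covector_circularCone_two (norm_inv_norm_smul hv) hc0 hc1
      · exact exists_null_covector_circularCone_three (norm_inv_norm_smul hv) hc0 hc1
  · subst hn
    obtain ⟨hc0, hc1⟩ := cos_pos_and_lt_one hθ₀ hθ
    have hmem : ∀ x, x ∈ polyhedralCone x₀ e ↔ x - x₀ ∈ finiteCone e := fun x => by
      change (∃ t : Fin l → ℝ, _ ∧ x = x₀ + _) ↔ ∃ t : Fin l → ℝ, _ ∧ x - x₀ = _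
      simp_rw [sub_eq_iff_eq_add']
    obtain ⟨hK, hℓ⟩ := exists_null_covector_finiteCone (norm_inv_norm_smul hv) hc0 hl hli hspan
      fun y hy => by
        have h1 : x₀ + y ∈ polyhedralCone x₀ e := (hmem _).2 (by simpa using hy)
        simpa using (mem_conicCone_iff hv hθ₀ hθ).1 (hsub h1)
    refine ⟨hh, Or.inr rfl, finiteCone e, hK, ?_, hℓ⟩
    ext x
    exact and_congr_left fun _ => hmem x

theorem IsHolderNonlinearity.continuousOn_comp {C : Set (EuclideanSpace ℝ (Fin n))} {γ : ℝ≥0}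
    {f : EuclideanSpace ℝ (Fin n) → ℂ → ℂ} (hf : IsHolderNonlinearity C γ f) (hγ : 0 < γ)
    {u : EuclideanSpace ℝ (Fin n) → ℂ} (hu : ContinuousOn u C) :
    ContinuousOn (fun x => f x (u x)) C := by
  intro x hx
  -- Near `x` the values of `u` stay in this ball, so a single Hölder bound suffices.
  obtain ⟨M, hM⟩ := hf (‖u x‖ + 1)
  have h1 := hM.continuousOn hγ (x, u x) ⟨hx, by simp⟩
  refine h1.tendsto.comp (tendsto_nhdsWithin_iff.2
    ⟨(continuousWithinAt_id.prodMk (hu x hx)).tendsto, ?_⟩)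
  have h2 : ∀ᶠ y in 𝓝[C] x, ‖u y‖ < ‖u x‖ + 1 :=
    (hu x hx).norm.tendsto.eventually_lt_const (by linarith)
  filter_upwards [h2, self_mem_nhdsWithin] with y hy hyC
  exact ⟨hyC, by simpa using hy.le⟩

theorem IsWeakCauchySolution.congr_ae {x₀ : EuclideanSpace ℝ (Fin n)}
    {K : Set (EuclideanSpace ℝ (Fin n))} {h : ℝ} {w w' g g' : EuclideanSpace ℝ (Fin n) → ℂ}
    (hwg : IsWeakCauchySolution x₀ K h w g)
    (hw : ∀ᵐ x ∂(volume.restrict (truncatedCone x₀ K h)), w x = w' x)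
    (hg : ∀ᵐ x ∂(volume.restrict (truncatedCone x₀ K h)), g x = g' x) :
    IsWeakCauchySolution x₀ K h w' g' := by
  intro φ r hφ hr hφr
  rw [← integral_congr_ae (hw.mono fun x hx => congrArg (· * smoothLaplacian φ x) hx),
    ← integral_congr_ae (hg.mono fun x hx => congrArg (· * φ x) hx)]
  exact hwg φ r hφ hr hφr

end Corner

theorem theorem2p1 {n : ℕ} (x₀ : EuclideanSpace ℝ (Fin n)) (h : ℝ)
    (C : Set (EuclideanSpace ℝ (Fin n))) (hC : IsConvexCorner x₀ h C)
    (lam : ℂ) (γ : ℝ≥0) (hγ₀ : 0 < γ) (hγ₁ : γ < 1)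
    (f : EuclideanSpace ℝ (Fin n) → ℂ → ℂ) (hf : IsHolderNonlinearity C γ f)
    (u v : EuclideanSpace ℝ (Fin n) → ℂ)
    (Du Dv : Fin n → EuclideanSpace ℝ (Fin n) → ℂ)
    (D2u D2v : Fin n → Fin n → EuclideanSpace ℝ (Fin n) → ℂ)
    (hu : IsH2Loc C u Du D2u) (hv : IsH2Loc C v Dv D2v)
    (equ : ∀ᵐ x ∂(volume.restrict C), laplacianOf D2u x + f x (u x) = 0)
    (eqv : ∀ᵐ x ∂(volume.restrict C), laplacianOf D2v x + lam * v x = 0)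
    (hD : DirichletEqOn C (frontier C \ sphere x₀ h) u Du v Dv)
    (hN : NeumannEqOn C (frontier C \ sphere x₀ h) Du D2u Dv D2v) :
    ∃ u' : EuclideanSpace ℝ (Fin n) → ℂ,
      ContinuousOn u' C ∧ (∀ᵐ x ∂(volume.restrict C), u' x = u x) ∧
      lam * u' x₀ - f x₀ (u' x₀) = 0 := by
  obtain ⟨hh, hn, K, hK, rfl, ℓ, hℓ, hnull, hF⟩ := hC.exists_isSolidCone
  have hn3 : n ≤ 3 := by omega
  obtain ⟨u', hu'c, hu'⟩ := hu.exists_continuousOn_ae_eq hn3 hK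
  obtain ⟨v', hv'c, hv'⟩ := hv.exists_continuousOn_ae_eq hn3 hK
  refine ⟨u', hu'c, hu', ?_⟩
  have hg : ContinuousOn (fun x => lam * v' x - f x (u' x)) (truncatedCone x₀ K h) :=
    (continuousOn_const.mul hv'c).sub (hf.continuousOn_comp hγ₀ hu'c)
  have hweak : IsWeakCauchySolution x₀ K h (fun x => u' x - v' x)
      (fun x => lam * v' x - f x (u' x)) := by
    refine (isWeakCauchySolution_of_cauchyData hK hh hu hv hD hN).congr_ae ?_ ?_
    · filter_upwards [hu', hv'] with x h1 h2
      rw [h1, h2]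
    · filter_upwards [hu', hv', equ, eqv] with x h1 h2 h3 h4
      rw [h1, h2]
      linear_combination h3 - h4
  have hw0 := hweak.apex_eq_zero (by omega) hK hh (hu'c.sub hv'c) hg
  have hg0 := hweak.laplacian_apex_eq_zero hK hh (hu'c.sub hv'c) hg hℓ hnull hF
  -- The weak equation gives $\lambda v'(x_0)=f(x_0,u'(x_0))$; the vanishing of $u'-v'$ at the apex
  -- replaces $v'$ by $u'$.
  rw [sub_eq_zero.1 hw0]
  rwa [sub_eq_zero.1 hw0] at hg0
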